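/- A degree-three series-parallel digraph is a two-terminal series-parallel directed multigraph (built from single edges by series and parallel compositions) in which every vertex has at most three incident edges; it is given by the preorder string of a decomposition tree, and $n\ge 2$ denotes its number of vertices. In an orthogonal drawing the vertices are distinct points of the integer grid and every edge is a path of horizontal and vertical segments with its bends at grid points; edges may cross, but they do not overlap or touch elsewhere, and they do not pass through vertices. A vertex is a junction if its in-degree is strictly greater than its out-degree. The drawing is Knuthian if no edge enters a non-junction vertex from below or leaves a non-junction vertex upwards. Width and height are the numbers of grid columns and rows of the bounding box, and the area is their product. Theorem (Fixed-Width Drawings). There is an algorithm which, given a degree-three series-parallel digraph with $n$ vertices and an integer $A\ge\log n$, computes in time $O(n)$ (on a random access machine with words of $O(\log(n+A))$ bits) a Knuthian drawing of it with width $O(A+\log n)$, height $O(\lceil n/A\rceil\log n)$ (which is $O((n/A)\log n)$ for $A\le n$), area $O(n\log n)$, and at most $3.5n+o(n)$ bends in total. Moreover, for a suitable choice of $A=A(n)\ge\log n$ these drawings have constant aspect ratio: width and height are within a constant factor of each other. The constants and the $o(n)$ term depend neither on the digraph nor on $A$. -/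

import Mathlib

namespace Knuthian

/-! Directed multigraphs -/

/-- A finite directed multigraph with vertices `0, …, n - 1` and edges `0, …, m - 1`. -/
structure MDigraph where
  n : ℕ
  m : ℕ
  src : Fin m → Fin n
  tgt : Fin m → Fin n

namespace MDigraph

def inDegree (G : MDigraph) (v : Fin G.n) : ℕ :=
  (Finset.univ.filter fun e => G.tgt e = v).card

def outDegree (G : MDigraph) (v : Fin G.n) : ℕ :=
  (Finset.univ.filter fun e => G.src e = v).card

/-- No vertex has more than three incident edges. -/
def DegreeThree (G : MDigraph) : Prop :=
  ∀ v, G.inDegree v + G.outDegree v ≤ 3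

/-- A junction is a vertex whose in-degree is strictly greater than its out-degree. -/
def IsJunction (G : MDigraph) (v : Fin G.n) : Prop :=
  G.outDegree v < G.inDegree v

end MDigraph

/-! Two-terminal series-parallel digraphs, given by their decomposition trees -/

/-- Decomposition trees of two-terminal series-parallel digraphs: a single edge from the source
to the sink, a series composition (the sink of the first part is identified with the source of
the second) or a parallel composition (the sources are identified, and so are the sinks). -/
inductive SPTree : Type
  | edge : SPTree
  | series : SPTree → SPTree → SPTree
  | parallel : SPTree → SPTree → SPTree

namespace SPTree

/-- Number of vertices other than the two terminals: one for every series composition. -/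
def inner : SPTree → ℕ
  | edge => 0
  | series l r => l.inner + r.inner + 1
  | parallel l r => l.inner + r.inner

/-- The edges, in preorder, of the digraph with source `s` and sink `t`, whose inner vertices are
numbered `k, k + 1, …`; the vertex made by a series composition comes before the inner vertices of
its two parts. -/
def edgesFrom : SPTree → ℕ → ℕ → ℕ → List (ℕ × ℕ)
  | edge, s, t, _ => [(s, t)]
  | series l r, s, t, k =>
      l.edgesFrom s k (k + 1) ++ r.edgesFrom k t (k + 1 + l.inner)
  | parallel l r, s, t, k =>
      l.edgesFrom s t k ++ r.edgesFrom s t (k + l.inner)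

theorem edgesFrom_lt (T : SPTree) : ∀ {s t k N : ℕ}, s < N → t < N → k + T.inner ≤ N →
    ∀ p ∈ T.edgesFrom s t k, p.1 < N ∧ p.2 < N := by
  induction T with
  | edge => intro s t k N hs ht _ p hp; simp only [edgesFrom, List.mem_singleton] at hp
            subst hp; exact ⟨hs, ht⟩
  | series l r ihl ihr =>
    intro s t k N hs ht hk p hp
    simp only [inner] at hk
    simp only [edgesFrom, List.mem_append] at hp
    rcases hp with hp | hp
    · exact ihl hs (by omega) (by omega) p hp
    · exact ihr (by omega) ht (by omega) p hp
  | parallel l r ihl ihr =>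
    intro s t k N hs ht hk p hp
    simp only [inner] at hk
    simp only [edgesFrom, List.mem_append] at hp
    rcases hp with hp | hp
    · exact ihl hs ht (by omega) p hp
    · exact ihr hs ht (by omega) p hp

/-- Number of vertices of the digraph. -/
def numNodes (T : SPTree) : ℕ := T.inner + 2

/-- All edges: the source is vertex `0`, the sink is vertex `1`, and the inner vertices are
`2, 3, …`. -/
def edges (T : SPTree) : List (ℕ × ℕ) := T.edgesFrom 0 1 2

theorem edges_lt (T : SPTree) (e : Fin T.edges.length) :
    (T.edges.get e).1 < T.numNodes ∧ (T.edges.get e).2 < T.numNodes :=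
  T.edgesFrom_lt (by simp [numNodes]) (by simp [numNodes]) (by simp [numNodes, add_comm]) _
    (List.get_mem _ _)

/-- The series-parallel digraph with decomposition tree `T`. -/
def graph (T : SPTree) : MDigraph where
  n := T.numNodes
  m := T.edges.length
  src e := ⟨(T.edges.get e).1, (T.edges_lt e).1⟩
  tgt e := ⟨(T.edges.get e).2, (T.edges_lt e).2⟩

/-- The preorder traversal of the tree, as a string over `{0, 1, 2}`. -/
def code : SPTree → List ℤ
  | edge => [0]
  | series l r => 1 :: (l.code ++ r.code)
  | parallel l r => 2 :: (l.code ++ r.code)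

end SPTree

/-! Orthogonal and Knuthian drawings -/

/-- The data of a drawing on the integer grid: a point for every vertex, and for every edge `e` a
polygonal path with the `bends e + 2` corners `pt e 0, …, pt e (bends e + 1)` (values of `pt e`
at larger arguments are meaningless). The second coordinate of a point grows upwards. -/
structure Drawing (G : MDigraph) where
  pos : Fin G.n → ℤ × ℤ
  bends : Fin G.m → ℕ
  pt : Fin G.m → ℕ → ℤ × ℤ

namespace Drawing

variable {G : MDigraph}

/-- The grid points on the `i`-th segment of the path of `e` (an axis-parallel segment is the box
spanned by its two ends). Since all ends of segments are grid points, two such segments meet in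
the plane only if they share a grid point, and overlap only if they share two. -/
def seg (D : Drawing G) (e : Fin G.m) (i : ℕ) : Set (ℤ × ℤ) :=
  Set.uIcc (D.pt e i) (D.pt e (i + 1))

/-- Orthogonal grid drawings. Different edges may cross, in a point interior to one segment of
each, but they neither overlap nor touch, and no edge passes through a vertex. -/
structure IsOrthogonal (D : Drawing G) : Prop where
  /-- Different vertices are at different points. -/
  pos_injective : Function.Injective D.pos
  /-- The path of an edge leads from its source to its target. -/
  start : ∀ e, D.pt e 0 = D.pos (G.src e)
  finish : ∀ e, D.pt e (D.bends e + 1) = D.pos (G.tgt e)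
  /-- Every segment is horizontal or vertical and has positive length. -/
  axis : ∀ e, ∀ i ≤ D.bends e,
    Xor ((D.pt e i).1 = (D.pt e (i + 1)).1) ((D.pt e i).2 = (D.pt e (i + 1)).2)
  /-- Consecutive segments are perpendicular, so that every inner corner is a bend. -/
  turn : ∀ e, ∀ i < D.bends e,
    (D.pt e i).1 ≠ (D.pt e (i + 2)).1 ∧ (D.pt e i).2 ≠ (D.pt e (i + 2)).2
  /-- The path of an edge does not meet itself. -/
  simple : ∀ e i j, i < j → j ≤ D.bends e → (D.seg e i ∩ D.seg e j).Nonempty → j = i + 1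
  /-- A path meets vertices only at its two ends. -/
  avoids : ∀ v e, ∀ i ≤ D.bends e, D.pos v ∈ D.seg e i →
    (i = 0 ∧ v = G.src e) ∨ (i = D.bends e ∧ v = G.tgt e)
  /-- Different edges do not overlap. -/
  no_overlap : ∀ e f, e ≠ f → ∀ i ≤ D.bends e, ∀ j ≤ D.bends f,
    (D.seg e i ∩ D.seg f j).Subsingleton
  /-- No bend of an edge lies on another edge. -/
  no_touch : ∀ e f, e ≠ f → ∀ i < D.bends e, ∀ j ≤ D.bends f, D.pt e (i + 1) ∉ D.seg f j

/-- An orthogonal drawing is Knuthian if no edge leaves a non-junction out of its top or enters a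
non-junction into its bottom. -/
structure IsKnuthian (D : Drawing G) : Prop where
  orthogonal : D.IsOrthogonal
  no_up_out : ∀ e, ¬ G.IsJunction (G.src e) → ¬ (D.pt e 0).2 < (D.pt e 1).2
  no_up_in : ∀ e, ¬ G.IsJunction (G.tgt e) →
    ¬ (D.pt e (D.bends e)).2 < (D.pt e (D.bends e + 1)).2

/-- All vertices and all corners of edges. -/
def points (D : Drawing G) : Finset (ℤ × ℤ) :=
  Finset.univ.image D.pos ∪
    Finset.univ.biUnion fun e => (Finset.range (D.bends e + 2)).image (D.pt e)

/-- The width: the number of grid columns of the bounding box. -/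
def width (D : Drawing G) : ℕ :=
  ((D.points ×ˢ D.points).sup fun q => (q.1.1 - q.2.1).natAbs) + 1

/-- The height: the number of grid rows of the bounding box. -/
def height (D : Drawing G) : ℕ :=
  ((D.points ×ˢ D.points).sup fun q => (q.1.2 - q.2.2).natAbs) + 1

def area (D : Drawing G) : ℕ := D.width * D.height

def totalBends (D : Drawing G) : ℕ := ∑ e, D.bends e

end Drawing

/-! Random access machines -/

/-- A memory state: integer registers, and integer arrays (a program mentions finitely many of
either). -/
structure State where
  reg : ℕ → ℤ
  arr : ℕ → ℤ → ℤ

inductive RExpr : Type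
  | const : ℤ → RExpr
  | reg : ℕ → RExpr
  | get : ℕ → RExpr → RExpr
  | plus : RExpr → RExpr → RExpr
  | minus : RExpr → RExpr → RExpr
  | times : RExpr → RExpr → RExpr
  | quot : RExpr → RExpr → RExpr

namespace RExpr

def eval (s : State) : RExpr → ℤ
  | const c => c
  | reg x => s.reg x
  | get a i => s.arr a (i.eval s)
  | plus e f => e.eval s + f.eval s
  | minus e f => e.eval s - f.eval s
  | times e f => e.eval s * f.eval s
  | quot e f => e.eval s / f.eval s

/-- Number of elementary operations in the evaluation of an expression. -/
def cost : RExpr → ℕ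
  | const _ => 1
  | reg _ => 1
  | get _ i => i.cost + 1
  | plus e f => e.cost + f.cost + 1
  | minus e f => e.cost + f.cost + 1
  | times e f => e.cost + f.cost + 1
  | quot e f => e.cost + f.cost + 1

end RExpr

/-- Structured programs of a random access machine; tests ask whether an expression is positive. -/
inductive Prog : Type
  | skip : Prog
  | assign : ℕ → RExpr → Prog
  | store : ℕ → RExpr → RExpr → Prog
  | seq : Prog → Prog → Prog
  | branch : RExpr → Prog → Prog → Prog
  | loop : RExpr → Prog → Prog

/-- `Exec B p s s' t`: started in state `s`, the program `p` halts in state `s'` after exactly `t`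
elementary steps, and all values that it stores, and all addresses at which it stores them, have
absolute value at most `B`. -/
inductive Exec (B : ℤ) : Prog → State → State → ℕ → Prop
  | skip (s : State) : Exec B Prog.skip s s 1
  | assign (x : ℕ) (e : RExpr) (s : State) (he : |e.eval s| ≤ B) :
      Exec B (Prog.assign x e) s ⟨Function.update s.reg x (e.eval s), s.arr⟩ (e.cost + 1)
  | store (a : ℕ) (i e : RExpr) (s : State) (hi : |i.eval s| ≤ B) (he : |e.eval s| ≤ B) :
      Exec B (Prog.store a i e) s
        ⟨s.reg, Function.update s.arr a (Function.update (s.arr a) (i.eval s) (e.eval s))⟩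
        (i.cost + e.cost + 1)
  | seq {p q : Prog} {s₁ s₂ s₃ : State} {t₁ t₂ : ℕ} (hp : Exec B p s₁ s₂ t₁)
      (hq : Exec B q s₂ s₃ t₂) : Exec B (Prog.seq p q) s₁ s₃ (t₁ + t₂)
  | branch_pos {e : RExpr} {p q : Prog} {s s' : State} {t : ℕ} (he : 0 < e.eval s)
      (hp : Exec B p s s' t) : Exec B (Prog.branch e p q) s s' (e.cost + 1 + t)
  | branch_neg {e : RExpr} {p q : Prog} {s s' : State} {t : ℕ} (he : ¬ 0 < e.eval s)
      (hq : Exec B q s s' t) : Exec B (Prog.branch e p q) s s' (e.cost + 1 + t)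
  | loop_done {e : RExpr} {p : Prog} {s : State} (he : ¬ 0 < e.eval s) :
      Exec B (Prog.loop e p) s s (e.cost + 1)
  | loop_step {e : RExpr} {p : Prog} {s₁ s₂ s₃ : State} {t₁ t₂ : ℕ} (he : 0 < e.eval s₁)
      (hp : Exec B p s₁ s₂ t₁) (hl : Exec B (Prog.loop e p) s₂ s₃ t₂) :
      Exec B (Prog.loop e p) s₁ s₃ (e.cost + 1 + t₁ + t₂)

/-- The input: array `0` holds the preorder string of the decomposition tree, register `0` its
length and register `1` the number `A`. Everything else is `0`. -/
def inputState (T : SPTree) (A : ℕ) : State where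
  reg x := if x = 0 then (T.code.length : ℤ) else if x = 1 then (A : ℤ) else 0
  arr a i := if a = 0 ∧ 0 ≤ i then T.code.getD i.toNat 0 else 0

/-- The output: arrays `1` and `2` hold the coordinates of the vertices, array `3` the number of
bends of each edge, array `4` the place in arrays `5` and `6` where the list of the coordinates of
the corners of that edge begins. -/
structure Encodes {G : MDigraph} (s : State) (D : Drawing G) : Prop where
  vertex : ∀ v : Fin G.n, (s.arr 1 (v : ℕ), s.arr 2 (v : ℕ)) = D.pos v
  bends : ∀ e : Fin G.m, s.arr 3 (e : ℕ) = D.bends e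
  corner : ∀ e : Fin G.m, ∀ i ≤ D.bends e + 1,
    (s.arr 5 (s.arr 4 (e : ℕ) + i), s.arr 6 (s.arr 4 (e : ℕ) + i)) = D.pt e i

/-- On input `T`, `A`, the program halts within `t` steps with the drawing `D` as its output, and
all numbers that it stores have absolute value at most `B`. -/
def Computes (P : Prog) (T : SPTree) (A : ℕ) (D : Drawing T.graph) (t B : ℕ) : Prop :=
  ∃ s' t', Exec (B : ℤ) P (inputState T A) s' t' ∧ t' ≤ t ∧ Encodes s' D

end Knuthian

/-! The vertices are put on a line, and the line is then cut into rows. Recursion over the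
decomposition tree gives every vertex a place on the line and a slot. A series composition places
its new vertex first, then the part with at most as many inner vertices as the other, then the other
part; a parallel composition only orders its two parts in this way. The new vertex takes one of the
three slots of the current pool `d` that neither terminal has. The part that comes first continues
with pool `d + 1`, the second one reuses pool `d`. Since a step to a deeper pool at least halves the
number of inner vertices, there are only `O(log n)` slots (`SPTree.Cons.sg_lt`). The track of an
edge is the slot of its early end combined with its port there. By `SPTree.Cons.before`, edges with
different early ends of the same slot occupy disjoint intervals of the line, so any two edges on one
track are disjoint.

A `Layout` turns such data into a drawing. A row of `W` places is a band of `2 * L` horizontal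
lanes, where `L` is the number of tracks. An edge within a row runs in the lane of its track. An
edge between rows runs to the right into a margin column given by its track, down to the row of its
late end, and back to the left; for this last piece the upper half of the band is reserved, because
it reaches from the late end to the margin and thus leaves the interval of the edge. A vertex lies
on the upper one of the lanes of its edges at ports 0 and 1. The edge of that lane, the main edge,
leaves horizontally, the other one leaves by the bottom, and an edge at port 2 leaves on the side
opposite to the main edge. The edge entering a non-junction, of which there is at most one, gets
port 2, so it enters horizontally; this is the Knuthian property (`Layout.isOrthogonal`,
`Layout.isKnuthian`).

The three ports of a vertex cost 0, 1 and 2 bends, hence at most `3 * n` in all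
(`Layout.sum_half_le`). A change of rows costs two more, and at most `L` edges leave any row, since
they have different tracks (`Layout.sum_wrap_le`). With `W = 200 * min A n` and `L = 9 * (Nat.log 2
n + 2)` one has `4 * L ≤ W` if `A ≤ n`, so these add up to at most `n / 2`; if `A > n` there is one
row only. Width `O(W + L)` and height `O(L * (n / W + 1))` give the other bounds
(`Draw.Sizes.bounds`). The aspect ratio is constant for `A` close to `√(n log n)`, by matching lower
bounds (`Draw.Sizes.aspect`).

The program is a fixed list of passes. Each is a loop over a counter whose body consists of stores
without branches; conditions are computed arithmetically. Every array is written by a single pass,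
so the final memory `F` satisfies one system of equations per pass (`Env.trace_of_wellFormed`), and
correctness is a statement about `F` alone. `Draw.Final.tree` identifies the arrays with places,
slots and edges, `Draw.Final.matches` with a layout, and `Draw.Matches.encodes` with the drawing of
this layout. -/

namespace Knuthian

/-! ### The order of the vertices and their slots -/

/-- The first of `3 * d`, `3 * d + 1`, `3 * d + 2` that is neither `a` nor `b`. -/
def pick (d a b : ℕ) : ℕ :=
  if a ≠ 3 * d ∧ b ≠ 3 * d then 3 * d
  else if a ≠ 3 * d + 1 ∧ b ≠ 3 * d + 1 then 3 * d + 1 else 3 * d + 2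

theorem pick_spec (d a b : ℕ) :
    3 * d ≤ pick d a b ∧ pick d a b < 3 * (d + 1) ∧ pick d a b ≠ a ∧ pick d a b ≠ b := by
  unfold pick; split_ifs <;> omega

namespace SPTree

/-- The offset of the first part among the places of the inner vertices: the part with fewer inner
vertices comes first. -/
def offL (l r : SPTree) : ℕ := if r.inner < l.inner then r.inner else 0

def offR (l r : SPTree) : ℕ := if r.inner < l.inner then 0 else l.inner

/-- The part that comes first moves to the next pool, the part that comes second keeps the pool. In
case of a tie the left part comes first. -/
def stepL (l r : SPTree) : ℕ := if r.inner < l.inner then 0 else 1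

def stepR (l r : SPTree) : ℕ := if r.inner < l.inner then 1 else 0

/-- `pos` and `sg` give the places and slots of the inner vertices of the tree, where the inner
vertices are numbered from `k`, the places begin at `b`, and `d` is the depth of the pool of slots. -/
def Cons (pos sg : ℕ → ℕ) : SPTree → ℕ → ℕ → ℕ → ℕ → ℕ → Prop
  | edge, _, _, _, _, _ => True
  | series l r, s, t, k, b, d =>
      pos k = b ∧ sg k = pick d (sg s) (sg t) ∧
      l.Cons pos sg s k (k + 1) (b + 1 + offL l r) (d + stepL l r) ∧
      r.Cons pos sg k t (k + 1 + l.inner) (b + 1 + offR l r) (d + stepR l r)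
  | parallel l r, s, t, k, b, d =>
      l.Cons pos sg s t k (b + offL l r) (d + stepL l r) ∧
      r.Cons pos sg s t (k + l.inner) (b + offR l r) (d + stepR l r)

theorem off_cases (l r : SPTree) :
    (r.inner < l.inner ∧ offL l r = r.inner ∧ offR l r = 0 ∧ stepL l r = 0 ∧ stepR l r = 1) ∨
    (l.inner ≤ r.inner ∧ offL l r = 0 ∧ offR l r = l.inner ∧ stepL l r = 1 ∧ stepR l r = 0) := by
  unfold offL offR stepL stepR; split_ifs with h
  · exact Or.inl ⟨h, rfl, rfl, rfl, rfl⟩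
  · exact Or.inr ⟨not_lt.1 h, rfl, rfl, rfl, rfl⟩

variable {pos sg : ℕ → ℕ}

theorem Cons.pos_mem {T : SPTree} : ∀ {s t k b d : ℕ}, T.Cons pos sg s t k b d →
    ∀ v, k ≤ v → v < k + T.inner → b ≤ pos v ∧ pos v < b + T.inner := by
  induction T with
  | edge => intro s t k b d _ v h1 h2; simp [inner] at h2; omega
  | series l r ihl ihr =>
    rintro s t k b d ⟨h1, -, hl, hr⟩ v hv1 hv2
    simp only [inner] at hv2 ⊢
    have := off_cases l r
    rcases Nat.lt_or_ge v (k + 1) with h | h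
    · obtain rfl : v = k := by omega
      omega
    · rcases Nat.lt_or_ge v (k + 1 + l.inner) with h' | h'
      · have := ihl hl v h h'; omega
      · have := ihr hr v h' (by omega); omega
  | parallel l r ihl ihr =>
    rintro s t k b d ⟨hl, hr⟩ v hv1 hv2
    simp only [inner] at hv2 ⊢
    have := off_cases l r
    rcases Nat.lt_or_ge v (k + l.inner) with h' | h'
    · have := ihl hl v hv1 h'; omega
    · have := ihr hr v h' (by omega); omega

theorem Cons.pos_inj {T : SPTree} : ∀ {s t k b d : ℕ}, T.Cons pos sg s t k b d →
    ∀ v w, k ≤ v → v < k + T.inner → k ≤ w → w < k + T.inner → pos v = pos w → v = w := by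
  induction T with
  | edge => intro s t k b d _ v w h1 h2; simp [inner] at h2; omega
  | series l r ihl ihr =>
    rintro s t k b d ⟨h1, -, hl, hr⟩ v w hv1 hv2 hw1 hw2 he
    simp only [inner] at hv2 hw2
    have := off_cases l r
    have key : ∀ v, k ≤ v → v < k + (l.inner + r.inner + 1) → (v = k ∧ pos v = b) ∨
      (k + 1 ≤ v ∧ v < k + 1 + l.inner ∧ b + 1 + offL l r ≤ pos v ∧
        pos v < b + 1 + offL l r + l.inner) ∨
      (k + 1 + l.inner ≤ v ∧ v < k + 1 + l.inner + r.inner ∧ b + 1 + offR l r ≤ pos v ∧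
        pos v < b + 1 + offR l r + r.inner) := by
      intro v hv1 hv2
      rcases Nat.lt_or_ge v (k + 1) with h | h
      · obtain rfl : v = k := by omega
        exact Or.inl ⟨rfl, h1⟩
      · rcases Nat.lt_or_ge v (k + 1 + l.inner) with h' | h'
        · exact Or.inr (Or.inl ⟨h, h', hl.pos_mem v h h'⟩)
        · exact Or.inr (Or.inr ⟨h', by omega, hr.pos_mem v h' (by omega)⟩)
    rcases key v hv1 hv2 with a | a | a <;> rcases key w hw1 hw2 with c | c | c
    all_goals first
      | omega
      | exact ihl hl v w a.1 a.2.1 c.1 c.2.1 he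
      | exact ihr hr v w a.1 a.2.1 c.1 c.2.1 he
  | parallel l r ihl ihr =>
    rintro s t k b d ⟨hl, hr⟩ v w hv1 hv2 hw1 hw2 he
    simp only [inner] at hv2 hw2
    have := off_cases l r
    have key : ∀ v, k ≤ v → v < k + (l.inner + r.inner) →
      (k ≤ v ∧ v < k + l.inner ∧ b + offL l r ≤ pos v ∧ pos v < b + offL l r + l.inner) ∨
      (k + l.inner ≤ v ∧ v < k + l.inner + r.inner ∧ b + offR l r ≤ pos v ∧
        pos v < b + offR l r + r.inner) := by
      intro v hv1 hv2
      rcases Nat.lt_or_ge v (k + l.inner) with h' | h'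
      · exact Or.inl ⟨hv1, h', hl.pos_mem v hv1 h'⟩
      · exact Or.inr ⟨h', by omega, hr.pos_mem v h' (by omega)⟩
    rcases key v hv1 hv2 with a | a <;> rcases key w hw1 hw2 with c | c
    all_goals first
      | omega
      | exact ihl hl v w a.1 a.2.1 c.1 c.2.1 he
      | exact ihr hr v w a.1 a.2.1 c.1 c.2.1 he

theorem Cons.le_sg {T : SPTree} : ∀ {s t k b d : ℕ}, T.Cons pos sg s t k b d →
    ∀ v, k ≤ v → v < k + T.inner → 3 * d ≤ sg v := by
  induction T with
  | edge => intro s t k b d _ v h1 h2; simp [inner] at h2; omega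
  | series l r ihl ihr =>
    rintro s t k b d ⟨-, h1, hl, hr⟩ v hv1 hv2
    simp only [inner] at hv2
    rcases Nat.lt_or_ge v (k + 1) with h | h
    · obtain rfl : v = k := by omega
      have := pick_spec d (sg s) (sg t)
      omega
    · rcases Nat.lt_or_ge v (k + 1 + l.inner) with h' | h'
      · have := ihl hl v h h'; omega
      · have := ihr hr v h' (by omega); omega
  | parallel l r ihl ihr =>
    rintro s t k b d ⟨hl, hr⟩ v hv1 hv2
    simp only [inner] at hv2
    rcases Nat.lt_or_ge v (k + l.inner) with h' | h'
    · have := ihl hl v hv1 h'; omega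
    · have := ihr hr v h' (by omega); omega

/-- The pool gets deeper only on the way into the part that comes first, which has at most half of
the inner vertices. So the depth grows at most logarithmically. -/
theorem Cons.sg_lt {T : SPTree} : ∀ {s t k b d : ℕ}, T.Cons pos sg s t k b d →
    ∀ D, T.inner < 2 ^ D → ∀ v, k ≤ v → v < k + T.inner → sg v < 3 * (d + D) := by
  -- Here `x` and `y` are the sizes of the smaller and the larger part, so `2 * x ≤ x + y < 2 ^ D`.
  -- The condition `1 ≤ y` excludes `D = 0`.
  have key : ∀ D x y z : ℕ, x + y + z < 2 ^ D → x ≤ y → 1 ≤ y → ∃ D', D = D' + 1 ∧ x < 2 ^ D' := by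
    intro D x y z h h1 h2
    cases D with
    | zero => simp at h; omega
    | succ D => exact ⟨D, rfl, by rw [pow_succ] at h; omega⟩
  induction T with
  | edge => intro s t k b d _ D _ v h1 h2; simp [inner] at h2; omega
  | series l r ihl ihr =>
    rintro s t k b d ⟨-, h1, hl, hr⟩ D hD v hv1 hv2
    simp only [inner] at hv2 hD
    obtain ⟨D', rfl, -⟩ := key D 0 1 (l.inner + r.inner) (by omega) (by omega) le_rfl
    rcases Nat.lt_or_ge v (k + 1) with h | h
    · obtain rfl : v = k := by omega
      have := pick_spec d (sg s) (sg t)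
      omega
    · rcases Nat.lt_or_ge v (k + 1 + l.inner) with h' | h'
      · rcases off_cases l r with hc | hc
        · have := ihl hl (D' + 1) (by omega) v h h'; omega
        · obtain ⟨E, hE, hE'⟩ := key (D' + 1) l.inner r.inner 0 (by omega) hc.1 (by omega)
          have := ihl hl E hE' v h h'; omega
      · rcases off_cases l r with hc | hc
        · obtain ⟨E, hE, hE'⟩ := key (D' + 1) r.inner l.inner 0 (by omega) hc.1.le (by omega)
          have := ihr hr E hE' v h' (by omega); omega
        · have := ihr hr (D' + 1) (by omega) v h' (by omega); omega
  | parallel l r ihl ihr =>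
    rintro s t k b d ⟨hl, hr⟩ D hD v hv1 hv2
    simp only [inner] at hv2 hD
    rcases Nat.lt_or_ge v (k + l.inner) with h' | h'
    · rcases off_cases l r with hc | hc
      · have := ihl hl D (by omega) v hv1 h'; omega
      · obtain ⟨E, hE, hE'⟩ := key D l.inner r.inner 0 (by omega) hc.1 (by omega)
        have := ihl hl E hE' v hv1 h'; omega
    · rcases off_cases l r with hc | hc
      · obtain ⟨E, hE, hE'⟩ := key D r.inner l.inner 0 (by omega) hc.1.le (by omega)
        have := ihr hr E hE' v h' (by omega); omega
      · have := ihr hr D (by omega) v h' (by omega); omega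

theorem edgesFrom_mem (T : SPTree) : ∀ {s t k : ℕ}, ∀ p ∈ T.edgesFrom s t k,
    (p.1 = s ∨ (k ≤ p.1 ∧ p.1 < k + T.inner)) ∧ (p.2 = t ∨ (k ≤ p.2 ∧ p.2 < k + T.inner)) := by
  induction T with
  | edge => intro s t k p hp; simp only [edgesFrom, List.mem_singleton] at hp; subst hp; simp
  | series l r ihl ihr =>
    intro s t k p hp
    simp only [edgesFrom, List.mem_append] at hp
    simp only [inner]
    rcases hp with hp | hp
    · have := ihl p hp; omega
    · have := ihr p hp; omega
  | parallel l r ihl ihr =>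
    intro s t k p hp
    simp only [edgesFrom, List.mem_append] at hp
    simp only [inner]
    rcases hp with hp | hp
    · have := ihl p hp; omega
    · have := ihr p hp; omega

theorem edgesFrom_ne (T : SPTree) : ∀ {s t k : ℕ}, s < k → t < k → s ≠ t →
    ∀ p ∈ T.edgesFrom s t k, p.1 ≠ p.2 := by
  induction T with
  | edge => intro s t k _ _ h p hp; simp only [edgesFrom, List.mem_singleton] at hp; subst hp; exact h
  | series l r ihl ihr =>
    intro s t k h1 h2 h3 p hp
    simp only [edgesFrom, List.mem_append] at hp
    rcases hp with hp | hp
    · exact ihl (by omega) (by omega) (by omega) p hp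
    · exact ihr (by omega) (by omega) (by omega) p hp
  | parallel l r ihl ihr =>
    intro s t k h1 h2 h3 p hp
    simp only [edgesFrom, List.mem_append] at hp
    rcases hp with hp | hp
    · exact ihl (by omega) (by omega) (by omega) p hp
    · exact ihr (by omega) (by omega) (by omega) p hp

theorem exists_source (T : SPTree) : ∀ {s t k : ℕ}, ∃ p ∈ T.edgesFrom s t k, p.1 = s := by
  induction T with
  | edge => intro s t k; exact ⟨(s, t), by simp [edgesFrom]⟩
  | series l r ihl ihr =>
    intro s t k; obtain ⟨p, hp, h⟩ := ihl (s := s) (t := k) (k := k + 1)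
    exact ⟨p, by simp [edgesFrom, hp], h⟩
  | parallel l r ihl ihr =>
    intro s t k; obtain ⟨p, hp, h⟩ := ihl (s := s) (t := t) (k := k)
    exact ⟨p, by simp [edgesFrom, hp], h⟩

theorem exists_sink (T : SPTree) : ∀ {s t k : ℕ}, ∃ p ∈ T.edgesFrom s t k, p.2 = t := by
  induction T with
  | edge => intro s t k; exact ⟨(s, t), by simp [edgesFrom]⟩
  | series l r ihl ihr =>
    intro s t k; obtain ⟨p, hp, h⟩ := ihr (s := k) (t := t) (k := k + 1 + l.inner)
    exact ⟨p, by simp [edgesFrom, hp], h⟩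
  | parallel l r ihl ihr =>
    intro s t k; obtain ⟨p, hp, h⟩ := ihl (s := s) (t := t) (k := k)
    exact ⟨p, by simp [edgesFrom, hp], h⟩

theorem exists_inner (T : SPTree) : ∀ {s t k : ℕ}, ∀ v, k ≤ v → v < k + T.inner →
    ∃ p ∈ T.edgesFrom s t k, p.1 = v := by
  induction T with
  | edge => intro s t k v h1 h2; simp [inner] at h2; omega
  | series l r ihl ihr =>
    intro s t k v hv1 hv2
    simp only [inner] at hv2
    rcases Nat.lt_or_ge v (k + 1) with h | h
    · obtain rfl : v = k := by omega
      obtain ⟨p, hp, h⟩ := r.exists_source (s := v) (t := t) (k := v + 1 + l.inner)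
      exact ⟨p, by simp [edgesFrom, hp], h⟩
    · rcases Nat.lt_or_ge v (k + 1 + l.inner) with h' | h'
      · obtain ⟨p, hp, h⟩ := ihl (s := s) (t := k) v h h'
        exact ⟨p, by simp [edgesFrom, hp], h⟩
      · obtain ⟨p, hp, h⟩ := ihr (s := k) (t := t) v h' (by omega)
        exact ⟨p, by simp [edgesFrom, hp], h⟩
  | parallel l r ihl ihr =>
    intro s t k v hv1 hv2
    simp only [inner] at hv2
    rcases Nat.lt_or_ge v (k + l.inner) with h' | h'
    · obtain ⟨p, hp, h⟩ := ihl (s := s) (t := t) v hv1 h'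
      exact ⟨p, by simp [edgesFrom, hp], h⟩
    · obtain ⟨p, hp, h⟩ := ihr (s := s) (t := t) v h' (by omega)
      exact ⟨p, by simp [edgesFrom, hp], h⟩

/-- The end of `p` that comes first. -/
def early (pos : ℕ → ℕ) (p : ℕ × ℕ) : ℕ := if pos p.1 < pos p.2 then p.1 else p.2

/-- All of `p` comes before all of `q`. -/
def Before (pos : ℕ → ℕ) (p q : ℕ × ℕ) : Prop :=
  (pos p.1 < pos q.1 ∧ pos p.1 < pos q.2) ∧ (pos p.2 < pos q.1 ∧ pos p.2 < pos q.2)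

/-- The edge `p` belongs to the part that comes first, and the inner vertices of the second part
begin at place `β`. Terminals with equal slots are equal, and an inner vertex of the first part
shares no slot with a terminal. What remains is that the early end of `q` is at `β` or later; then
so is all of `q`, while `p` ends before `β`. -/
theorem before_of_parts {p q : ℕ × ℕ} {β γ : ℕ} {Tm : ℕ → Prop}
    (hT : ∀ u v, Tm u → Tm v → sg u = sg v → u = v) (hlt : ∀ u, Tm u → sg u < γ)
    (hp : Tm (early pos p) ∨ γ ≤ sg (early pos p)) (hp1 : pos p.1 < β) (hp2 : pos p.2 < β)
    (hq : Tm (early pos q) ∨ β ≤ pos (early pos q)) (hne : early pos p ≠ early pos q)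
    (hs : sg (early pos p) = sg (early pos q)) : Before pos p q := by
  rcases hq with hq | hq
  · rcases hp with hp | hp
    · exact absurd (hT _ _ hp hq hs) hne
    · have := hlt _ hq; omega
  · have : β ≤ pos q.1 ∧ β ≤ pos q.2 := by
      unfold early at hq; split_ifs at hq <;> omega
    unfold Before; omega

theorem early_or (p : ℕ × ℕ) : early pos p = p.1 ∨ early pos p = p.2 := by
  unfold early; split_ifs <;> simp

/-- What is known of an end `v` of an edge of a part: it is a terminal, or its slot is in the pools
from `e` on and its place is one of the `x` places from `β` on. -/
def PartEnd (pos sg : ℕ → ℕ) (Tm : ℕ → Prop) (b e β x v : ℕ) : Prop :=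
  (Tm v ∧ pos v < b) ∨ (3 * e ≤ sg v ∧ β ≤ pos v ∧ pos v < β + x)

theorem PartEnd.lt {Tm : ℕ → Prop} {b e β x v : ℕ} (h : PartEnd pos sg Tm b e β x v)
    (hb : b ≤ β) : pos v < β + x := by
  rcases h with h | h <;> omega

theorem before_cross {p q : ℕ × ℕ} {Tm : ℕ → Prop} {b d x y : ℕ}
    (hT : ∀ u v, Tm u → Tm v → sg u = sg v → u = v) (hlt : ∀ u, Tm u → sg u < 3 * (d + 1))
    (hp : ∀ v, v = p.1 ∨ v = p.2 → PartEnd pos sg Tm b (d + 1) b x v)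
    (hq : ∀ v, v = q.1 ∨ v = q.2 → PartEnd pos sg Tm b d (b + x) y v)
    (hne : early pos p ≠ early pos q) (hs : sg (early pos p) = sg (early pos q)) :
    Before pos p q :=
  before_of_parts (β := b + x) hT hlt ((hp _ (early_or p)).imp And.left And.left)
    ((hp _ (Or.inl rfl)).lt le_rfl) ((hp _ (Or.inr rfl)).lt le_rfl)
    ((hq _ (early_or q)).imp And.left fun h => h.2.1) hne hs

/-- Two edges of the same part are compared by induction, two edges of different parts by
`before_cross`. The invariant is that the terminals come before the part and have different slots in
the pools up to `d`; it passes to the parts because `pick` avoids both terminals and stays in pool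
`d`. -/
theorem Cons.before {T : SPTree} : ∀ {s t k b d : ℕ}, T.Cons pos sg s t k b d → s < k → t < k →
    sg s ≠ sg t → sg s < 3 * (d + 1) → sg t < 3 * (d + 1) → pos s < b → pos t < b →
    ∀ p ∈ T.edgesFrom s t k, ∀ q ∈ T.edgesFrom s t k, early pos p ≠ early pos q →
      sg (early pos p) = sg (early pos q) → Before pos p q ∨ Before pos q p := by
  induction T with
  | edge =>
    intro s t k b d _ _ _ _ _ _ _ _ p hp q hq hne
    simp only [edgesFrom, List.mem_singleton] at hp hq
    subst hp; subst hq; exact absurd rfl hne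
  | series l r ihl ihr =>
    rintro s t k b d ⟨hk, hsk, hl, hr⟩ hs ht hst hs3 ht3 hsb htb p hp q hq hne he
    have hpk := pick_spec d (sg s) (sg t)
    rw [← hsk] at hpk
    have hc := off_cases l r
    -- The new vertex `k` is a terminal of both parts, and the slots of `s`, `t` and `k` are
    -- pairwise different.
    set Tm : ℕ → Prop := fun v => v = s ∨ v = t ∨ v = k with hTm
    have hT : ∀ u v, Tm u → Tm v → sg u = sg v → u = v := by
      rintro u v (rfl | rfl | rfl) (rfl | rfl | rfl) h <;> first | rfl | omega
    have hlt : ∀ u, Tm u → sg u < 3 * (d + 1) := by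
      rintro u (rfl | rfl | rfl) <;> omega
    have Hl : ∀ p ∈ l.edgesFrom s k (k + 1), ∀ v, v = p.1 ∨ v = p.2 →
        PartEnd pos sg Tm (b + 1) (d + stepL l r) (b + 1 + offL l r) l.inner v := by
      intro p hp v hv
      have := l.edgesFrom_mem p hp
      by_cases hh : k + 1 ≤ v ∧ v < k + 1 + l.inner
      · exact Or.inr ⟨hl.le_sg v hh.1 hh.2, hl.pos_mem v hh.1 hh.2⟩
      · have : v = s ∨ v = k := by omega
        rcases this with rfl | rfl
        · exact Or.inl ⟨Or.inl rfl, by omega⟩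
        · exact Or.inl ⟨Or.inr (Or.inr rfl), by omega⟩
    have Hr : ∀ p ∈ r.edgesFrom k t (k + 1 + l.inner), ∀ v, v = p.1 ∨ v = p.2 →
        PartEnd pos sg Tm (b + 1) (d + stepR l r) (b + 1 + offR l r) r.inner v := by
      intro p hp v hv
      have := r.edgesFrom_mem p hp
      by_cases hh : k + 1 + l.inner ≤ v ∧ v < k + 1 + l.inner + r.inner
      · exact Or.inr ⟨hr.le_sg v hh.1 hh.2, hr.pos_mem v hh.1 hh.2⟩
      · have : v = t ∨ v = k := by omega
        rcases this with rfl | rfl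
        · exact Or.inl ⟨Or.inr (Or.inl rfl), by omega⟩
        · exact Or.inl ⟨Or.inr (Or.inr rfl), by omega⟩
    have cross : ∀ p ∈ l.edgesFrom s k (k + 1), ∀ q ∈ r.edgesFrom k t (k + 1 + l.inner),
        early pos p ≠ early pos q → sg (early pos p) = sg (early pos q) →
        Before pos p q ∨ Before pos q p := by
      intro p hp q hq hne he
      have hp' := Hl p hp
      have hq' := Hr q hq
      rcases hc with ⟨-, h1, h2, h3, h4⟩ | ⟨-, h1, h2, h3, h4⟩
      · rw [h1, h3] at hp'; rw [h2, h4] at hq'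
        exact Or.inr (before_cross hT hlt hq' hp' hne.symm he.symm)
      · rw [h1, h3] at hp'; rw [h2, h4] at hq'
        exact Or.inl (before_cross hT hlt hp' hq' hne he)
    simp only [edgesFrom, List.mem_append] at hp hq
    rcases hp with hp | hp <;> rcases hq with hq | hq
    · exact ihl hl (by omega) (by omega) (by omega) (by omega) (by omega) (by omega) (by omega)
        p hp q hq hne he
    · exact cross p hp q hq hne he
    · exact (cross q hq p hp hne.symm he.symm).symm
    · exact ihr hr (by omega) (by omega) (by omega) (by omega) (by omega) (by omega) (by omega)
        p hp q hq hne he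
  | parallel l r ihl ihr =>
    rintro s t k b d ⟨hl, hr⟩ hs ht hst hs3 ht3 hsb htb p hp q hq hne he
    have hc := off_cases l r
    set Tm : ℕ → Prop := fun v => v = s ∨ v = t with hTm
    have hT : ∀ u v, Tm u → Tm v → sg u = sg v → u = v := by
      rintro u v (rfl | rfl) (rfl | rfl) h <;> first | rfl | omega
    have hlt : ∀ u, Tm u → sg u < 3 * (d + 1) := by
      rintro u (rfl | rfl) <;> omega
    have Hl : ∀ p ∈ l.edgesFrom s t k, ∀ v, v = p.1 ∨ v = p.2 →
        PartEnd pos sg Tm (b) (d + stepL l r) (b + offL l r) l.inner v := by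
      intro p hp v hv
      have := l.edgesFrom_mem p hp
      by_cases hh : k ≤ v ∧ v < k + l.inner
      · exact Or.inr ⟨hl.le_sg v hh.1 hh.2, hl.pos_mem v hh.1 hh.2⟩
      · have : v = s ∨ v = t := by omega
        rcases this with rfl | rfl
        · exact Or.inl ⟨Or.inl rfl, by omega⟩
        · exact Or.inl ⟨Or.inr rfl, by omega⟩
    have Hr : ∀ p ∈ r.edgesFrom s t (k + l.inner), ∀ v, v = p.1 ∨ v = p.2 →
        PartEnd pos sg Tm (b) (d + stepR l r) (b + offR l r) r.inner v := by
      intro p hp v hv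
      have := r.edgesFrom_mem p hp
      by_cases hh : k + l.inner ≤ v ∧ v < k + l.inner + r.inner
      · exact Or.inr ⟨hr.le_sg v hh.1 hh.2, hr.pos_mem v hh.1 hh.2⟩
      · have : v = s ∨ v = t := by omega
        rcases this with rfl | rfl
        · exact Or.inl ⟨Or.inl rfl, by omega⟩
        · exact Or.inl ⟨Or.inr rfl, by omega⟩
    have cross : ∀ p ∈ l.edgesFrom s t k, ∀ q ∈ r.edgesFrom s t (k + l.inner),
        early pos p ≠ early pos q → sg (early pos p) = sg (early pos q) →
        Before pos p q ∨ Before pos q p := by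
      intro p hp q hq hne he
      have hp' := Hl p hp
      have hq' := Hr q hq
      rcases hc with ⟨-, h1, h2, h3, h4⟩ | ⟨-, h1, h2, h3, h4⟩
      · rw [h1, h3] at hp'; rw [h2, h4] at hq'
        exact Or.inr (before_cross hT hlt hq' hp' hne.symm he.symm)
      · rw [h1, h3] at hp'; rw [h2, h4] at hq'
        exact Or.inl (before_cross hT hlt hp' hq' hne he)
    simp only [edgesFrom, List.mem_append] at hp hq
    rcases hp with hp | hp <;> rcases hq with hq | hq
    · exact ihl hl (by omega) (by omega) (by omega) (by omega) (by omega) (by omega) (by omega)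
        p hp q hq hne he
    · exact cross p hp q hq hne he
    · exact (cross q hq p hp hne.symm he.symm).symm
    · exact ihr hr (by omega) (by omega) (by omega) (by omega) (by omega) (by omega) (by omega)
        p hp q hq hne he

end SPTree

/-! ### The geometry of the drawings -/

namespace MDigraph

/-- The source (`false`) or the target (`true`) of an edge. -/
def vt (G : MDigraph) (e : Fin G.m) (b : Bool) : Fin G.n := if b then G.tgt e else G.src e

end MDigraph

/-- What determines a drawing: the places of the vertices, the tracks of the edges, the ports by
which the edges are attached to their ends, the number of vertices in a row, and the number of
tracks. -/
structure Layout (G : MDigraph) where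
  pos : Fin G.n → ℕ
  track : Fin G.m → ℕ
  port : Fin G.m → Bool → ℕ
  W : ℕ
  L : ℕ
  W_pos : 0 < W
  track_lt : ∀ e, track e < L
  pos_inj : Function.Injective pos
  port_lt : ∀ e b, port e b < 3
  port_inj : ∀ e b f c, G.vt e b = G.vt f c → port e b = port f c → e = f ∧ b = c
  port_zero : ∀ v, ∃ e b, G.vt e b = v ∧ port e b = 0
  port_in : ∀ e, ¬ G.IsJunction (G.tgt e) → port e true = 2
  track_disj : ∀ e f, e ≠ f → track e = track f →
    (∀ b c, pos (G.vt e b) < pos (G.vt f c)) ∨ (∀ b c, pos (G.vt f c) < pos (G.vt e b))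
  ne : ∀ e b, G.vt e b ≠ G.vt e (!b)

namespace Layout

open Classical

variable {G : MDigraph} (Λ : Layout G)

def row (v : Fin G.n) : ℕ := Λ.pos v / Λ.W

/-- The place of a vertex within its row. -/
def idx (v : Fin G.n) : ℕ := Λ.pos v % Λ.W

/-- Every vertex has three columns: its own, and one on either side for the edge at port 2. -/
def px (v : Fin G.n) : ℤ := 3 * (Λ.idx v : ℤ) + 1

/-- The ends of the edge are in different rows. -/
def wr (e : Fin G.m) : Prop := Λ.row (G.src e) ≠ Λ.row (G.tgt e)

/-- The end `b` is the late end of an edge whose ends are in different rows. -/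
def late (e : Fin G.m) (b : Bool) : Prop :=
  Λ.wr e ∧ Λ.pos (G.vt e (!b)) < Λ.pos (G.vt e b)

/-- The depth at which the edge runs in the row of its end `b`. -/
noncomputable def lane (e : Fin G.m) (b : Bool) : ℤ :=
  -- The upper half of the band is kept for late ends of edges from other rows. From such an end the
  -- edge runs up to the margin and would hit later edges of the same track that start in this row.
  2 * Λ.L * Λ.row (G.vt e b) + Λ.track e + if Λ.late e b then 0 else (Λ.L : ℤ)

/-- The edge runs to the right from its end `b`. -/
def toRight (e : Fin G.m) (b : Bool) : Prop :=
  Λ.wr e ∨ Λ.pos (G.vt e b) < Λ.pos (G.vt e (!b))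

/-- The edge at port 1 runs above the edge at port 0. -/
def low (v : Fin G.n) : Prop :=
  ∃ e b f c, G.vt e b = v ∧ Λ.port e b = 0 ∧ G.vt f c = v ∧ Λ.port f c = 1 ∧
    Λ.lane f c < Λ.lane e b

/-- The port of the edge that leaves the vertex along its lane. -/
noncomputable def mainPort (v : Fin G.n) : ℕ := if Λ.low v then 1 else 0

theorem mainPort_lt (v : Fin G.n) : Λ.mainPort v < 2 := by unfold mainPort; split_ifs <;> omega

theorem exists_main (v : Fin G.n) :
    ∃ h : Fin G.m × Bool, G.vt h.1 h.2 = v ∧ Λ.port h.1 h.2 = Λ.mainPort v := by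
  unfold mainPort
  split_ifs with h
  · obtain ⟨e, b, f, c, -, -, h1, h2, -⟩ := h
    exact ⟨(f, c), h1, h2⟩
  · obtain ⟨e, b, h1, h2⟩ := Λ.port_zero v
    exact ⟨(e, b), h1, h2⟩

noncomputable def main (v : Fin G.n) : Fin G.m × Bool := (Λ.exists_main v).choose

theorem vt_main (v : Fin G.n) : G.vt (Λ.main v).1 (Λ.main v).2 = v :=
  (Λ.exists_main v).choose_spec.1

theorem port_main (v : Fin G.n) : Λ.port (Λ.main v).1 (Λ.main v).2 = Λ.mainPort v :=
  (Λ.exists_main v).choose_spec.2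

theorem main_eq (e : Fin G.m) (b : Bool) (h : Λ.port e b = Λ.mainPort (G.vt e b)) :
    Λ.main (G.vt e b) = (e, b) := by
  have := Λ.port_inj _ _ e b (Λ.vt_main _) ((Λ.port_main _).trans h.symm)
  exact Prod.ext this.1 this.2

/-- The depth of a vertex. -/
noncomputable def py (v : Fin G.n) : ℤ := Λ.lane (Λ.main v).1 (Λ.main v).2

/-- The side of a vertex at which port 2 is. -/
noncomputable def side (v : Fin G.n) : ℤ :=
  if Λ.toRight (Λ.main v).1 (Λ.main v).2 then -1 else 1

theorem py_main (e : Fin G.m) (b : Bool) (h : Λ.port e b = Λ.mainPort (G.vt e b)) :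
    Λ.py (G.vt e b) = Λ.lane e b := by
  rw [py, Λ.main_eq e b h]

theorem side_main (e : Fin G.m) (b : Bool) (h : Λ.port e b = Λ.mainPort (G.vt e b)) :
    Λ.side (G.vt e b) = if Λ.toRight e b then -1 else 1 := by
  rw [side, Λ.main_eq e b h]

theorem side_cases (v : Fin G.n) : Λ.side v = 1 ∨ Λ.side v = -1 := by
  unfold side; split_ifs <;> simp

/-- The column in which the edge comes to its lane near its end `b`. -/
noncomputable def cx (e : Fin G.m) (b : Bool) : ℤ :=
  Λ.px (G.vt e b) + if Λ.port e b = 2 then Λ.side (G.vt e b) else 0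

/-- The column used by an edge whose ends are in different rows. -/
def wx (e : Fin G.m) : ℤ := 3 * Λ.W + Λ.track e

/-- The corners between the end `b` and the middle of the edge, each with the condition under which
it is there. -/
noncomputable def half (e : Fin G.m) (b : Bool) : List (Bool × (ℤ × ℤ)) :=
  [(true, (Λ.px (G.vt e b), -Λ.py (G.vt e b))),
   (decide (Λ.port e b = 2), (Λ.cx e b, -Λ.py (G.vt e b))),
   (decide (Λ.port e b ≠ Λ.mainPort (G.vt e b)), (Λ.cx e b, -Λ.lane e b)),
   (decide (Λ.wr e), (Λ.wx e, -Λ.lane e b))]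

noncomputable def path (e : Fin G.m) : List (ℤ × ℤ) :=
  ((Λ.half e false ++ (Λ.half e true).reverse).filter Prod.fst).map Prod.snd

/-- Depths are counted downwards, whence the signs. The two ends of a path are not bends, and `0` is
only the value at meaningless indices. -/
noncomputable def drawing : Drawing G where
  pos v := (Λ.px v, -Λ.py v)
  bends e := (Λ.path e).length - 2
  pt e i := (Λ.path e).getD i 0

/-! Elementary facts -/

theorem vt_cases (e : Fin G.m) (b : Bool) : G.vt e b = G.src e ∧ G.vt e (!b) = G.tgt e ∨
    G.vt e b = G.tgt e ∧ G.vt e (!b) = G.src e := by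
  cases b <;> simp [MDigraph.vt]

theorem wr_iff (e : Fin G.m) (b : Bool) :
    Λ.wr e ↔ Λ.row (G.vt e b) ≠ Λ.row (G.vt e (!b)) := by
  unfold wr
  rcases vt_cases e b with ⟨h1, h2⟩ | ⟨h1, h2⟩ <;> rw [h1, h2]
  exact ne_comm

theorem row_le {v w : Fin G.n} (h : Λ.pos v ≤ Λ.pos w) : Λ.row v ≤ Λ.row w :=
  Nat.div_le_div_right h

theorem idx_lt (v : Fin G.n) : Λ.idx v < Λ.W := Nat.mod_lt _ Λ.W_pos

theorem idx_lt_idx {v w : Fin G.n} (hr : Λ.row v = Λ.row w) (h : Λ.pos v < Λ.pos w) :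
    Λ.idx v < Λ.idx w := by
  have h1 := Nat.div_add_mod (Λ.pos v) Λ.W
  have h2 := Nat.div_add_mod (Λ.pos w) Λ.W
  unfold row at hr
  rw [hr] at h1
  unfold idx; omega

theorem eq_of_row_idx {v w : Fin G.n} (hr : Λ.row v = Λ.row w) (h : Λ.idx v = Λ.idx w) :
    v = w := by
  rcases lt_trichotomy (Λ.pos v) (Λ.pos w) with h' | h' | h'
  · have := Λ.idx_lt_idx hr h'; omega
  · exact Λ.pos_inj h'
  · have := Λ.idx_lt_idx hr.symm h'; omega

theorem lane_band (e : Fin G.m) (b : Bool) : 2 * (Λ.L : ℤ) * Λ.row (G.vt e b) ≤ Λ.lane e b ∧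
    Λ.lane e b < 2 * (Λ.L : ℤ) * Λ.row (G.vt e b) + 2 * Λ.L := by
  have := Λ.track_lt e
  unfold lane
  split_ifs <;> constructor <;> omega

theorem py_band (v : Fin G.n) : 2 * (Λ.L : ℤ) * Λ.row v ≤ Λ.py v ∧
    Λ.py v < 2 * (Λ.L : ℤ) * Λ.row v + 2 * Λ.L := by
  have := Λ.lane_band (Λ.main v).1 (Λ.main v).2
  rwa [Λ.vt_main] at this

theorem band_lt {r r' : ℕ} (h : r < r') :
    2 * (Λ.L : ℤ) * r + 2 * Λ.L ≤ 2 * (Λ.L : ℤ) * r' := by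
  have : (r : ℤ) + 1 ≤ r' := by exact_mod_cast h
  nlinarith [Int.natCast_nonneg Λ.L]

theorem row_eq {r r' : ℕ} {y : ℤ} (h1 : 2 * (Λ.L : ℤ) * r ≤ y) (h2 : y < 2 * (Λ.L : ℤ) * r + 2 * Λ.L)
    (h3 : 2 * (Λ.L : ℤ) * r' ≤ y) (h4 : y < 2 * (Λ.L : ℤ) * r' + 2 * Λ.L) : r = r' := by
  rcases lt_trichotomy r r' with h | h | h
  · have := Λ.band_lt h; omega
  · exact h
  · have := Λ.band_lt h; omega

/-- The bands of the rows are disjoint, and tracks are less than `L`. So the band gives the row, its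
half gives the lateness, and the remainder is the track. -/
theorem lane_decode {e f : Fin G.m} {b c : Bool} (h : Λ.lane e b = Λ.lane f c) :
    Λ.row (G.vt e b) = Λ.row (G.vt f c) ∧ Λ.track e = Λ.track f ∧ (Λ.late e b ↔ Λ.late f c) := by
  have h1 := Λ.lane_band e b
  have h2 := Λ.lane_band f c
  have hr : Λ.row (G.vt e b) = Λ.row (G.vt f c) :=
    Λ.row_eq h1.1 h1.2 (h ▸ h2.1) (h ▸ h2.2)
  have te := Λ.track_lt e
  have tf := Λ.track_lt f
  unfold lane at h
  rw [hr] at h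
  refine ⟨hr, ?_⟩
  by_cases p : Λ.late e b <;> by_cases q : Λ.late f c <;> simp only [p, q, if_true, if_false] at h ⊢
  all_goals first
    | exact ⟨by omega, trivial⟩
    | (exfalso; omega)

/-- Equal lanes would mean equal tracks, and then the common end would have to come before itself.
-/
theorem lane_ne {e f : Fin G.m} {b c : Bool} (hv : G.vt e b = G.vt f c) (hne : e ≠ f) :
    Λ.lane e b ≠ Λ.lane f c := by
  intro h
  rcases Λ.track_disj e f hne (Λ.lane_decode h).2.1 with h | h
  · have := h b c; rw [hv] at this; omega
  · have := h b c; rw [hv] at this; omega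

theorem edge_ne {e f : Fin G.m} {b c : Bool} (hv : G.vt e b = G.vt f c)
    (hp : Λ.port e b ≠ Λ.port f c) : e ≠ f := by
  rintro rfl
  by_cases h : b = c
  · exact hp (by rw [h])
  · have : c = !b := by cases b <;> cases c <;> simp_all
    exact Λ.ne e b (this ▸ hv)

/-- The edge attached by the bottom runs below the vertex. -/
theorem py_lt (e : Fin G.m) (b : Bool) (h2 : Λ.port e b ≠ 2)
    (hm : Λ.port e b ≠ Λ.mainPort (G.vt e b)) : Λ.py (G.vt e b) < Λ.lane e b := by
  have h3 := Λ.port_lt e b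
  have hv := Λ.vt_main (G.vt e b)
  have hp := Λ.port_main (G.vt e b)
  have hne : Λ.lane (Λ.main (G.vt e b)).1 (Λ.main (G.vt e b)).2 ≠ Λ.lane e b :=
    Λ.lane_ne hv (Λ.edge_ne hv (by rw [hp]; exact hm.symm))
  unfold py
  by_cases hl : Λ.low (G.vt e b)
  · rw [mainPort, if_pos hl] at hm hp
    obtain ⟨e', b', f, c, h4, h5, h6, h7, h8⟩ := hl
    obtain ⟨rfl, rfl⟩ := Λ.port_inj e b e' b' h4.symm (by omega)
    obtain ⟨h9, h10⟩ := Λ.port_inj _ _ f c (hv.trans h6.symm) (by omega)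
    rw [h9, h10]; exact h8
  · rw [mainPort, if_neg hl] at hm hp
    by_contra hlt
    exact hl ⟨_, _, e, b, hv, hp, rfl, by omega, by omega⟩

theorem py_ne (e : Fin G.m) (b : Bool)
    (hm : Λ.port e b ≠ Λ.mainPort (G.vt e b)) : Λ.py (G.vt e b) ≠ Λ.lane e b := by
  have hv := Λ.vt_main (G.vt e b)
  have hp := Λ.port_main (G.vt e b)
  exact Λ.lane_ne hv (Λ.edge_ne hv (by rw [hp]; exact hm.symm))

/-! The segments -/

/-- The horizontal piece of length one at port 2. -/
def Stub (e : Fin G.m) (b : Bool) (p : ℤ × ℤ) : Prop :=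
  Λ.port e b = 2 ∧ p.2 = -Λ.py (G.vt e b) ∧ p.1 ∈ Set.uIcc (Λ.px (G.vt e b)) (Λ.cx e b)

/-- The vertical piece between the height of the end and the lane. -/
def Vert (e : Fin G.m) (b : Bool) (p : ℤ × ℤ) : Prop :=
  Λ.port e b ≠ Λ.mainPort (G.vt e b) ∧ p.1 = Λ.cx e b ∧
    p.2 ∈ Set.uIcc (-Λ.py (G.vt e b)) (-Λ.lane e b)

/-- The piece in the lane. -/
def Main (e : Fin G.m) (b : Bool) (p : ℤ × ℤ) : Prop :=
  p.2 = -Λ.lane e b ∧ p.1 ∈ Set.uIcc (Λ.cx e b) (if Λ.wr e then Λ.wx e else Λ.cx e (!b))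

/-- The vertical piece of an edge whose ends are in different rows. -/
def Wrap (e : Fin G.m) (p : ℤ × ℤ) : Prop :=
  Λ.wr e ∧ p.1 = Λ.wx e ∧ p.2 ∈ Set.uIcc (-Λ.lane e false) (-Λ.lane e true)

theorem mem_uIcc_int {a b x : ℤ} : x ∈ Set.uIcc a b ↔ (a ≤ x ∧ x ≤ b) ∨ (b ≤ x ∧ x ≤ a) :=
  Set.mem_uIcc

theorem cx_near (e : Fin G.m) (b : Bool) :
    Λ.px (G.vt e b) - 1 ≤ Λ.cx e b ∧ Λ.cx e b ≤ Λ.px (G.vt e b) + 1 := by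
  unfold cx; rcases Λ.side_cases (G.vt e b) with h | h <;> split_ifs <;> omega

theorem px_near_inj {v w : Fin G.n} {x : ℤ} (hr : Λ.row v = Λ.row w)
    (h1 : Λ.px v - 1 ≤ x) (h2 : x ≤ Λ.px v + 1) (h3 : Λ.px w - 1 ≤ x) (h4 : x ≤ Λ.px w + 1) :
    v = w := by
  refine Λ.eq_of_row_idx hr ?_
  unfold px at *; omega

/-- The columns used by a lane piece. -/
theorem Main.extent {e : Fin G.m} {b : Bool} {p : ℤ × ℤ} (h : Λ.Main e b p) :
    (Λ.wr e → Λ.px (G.vt e b) - 1 ≤ p.1) ∧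
    (¬ Λ.wr e → Λ.row (G.vt e b) = Λ.row (G.vt e (!b)) ∧
      ((Λ.px (G.vt e b) - 1 ≤ p.1 ∧ p.1 ≤ Λ.px (G.vt e (!b)) + 1 ∧
          Λ.pos (G.vt e b) < Λ.pos (G.vt e (!b))) ∨
        (Λ.px (G.vt e (!b)) - 1 ≤ p.1 ∧ p.1 ≤ Λ.px (G.vt e b) + 1 ∧
          Λ.pos (G.vt e (!b)) < Λ.pos (G.vt e b)))) := by
  have h1 := Λ.cx_near e b
  have h2 := Λ.cx_near e (!b)
  have h3 := h.2
  rw [mem_uIcc_int] at h3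
  constructor
  · intro hw
    rw [if_pos hw] at h3
    have := Λ.idx_lt (G.vt e b)
    unfold px at *; unfold wx at *
    omega
  · intro hw
    rw [if_neg hw] at h3
    have hr : Λ.row (G.vt e b) = Λ.row (G.vt e (!b)) := by
      by_contra h; exact hw ((Λ.wr_iff e b).2 h)
    refine ⟨hr, ?_⟩
    rcases lt_trichotomy (Λ.pos (G.vt e b)) (Λ.pos (G.vt e (!b))) with h' | h' | h'
    · have := Λ.idx_lt_idx hr h'
      left; unfold px at *; omega
    · exact absurd (Λ.pos_inj h') (Λ.ne e b)
    · have := Λ.idx_lt_idx hr.symm h'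
      right; unfold px at *; omega

theorem px_lt_of_pos {v w : Fin G.n} (hr : Λ.row v = Λ.row w) (h : Λ.pos v < Λ.pos w) :
    Λ.px v + 3 ≤ Λ.px w := by
  have := Λ.idx_lt_idx hr h; unfold px; omega

/-- If two edges have the same lane in some row and the first comes before the second, then in this
row the second is to the right of the first. -/
theorem lane_order {e f : Fin G.m} {b c : Bool} (h : Λ.lane e b = Λ.lane f c)
    (hb : ∀ b c, Λ.pos (G.vt e b) < Λ.pos (G.vt f c)) : ¬ Λ.wr e ∧
      (Λ.wr f → Λ.pos (G.vt f c) < Λ.pos (G.vt f (!c))) := by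
  obtain ⟨hr, -, hl⟩ := Λ.lane_decode h
  constructor
  · intro hw
    have hw' := (Λ.wr_iff e b).1 hw
    by_cases hlt : Λ.pos (G.vt e (!b)) < Λ.pos (G.vt e b)
    · obtain ⟨h1, h2⟩ := hl.1 ⟨hw, hlt⟩
      have h3 := (Λ.wr_iff f c).1 h1
      have h4 := Λ.row_le (hb b (!c)).le
      have h5 := Λ.row_le h2.le
      omega
    · have h4 := Λ.row_le (hb (!b) c).le
      have h5 := Λ.row_le (not_lt.1 hlt)
      omega
  · intro hw
    by_contra hc
    have hne : Λ.pos (G.vt f c) ≠ Λ.pos (G.vt f (!c)) := fun h => Λ.ne f c (Λ.pos_inj h)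
    obtain ⟨h1, h2⟩ := hl.2 ⟨hw, by omega⟩
    have h3 := (Λ.wr_iff e b).1 h1
    have h4 := (Λ.wr_iff f c).1 hw
    have h5 := Λ.row_le (hb b (!c)).le
    have h6 := Λ.row_le (not_lt.1 hc)
    omega

/-- By `lane_order` the earlier edge stays within the row, and the later one either does so too or
runs to the right from its end in this row. Vertices of one row are three columns apart, so ends
shifted by one column remain separated. -/
theorem main_main_aux {e f : Fin G.m} {b c : Bool} {p : ℤ × ℤ}
    (he : Λ.Main e b p) (hf : Λ.Main f c p)
    (hb : ∀ b c, Λ.pos (G.vt e b) < Λ.pos (G.vt f c)) : False := by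
  have hl : Λ.lane e b = Λ.lane f c := by have := he.1; have := hf.1; omega
  obtain ⟨hr, -, -⟩ := Λ.lane_decode hl
  obtain ⟨h1, h2⟩ := Λ.lane_order hl hb
  obtain ⟨h3, h4⟩ := he.extent.2 h1
  by_cases hw : Λ.wr f
  · have h5 := hf.extent.1 hw
    have a1 := Λ.px_lt_of_pos hr (hb b c)
    have a2 := Λ.px_lt_of_pos (h3.symm.trans hr) (hb (!b) c)
    omega
  · obtain ⟨h5, h6⟩ := hf.extent.2 hw
    have a1 := Λ.px_lt_of_pos hr (hb b c)
    have a2 := Λ.px_lt_of_pos (h3.symm.trans hr) (hb (!b) c)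
    have a3 := Λ.px_lt_of_pos (hr.trans h5) (hb b (!c))
    have a4 := Λ.px_lt_of_pos (h3.symm.trans (hr.trans h5)) (hb (!b) (!c))
    omega

theorem main_main {e f : Fin G.m} {b c : Bool} {p : ℤ × ℤ} (hne : e ≠ f)
    (he : Λ.Main e b p) (hf : Λ.Main f c p) : False := by
  have hl : Λ.lane e b = Λ.lane f c := by have := he.1; have := hf.1; omega
  rcases Λ.track_disj e f hne (Λ.lane_decode hl).2.1 with h | h
  · exact Λ.main_main_aux he hf h
  · exact Λ.main_main_aux hf he fun b c => h c b

/-- In the lane of an edge `g` no other edge runs near an end of `g`. -/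
theorem main_near {e g : Fin G.m} {b c : Bool} {p : ℤ × ℤ} (hne : e ≠ g) (he : Λ.Main e b p)
    (hl : p.2 = -Λ.lane g c) (h1 : Λ.px (G.vt g c) - 1 ≤ p.1) (h2 : p.1 ≤ Λ.px (G.vt g c) + 1) :
    False := by
  have hl : Λ.lane e b = Λ.lane g c := by have := he.1; omega
  obtain ⟨hr, ht, -⟩ := Λ.lane_decode hl
  rcases Λ.track_disj e g hne ht with hb | hb
  · obtain ⟨h3, -⟩ := Λ.lane_order hl hb
    obtain ⟨h4, h5⟩ := he.extent.2 h3
    have a1 := Λ.px_lt_of_pos hr (hb b c)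
    have a2 := Λ.px_lt_of_pos (h4.symm.trans hr) (hb (!b) c)
    omega
  · have a1 := Λ.px_lt_of_pos hr.symm (hb b c)
    by_cases hw : Λ.wr e
    · have := he.extent.1 hw; omega
    · obtain ⟨h4, h5⟩ := he.extent.2 hw
      have a2 := Λ.px_lt_of_pos (hr.symm.trans h4) (hb (!b) c)
      omega

/-- Near a vertex, only its main edge runs at its height. -/
theorem main_near_vertex {e : Fin G.m} {b : Bool} {v : Fin G.n} {p : ℤ × ℤ} (he : Λ.Main e b p)
    (hl : p.2 = -Λ.py v) (h1 : Λ.px v - 1 ≤ p.1) (h2 : p.1 ≤ Λ.px v + 1) :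
    e = (Λ.main v).1 := by
  by_contra hne
  exact Λ.main_near hne he hl (by rwa [Λ.vt_main]) (by rwa [Λ.vt_main])

theorem Stub.near {e : Fin G.m} {b : Bool} {p : ℤ × ℤ} (h : Λ.Stub e b p) :
    Λ.px (G.vt e b) - 1 ≤ p.1 ∧ p.1 ≤ Λ.px (G.vt e b) + 1 := by
  have h1 := Λ.cx_near e b
  have h3 := h.2.2
  rw [mem_uIcc_int] at h3
  omega

theorem Vert.near {e : Fin G.m} {b : Bool} {p : ℤ × ℤ} (h : Λ.Vert e b p) :
    Λ.px (G.vt e b) - 1 ≤ p.1 ∧ p.1 ≤ Λ.px (G.vt e b) + 1 := by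
  have h1 := Λ.cx_near e b
  have := h.2.1
  omega

theorem Vert.band {e : Fin G.m} {b : Bool} {p : ℤ × ℤ} (h : Λ.Vert e b p) :
    2 * (Λ.L : ℤ) * Λ.row (G.vt e b) ≤ -p.2 ∧
    -p.2 < 2 * (Λ.L : ℤ) * Λ.row (G.vt e b) + 2 * Λ.L := by
  have h1 := Λ.lane_band e b
  have h2 := Λ.py_band (G.vt e b)
  have h3 := h.2.2
  rw [mem_uIcc_int] at h3
  omega

theorem Stub.band {e : Fin G.m} {b : Bool} {p : ℤ × ℤ} (h : Λ.Stub e b p) :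
    2 * (Λ.L : ℤ) * Λ.row (G.vt e b) ≤ -p.2 ∧
    -p.2 < 2 * (Λ.L : ℤ) * Λ.row (G.vt e b) + 2 * Λ.L := by
  have h2 := Λ.py_band (G.vt e b)
  have := h.2.1
  omega

theorem Main.band {e : Fin G.m} {b : Bool} {p : ℤ × ℤ} (h : Λ.Main e b p) :
    2 * (Λ.L : ℤ) * Λ.row (G.vt e b) ≤ -p.2 ∧
    -p.2 < 2 * (Λ.L : ℤ) * Λ.row (G.vt e b) + 2 * Λ.L := by
  have h2 := Λ.lane_band e b
  have := h.1
  omega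

/-- If points of the plane are near two vertices and in the bands of their rows, the vertices are
the same. -/
theorem vertex_eq {v w : Fin G.n} {p : ℤ × ℤ}
    (hv : Λ.px v - 1 ≤ p.1 ∧ p.1 ≤ Λ.px v + 1)
    (hv' : 2 * (Λ.L : ℤ) * Λ.row v ≤ -p.2 ∧ -p.2 < 2 * (Λ.L : ℤ) * Λ.row v + 2 * Λ.L)
    (hw : Λ.px w - 1 ≤ p.1 ∧ p.1 ≤ Λ.px w + 1)
    (hw' : 2 * (Λ.L : ℤ) * Λ.row w ≤ -p.2 ∧ -p.2 < 2 * (Λ.L : ℤ) * Λ.row w + 2 * Λ.L) : v = w :=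
  Λ.px_near_inj (Λ.row_eq hv'.1 hv'.2 hw'.1 hw'.2) hv.1 hv.2 hw.1 hw.2

theorem stub_stub {e f : Fin G.m} {b c : Bool} {p : ℤ × ℤ} (h : Λ.Stub e b p) (h' : Λ.Stub f c p) :
    e = f ∧ b = c :=
  Λ.port_inj _ _ _ _ (Λ.vertex_eq h.near h.band h'.near h'.band) (h.1.trans h'.1.symm)

/-- At a vertex only two ports can have vertical pieces: port 2, in a column beside the vertex, and
the one of the ports 0 and 1 that is not the main port, in the column of the vertex. So the column
determines the port. -/
theorem vert_vert {e f : Fin G.m} {b c : Bool} {p : ℤ × ℤ} (h : Λ.Vert e b p) (h' : Λ.Vert f c p) :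
    e = f ∧ b = c := by
  have hv := Λ.vertex_eq h.near h.band h'.near h'.band
  refine Λ.port_inj _ _ _ _ hv ?_
  have h1 := h.1
  have h2 := h'.1
  have h3 := h.2.1
  have h4 := h'.2.1
  have h5 := Λ.port_lt e b
  have h6 := Λ.port_lt f c
  have h7 := Λ.mainPort_lt (G.vt f c)
  unfold cx at h3 h4
  rw [hv] at h1 h3
  rcases Λ.side_cases (G.vt f c) with h8 | h8 <;> rw [h8] at h3 h4 <;> split_ifs at h3 h4 <;> omega

theorem vert_wrap {e f : Fin G.m} {b : Bool} {p : ℤ × ℤ} (h : Λ.Vert e b p) (h' : Λ.Wrap f p) :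
    False := by
  have h1 := h.near
  have h2 := h'.2.1
  have := Λ.idx_lt (G.vt e b)
  unfold px at h1; unfold wx at h2
  omega

/-- Equal margin columns mean equal tracks. The piece of the earlier edge ends in the upper half of
the row of its late end `b`; that of the later edge begins in the lower half of the row of its early
end `c`, which is the same row or one below. -/
theorem wrap_wrap_aux {e f : Fin G.m} {p : ℤ × ℤ} (h : Λ.Wrap e p) (h' : Λ.Wrap f p)
    (hb : ∀ b c, Λ.pos (G.vt e b) < Λ.pos (G.vt f c)) : False := by
  have e1 : Λ.track e = Λ.track f := by
    have h1 := h.2.1; have h2 := h'.2.1; unfold wx at h1 h2; omega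
  obtain ⟨b, hb1⟩ : ∃ b, Λ.late e b := by
    rcases lt_trichotomy (Λ.pos (G.vt e true)) (Λ.pos (G.vt e false)) with h' | h' | h'
    · exact ⟨false, h.1, h'⟩
    · exact absurd (Λ.pos_inj h') (Λ.ne e true)
    · exact ⟨true, h.1, h'⟩
  obtain ⟨c, hc1⟩ : ∃ c, Λ.late f (!c) := by
    rcases lt_trichotomy (Λ.pos (G.vt f true)) (Λ.pos (G.vt f false)) with h | h | h
    · exact ⟨true, h'.1, h⟩
    · exact absurd (Λ.pos_inj h) (Λ.ne f true)
    · exact ⟨false, h'.1, h⟩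
  have hc2 : ¬ Λ.late f c := fun h => by
    have := hc1.2; have := h.2; rw [Bool.not_not] at *; omega
  have hb2 : Λ.row (G.vt e (!b)) < Λ.row (G.vt e b) :=
    lt_of_le_of_ne (Λ.row_le hb1.2.le) ((Λ.wr_iff e b).1 h.1).symm
  have hc3 : Λ.row (G.vt f c) < Λ.row (G.vt f (!c)) :=
    lt_of_le_of_ne (by have := Λ.row_le hc1.2.le; rwa [Bool.not_not] at this)
      ((Λ.wr_iff f c).1 h'.1)
  have l1 : Λ.lane e b = 2 * Λ.L * Λ.row (G.vt e b) + Λ.track e := by simp [lane, hb1]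
  have l2 := Λ.lane_band e (!b)
  have l3 : Λ.lane f c = 2 * Λ.L * Λ.row (G.vt f c) + Λ.track f + Λ.L := by simp [lane, hc2]
  have l4 := Λ.lane_band f (!c)
  have l5 := Λ.band_lt hb2
  have l6 := Λ.band_lt hc3
  have l7 := Λ.row_le (hb b c).le
  have l8 : 2 * (Λ.L : ℤ) * Λ.row (G.vt e b) ≤ 2 * (Λ.L : ℤ) * Λ.row (G.vt f c) := by
    have : (Λ.row (G.vt e b) : ℤ) ≤ Λ.row (G.vt f c) := by exact_mod_cast l7
    exact mul_le_mul_of_nonneg_left this (by positivity)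
  have te := Λ.track_lt e
  have h3 := h.2.2
  have h4 := h'.2.2
  rw [mem_uIcc_int] at h3 h4
  cases b <;> cases c <;> simp only [Bool.not_true, Bool.not_false] at * <;> omega

theorem wrap_wrap {e f : Fin G.m} {p : ℤ × ℤ} (h : Λ.Wrap e p) (h' : Λ.Wrap f p) : e = f := by
  by_contra hne
  have e1 : Λ.track e = Λ.track f := by
    have h1 := h.2.1; have h2 := h'.2.1; unfold wx at h1 h2; omega
  rcases Λ.track_disj e f hne e1 with hb | hb
  · exact Λ.wrap_wrap_aux h h' hb
  · exact Λ.wrap_wrap_aux h' h fun b c => hb c b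

/-- A lane piece and a piece at port 2 of different edges meet at most in the vertex. -/
theorem main_stub {e f : Fin G.m} {b c : Bool} {p : ℤ × ℤ} (h : Λ.Main e b p) (h' : Λ.Stub f c p) :
    e ≠ f ∧ p = (Λ.px (G.vt f c), -Λ.py (G.vt f c)) := by
  have he := Λ.main_near_vertex h h'.2.1 h'.near.1 h'.near.2
  have hv := Λ.vt_main (G.vt f c)
  have hp := Λ.port_main (G.vt f c)
  have hlt := Λ.mainPort_lt (G.vt f c)
  have hne := Λ.edge_ne hv (by have := h'.1; omega)
  refine ⟨he ▸ hne, Prod.ext ?_ h'.2.1⟩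
  -- the end of `e` at the vertex
  obtain ⟨d, hd⟩ : ∃ d, (Λ.main (G.vt f c)) = (e, d) := ⟨_, Prod.ext he.symm rfl⟩
  rw [hd] at hv hp
  simp only at hv hp
  have hm : Λ.port e d = Λ.mainPort (G.vt e d) := by rw [hv]; exact hp
  have hs := Λ.side_main e d hm
  have hd' : b = d ∨ (b = !d ∧ ¬ Λ.wr e) := by
    by_cases hbd : b = d
    · exact Or.inl hbd
    · have hbd' : b = !d := by cases b <;> cases d <;> simp_all
      refine Or.inr ⟨hbd', fun hw => ?_⟩
      have h1 := h.band
      have h2 := h'.band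
      rw [← hv] at h2
      rw [hbd'] at h1
      exact (Λ.wr_iff e d).1 hw (Λ.row_eq h2.1 h2.2 h1.1 h1.2)
  have hc2 : Λ.cx f c = Λ.px (G.vt f c) + Λ.side (G.vt f c) := by simp [cx, h'.1]
  have hcd : Λ.cx e d = Λ.px (G.vt e d) := by
    have : Λ.port e d ≠ 2 := by omega
    simp [cx, this]
  have h1 := h'.2.2
  have h2 := h.2
  rw [mem_uIcc_int] at h1 h2
  rw [hc2, ← hv, hs] at h1
  rw [← hv]
  have hn := Λ.cx_near e (!d)
  by_cases hw : Λ.wr e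
  · have hR : Λ.toRight e d := Or.inl hw
    rw [if_pos hR] at h1
    obtain rfl : b = d := hd'.resolve_right fun h => h.2 hw
    rw [if_pos hw, hcd] at h2
    have := Λ.idx_lt (G.vt e b)
    unfold px wx at *
    omega
  · rw [if_neg hw] at h2
    have hr : Λ.row (G.vt e d) = Λ.row (G.vt e (!d)) := by
      by_contra h; exact hw ((Λ.wr_iff e d).2 h)
    have h3 : (Λ.px (G.vt e d) ≤ p.1 ∧ p.1 ≤ Λ.cx e (!d)) ∨
        (Λ.cx e (!d) ≤ p.1 ∧ p.1 ≤ Λ.px (G.vt e d)) := by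
      rcases hd' with rfl | ⟨rfl, -⟩
      · rw [hcd] at h2; exact h2
      · rw [Bool.not_not, hcd] at h2; omega
    by_cases hlt : Λ.pos (G.vt e d) < Λ.pos (G.vt e (!d))
    · have hR : Λ.toRight e d := Or.inr hlt
      rw [if_pos hR] at h1
      have := Λ.px_lt_of_pos hr hlt
      omega
    · rw [if_neg (by unfold toRight; tauto)] at h1
      have hlt' : Λ.pos (G.vt e (!d)) < Λ.pos (G.vt e d) :=
        lt_of_le_of_ne (not_lt.1 hlt) fun h => Λ.ne e d (Λ.pos_inj h).symm
      have := Λ.px_lt_of_pos hr.symm hlt'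
      omega

end Layout
-- Corners and segments of the paths
namespace Layout

open Classical

variable {G : MDigraph} (Λ : Layout G)

theorem mem_seg_h {x₁ x₂ y : ℤ} {p : ℤ × ℤ} (h : p ∈ Set.uIcc (x₁, y) (x₂, y)) :
    p.2 = y ∧ p.1 ∈ Set.uIcc x₁ x₂ := by
  rw [← Set.uIcc_prod_uIcc] at h
  exact ⟨by simpa using h.2, h.1⟩

theorem mem_seg_v {x y₁ y₂ : ℤ} {p : ℤ × ℤ} (h : p ∈ Set.uIcc (x, y₁) (x, y₂)) :
    p.1 = x ∧ p.2 ∈ Set.uIcc y₁ y₂ := by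
  rw [← Set.uIcc_prod_uIcc] at h
  exact ⟨by simpa using h.1, h.2⟩

/-- The number of bends at port 2 before the vertical piece. -/
noncomputable def nStub (e : Fin G.m) (b : Bool) : ℕ := if Λ.port e b = 2 then 1 else 0

noncomputable def nVert (e : Fin G.m) (b : Bool) : ℕ :=
  if Λ.port e b ≠ Λ.mainPort (G.vt e b) then 1 else 0

noncomputable def nWrap (e : Fin G.m) : ℕ := if Λ.wr e then 1 else 0

/-- The segment `i` is number `k` from the end `b`. -/
def NumFrom (e : Fin G.m) (b : Bool) (k i : ℕ) : Prop :=
  if b then i + k = Λ.drawing.bends e else i = k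

theorem bends_eq (e : Fin G.m) : Λ.drawing.bends e = Λ.nStub e false + Λ.nVert e false +
    2 * Λ.nWrap e + Λ.nVert e true + Λ.nStub e true := by
  simp only [drawing, path, half, nStub, nVert, nWrap, List.length_map, List.reverse_cons,
    List.reverse_nil, List.nil_append, List.cons_append, List.filter_cons, decide_eq_true_eq,
    if_true]
  split_ifs <;> simp

theorem path_length (e : Fin G.m) : (Λ.path e).length = Λ.drawing.bends e + 2 := by
  rw [bends_eq]
  simp only [path, half, nStub, nVert, nWrap, List.length_map, List.reverse_cons,
    List.reverse_nil, List.nil_append, List.cons_append, List.filter_cons, decide_eq_true_eq,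
    if_true]
  split_ifs <;> simp

theorem not_wr {e : Fin G.m} (h : ¬ Λ.wr e) : Λ.lane e false = Λ.lane e true := by
  have h1 : ¬ Λ.late e false := fun h' => h h'.1
  have h2 : ¬ Λ.late e true := fun h' => h h'.1
  have h3 : Λ.row (G.vt e false) = Λ.row (G.vt e true) := by
    by_contra h'; exact h ((Λ.wr_iff e false).2 h')
  simp [lane, h1, h2, h3]

/-- The corners between the end `b` and the lane. -/
noncomputable def pre (e : Fin G.m) (b : Bool) : List (ℤ × ℤ) :=
  (((Λ.half e b).take 3).filter Prod.fst).map Prod.snd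

theorem path_eq (e : Fin G.m) : Λ.path e = Λ.pre e false ++
    (if Λ.wr e then [(Λ.wx e, -Λ.lane e false), (Λ.wx e, -Λ.lane e true)] else []) ++
    (Λ.pre e true).reverse := by
  have h : ∀ b, ((Λ.half e b).filter Prod.fst).map Prod.snd =
      Λ.pre e b ++ if Λ.wr e then [(Λ.wx e, -Λ.lane e b)] else [] := by
    intro b
    simp only [half, pre, List.take_succ_cons, List.take_zero, List.filter_cons, decide_eq_true_eq,
      if_true]
    split_ifs <;> simp
  rw [path, List.filter_append, List.map_append, List.filter_reverse, List.map_reverse, h, h]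
  split_ifs <;> simp

/-- The three ways to attach an edge: by the side, by the bottom, or along the lane. In the last
case the vertex lies on the lane, so the first corner on the lane is the vertex itself. -/
theorem port_cases (e : Fin G.m) (b : Bool) :
    (Λ.port e b = 2 ∧ Λ.port e b ≠ Λ.mainPort (G.vt e b) ∧ Λ.nStub e b = 1 ∧ Λ.nVert e b = 1 ∧
      Λ.pre e b = [(Λ.px (G.vt e b), -Λ.py (G.vt e b)), (Λ.cx e b, -Λ.py (G.vt e b)),
        (Λ.cx e b, -Λ.lane e b)] ∧ Λ.px (G.vt e b) ≠ Λ.cx e b ∧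
          Λ.py (G.vt e b) ≠ Λ.lane e b) ∨
    (Λ.port e b ≠ Λ.mainPort (G.vt e b) ∧ Λ.nStub e b = 0 ∧ Λ.nVert e b = 1 ∧
      Λ.pre e b = [(Λ.cx e b, -Λ.py (G.vt e b)), (Λ.cx e b, -Λ.lane e b)] ∧
      Λ.py (G.vt e b) < Λ.lane e b) ∨
    (Λ.port e b = Λ.mainPort (G.vt e b) ∧ Λ.nStub e b = 0 ∧ Λ.nVert e b = 0 ∧
      Λ.pre e b = [(Λ.cx e b, -Λ.lane e b)]) := by
  have := Λ.mainPort_lt (G.vt e b)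
  by_cases h : Λ.port e b = 2
  · have h' : Λ.port e b ≠ Λ.mainPort (G.vt e b) := by omega
    refine Or.inl ⟨h, h', by simp [nStub, h], by simp [nVert, h'], by simp [pre, half, h, show ¬ 2 = Λ.mainPort (G.vt e b) by omega], ?_,
      Λ.py_ne e b h'⟩
    · simp only [cx, h, if_true]
      have := Λ.side_cases (G.vt e b)
      omega
  · right
    have hc : Λ.cx e b = Λ.px (G.vt e b) := by simp [cx, h]
    by_cases h' : Λ.port e b = Λ.mainPort (G.vt e b)
    · refine Or.inr ⟨h', by simp [nStub, h], by simp [nVert, h'], ?_⟩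
      rw [← Λ.py_main e b h', hc]
      simp [pre, half, h']
      omega
    · exact Or.inl ⟨h', by simp [nStub, h], by simp [nVert, h'], by simp [pre, half, h, h', hc],
        Λ.py_lt e b h h'⟩

/-- All later arguments about segments use only their kind and their number. Numbers are counted
from the end `b` by `NumFrom`, so that both ends can be treated alike. -/
theorem seg_kind (e : Fin G.m) (i : ℕ) (hi : i ≤ Λ.drawing.bends e) :
    (∃ b, Λ.NumFrom e b 0 i ∧ ∀ p ∈ Λ.drawing.seg e i, Λ.Stub e b p) ∨
    (∃ b, Λ.NumFrom e b (Λ.nStub e b) i ∧ ∀ p ∈ Λ.drawing.seg e i, Λ.Vert e b p) ∨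
    (∃ b, Λ.NumFrom e b (Λ.nStub e b + Λ.nVert e b) i ∧
      ∀ p ∈ Λ.drawing.seg e i, Λ.Main e b p) ∨
    (Λ.NumFrom e false (Λ.nStub e false + Λ.nVert e false + 1) i ∧
      ∀ p ∈ Λ.drawing.seg e i, Λ.Wrap e p) := by
  have hb := Λ.bends_eq e
  have hp := Λ.path_eq e
  have S1 : ∀ b p, Λ.port e b = 2 →
      p ∈ Set.uIcc (Λ.px (G.vt e b), -Λ.py (G.vt e b)) (Λ.cx e b, -Λ.py (G.vt e b)) →
      Λ.Stub e b p := fun b p h hp => ⟨h, mem_seg_h hp⟩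
  have S2 : ∀ b p, Λ.port e b = 2 →
      p ∈ Set.uIcc (Λ.cx e b, -Λ.py (G.vt e b)) (Λ.px (G.vt e b), -Λ.py (G.vt e b)) →
      Λ.Stub e b p := fun b p h hp => by
    rw [Set.uIcc_comm] at hp; exact ⟨h, mem_seg_h hp⟩
  have V1 : ∀ b p, Λ.port e b ≠ Λ.mainPort (G.vt e b) →
      p ∈ Set.uIcc (Λ.cx e b, -Λ.py (G.vt e b)) (Λ.cx e b, -Λ.lane e b) →
      Λ.Vert e b p := fun b p h hp => ⟨h, mem_seg_v hp⟩
  have V2 : ∀ b p, Λ.port e b ≠ Λ.mainPort (G.vt e b) →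
      p ∈ Set.uIcc (Λ.cx e b, -Λ.lane e b) (Λ.cx e b, -Λ.py (G.vt e b)) →
      Λ.Vert e b p := fun b p h hp => by
    rw [Set.uIcc_comm] at hp; exact ⟨h, mem_seg_v hp⟩
  have M1 : ∀ b p, Λ.wr e → p ∈ Set.uIcc (Λ.cx e b, -Λ.lane e b) (Λ.wx e, -Λ.lane e b) →
      Λ.Main e b p := fun b p h hp => by
    obtain ⟨h1, h2⟩ := mem_seg_h hp
    exact ⟨h1, by rwa [if_pos h]⟩
  have M2 : ∀ b p, Λ.wr e → p ∈ Set.uIcc (Λ.wx e, -Λ.lane e b) (Λ.cx e b, -Λ.lane e b) →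
      Λ.Main e b p := fun b p h hp => by
    rw [Set.uIcc_comm] at hp; exact M1 b p h hp
  have M3 : ∀ p, ¬ Λ.wr e → p ∈ Set.uIcc (Λ.cx e false, -Λ.lane e false)
      (Λ.cx e true, -Λ.lane e true) → Λ.Main e false p := fun p h hp => by
    rw [← Λ.not_wr h] at hp
    obtain ⟨h1, h2⟩ := mem_seg_h hp
    exact ⟨h1, by rwa [if_neg h]⟩
  have W1 : ∀ p, Λ.wr e → p ∈ Set.uIcc (Λ.wx e, -Λ.lane e false)
      (Λ.wx e, -Λ.lane e true) → Λ.Wrap e p := fun p h hp => ⟨h, mem_seg_v hp⟩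
  simp only [NumFrom, Drawing.seg]
  rw [hb] at hi ⊢
  have hpt : ∀ i, Λ.drawing.pt e i = (Λ.path e).getD i 0 := fun _ => rfl
  simp only [hpt, hp]
  -- Two cases for the rows and three for the attachment of each end: in each of these the path is
  -- an explicit list of at most eight corners.
  by_cases hw : Λ.wr e <;>
    rcases Λ.port_cases e false with ⟨h0, h1, h2, h3, h4, -⟩ | ⟨h1, h2, h3, h4, -⟩ |
      ⟨h1, h2, h3, h4⟩ <;>
    rcases Λ.port_cases e true with ⟨g0, g1, g2, g3, g4, -⟩ | ⟨g1, g2, g3, g4, -⟩ |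
      ⟨g1, g2, g3, g4⟩ <;>
    simp only [nWrap, hw, h2, h3, h4, g2, g3, g4, if_true, if_false, List.cons_append,
      List.nil_append, List.append_nil, List.reverse_cons, List.reverse_nil] at hi ⊢ <;>
    interval_cases i
  all_goals first
    | exact Or.inl ⟨false, rfl, fun p => S1 false p h0⟩
    | exact Or.inl ⟨true, rfl, fun p => S2 true p g0⟩
    | exact Or.inr (Or.inl ⟨false, h2.symm, fun p => V1 false p h1⟩)
    | exact Or.inr (Or.inl ⟨true, by rw [g2]; rfl, fun p => V2 true p g1⟩)
    | exact Or.inr (Or.inr (Or.inl ⟨false, by rw [h2, h3]; rfl, fun p => M1 false p hw⟩))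
    | exact Or.inr (Or.inr (Or.inl ⟨true, by rw [g2, g3]; rfl, fun p => M2 true p hw⟩))
    | exact Or.inr (Or.inr (Or.inl ⟨false, by rw [h2, h3]; rfl, fun p => M3 p hw⟩))
    | exact Or.inr (Or.inr (Or.inr ⟨rfl, fun p => W1 p hw⟩))

end Layout
-- The drawing is orthogonal and Knuthian
namespace Layout

open Classical

variable {G : MDigraph} (Λ : Layout G)

theorem cx_ne_wx (e : Fin G.m) (b : Bool) : Λ.cx e b ≠ Λ.wx e := by
  have h1 := Λ.cx_near e b
  have := Λ.idx_lt (G.vt e b)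
  unfold px at h1; unfold wx
  omega

theorem wr_facts {e : Fin G.m} (h : Λ.wr e) : Λ.lane e false ≠ Λ.lane e true := fun h' =>
  (Λ.wr_iff e false).1 h (Λ.lane_decode h').1

theorem not_wr_facts {e : Fin G.m} (h : ¬ Λ.wr e) : Λ.cx e false ≠ Λ.cx e true := by
  intro h'
  have h3 : Λ.row (G.vt e false) = Λ.row (G.vt e true) := by
    by_contra h'; exact h ((Λ.wr_iff e false).2 h')
  have h1 := Λ.cx_near e false
  have h2 := Λ.cx_near e true
  exact Λ.ne e false (Λ.px_near_inj h3 h1.1 h1.2 (by rw [h']; exact h2.1) (by rw [h']; exact h2.2))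

theorem xor_of_left {p q : Prop} (hp : p) (hq : ¬ q) : Xor p q := Or.inl ⟨hp, hq⟩

theorem xor_of_right {p q : Prop} (hp : ¬ p) (hq : q) : Xor p q := Or.inr ⟨hq, hp⟩

theorem axis_turn (e : Fin G.m) :
    (∀ i ≤ Λ.drawing.bends e, Xor ((Λ.drawing.pt e i).1 = (Λ.drawing.pt e (i + 1)).1)
      ((Λ.drawing.pt e i).2 = (Λ.drawing.pt e (i + 1)).2)) ∧
    (∀ i < Λ.drawing.bends e, (Λ.drawing.pt e i).1 ≠ (Λ.drawing.pt e (i + 2)).1 ∧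
      (Λ.drawing.pt e i).2 ≠ (Λ.drawing.pt e (i + 2)).2) := by
  have hb := Λ.bends_eq e
  have hp := Λ.path_eq e
  have c0 := Λ.cx_ne_wx e false
  have c1 := Λ.cx_ne_wx e true
  have hpt : ∀ i, Λ.drawing.pt e i = (Λ.path e).getD i 0 := fun _ => rfl
  simp only [hpt, hp]
  rw [hb]
  have L : (Λ.wr e ∧ Λ.lane e false ≠ Λ.lane e true) ∨ (¬ Λ.wr e ∧
      Λ.lane e false = Λ.lane e true ∧ Λ.cx e false ≠ Λ.cx e true) := by
    by_cases hw : Λ.wr e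
    · exact Or.inl ⟨hw, Λ.wr_facts hw⟩
    · exact Or.inr ⟨hw, Λ.not_wr hw, Λ.not_wr_facts hw⟩
  rcases L with ⟨hw, l⟩ | ⟨hw, l, c⟩ <;>
    rcases Λ.port_cases e false with ⟨h0, h1, h2, h3, h4, h5, h6⟩ | ⟨h1, h2, h3, h4, h5⟩ |
      ⟨h1, h2, h3, h4⟩ <;>
    rcases Λ.port_cases e true with ⟨g0, g1, g2, g3, g4, g5, g6⟩ | ⟨g1, g2, g3, g4, g5⟩ |
      ⟨g1, g2, g3, g4⟩ <;>
    simp only [nWrap, hw, h2, h3, h4, g2, g3, g4, if_true, if_false, List.cons_append,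
      List.nil_append, List.append_nil, List.reverse_cons, List.reverse_nil] <;>
    refine ⟨fun i hi => ?_, fun i hi => ?_⟩ <;>
    interval_cases i <;>
    simp only [List.getD_cons_zero, List.getD_cons_succ, zero_add, Nat.reduceAdd]
  all_goals first
    | (refine xor_of_left trivial ?_; omega)
    | (refine xor_of_right ?_ trivial; omega)
    | (refine xor_of_right ?_ ?_ <;> omega)
    | (constructor <;> omega)

theorem pt_zero (e : Fin G.m) : Λ.drawing.pt e 0 = Λ.drawing.pos (G.src e) := rfl

theorem pt_last (e : Fin G.m) :
    Λ.drawing.pt e (Λ.drawing.bends e + 1) = Λ.drawing.pos (G.tgt e) := by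
  have h := Λ.path_length e
  have h2 : Λ.drawing.pt e (Λ.drawing.bends e + 1) = (Λ.path e).getD (Λ.drawing.bends e + 1) 0 :=
    rfl
  have h3 : (Λ.path e).getLast? = some (Λ.drawing.pos (G.tgt e)) := by
    have h4 : (Λ.half e true).reverse =
        (Λ.half e true).tail.reverse ++ [(true, Λ.drawing.pos (G.tgt e))] := by
      rw [← List.reverse_cons]; rfl
    rw [path, h4, ← List.append_assoc, List.filter_append, List.map_append]
    simp
  rw [h2, List.getD_eq_getElem?_getD]
  rw [List.getLast?_eq_getElem?, h] at h3
  rw [show Λ.drawing.bends e + 1 = Λ.drawing.bends e + 2 - 1 by omega, h3]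
  rfl

def HPiece (e : Fin G.m) (p : ℤ × ℤ) : Prop := ∃ b, Λ.Stub e b p ∨ Λ.Main e b p

def VPiece (e : Fin G.m) (p : ℤ × ℤ) : Prop := (∃ b, Λ.Vert e b p) ∨ Λ.Wrap e p

theorem seg_piece (e : Fin G.m) (i : ℕ) (hi : i ≤ Λ.drawing.bends e) :
    ((∀ p ∈ Λ.drawing.seg e i, Λ.HPiece e p) ∧
      ∀ p ∈ Λ.drawing.seg e i, ∀ q ∈ Λ.drawing.seg e i, p.2 = q.2) ∨
    ((∀ p ∈ Λ.drawing.seg e i, Λ.VPiece e p) ∧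
      ∀ p ∈ Λ.drawing.seg e i, ∀ q ∈ Λ.drawing.seg e i, p.1 = q.1) := by
  rcases Λ.seg_kind e i hi with ⟨b, -, h⟩ | ⟨b, -, h⟩ | ⟨b, -, h⟩ | ⟨-, h⟩
  · exact Or.inl ⟨fun p hp => ⟨b, Or.inl (h p hp)⟩,
      fun p hp q hq => (h p hp).2.1.trans (h q hq).2.1.symm⟩
  · exact Or.inr ⟨fun p hp => Or.inl ⟨b, h p hp⟩,
      fun p hp q hq => (h p hp).2.1.trans (h q hq).2.1.symm⟩
  · exact Or.inl ⟨fun p hp => ⟨b, Or.inr (h p hp)⟩,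
      fun p hp q hq => (h p hp).1.trans (h q hq).1.symm⟩
  · exact Or.inr ⟨fun p hp => Or.inr (h p hp),
      fun p hp q hq => (h p hp).2.1.trans (h q hq).2.1.symm⟩

theorem vPiece_inter {e f : Fin G.m} (hne : e ≠ f) {p : ℤ × ℤ} (h : Λ.VPiece e p)
    (h' : Λ.VPiece f p) : False := by
  rcases h with ⟨b, h⟩ | h <;> rcases h' with ⟨c, h'⟩ | h'
  · exact hne (Λ.vert_vert h h').1
  · exact Λ.vert_wrap h h'
  · exact Λ.vert_wrap h' h
  · exact hne (Λ.wrap_wrap h h')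

/-- Horizontal pieces of different edges meet only in vertices. -/
theorem hPiece_inter {e f : Fin G.m} (hne : e ≠ f) {p : ℤ × ℤ} (h : Λ.HPiece e p)
    (h' : Λ.HPiece f p) : ∃ v, p = Λ.drawing.pos v := by
  obtain ⟨b, h | h⟩ := h <;> obtain ⟨c, h' | h'⟩ := h'
  · exact absurd (Λ.stub_stub h h').1 hne
  · exact ⟨_, (Λ.main_stub h' h).2⟩
  · exact ⟨_, (Λ.main_stub h h').2⟩
  · exact (Λ.main_main hne h h').elim

theorem pos_injective : Function.Injective Λ.drawing.pos := by
  intro v w h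
  have h1 : Λ.px v = Λ.px w := (Prod.ext_iff.1 h).1
  have h2 : Λ.py v = Λ.py w := neg_inj.1 (Prod.ext_iff.1 h).2
  have h3 := Λ.py_band v
  have h4 := Λ.py_band w
  rw [← h2] at h4
  exact Λ.px_near_inj (Λ.row_eq h3.1 h3.2 h4.1 h4.2) (x := Λ.px v) (by omega) (by omega)
    (by omega) (by omega)

theorem eq_or_eq_not (b c : Bool) : b = c ∨ b = !c := by cases b <;> cases c <;> simp

theorem nStub_zero {e : Fin G.m} {b : Bool} (h : Λ.port e b = Λ.mainPort (G.vt e b)) :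
    Λ.nStub e b = 0 ∧ Λ.nVert e b = 0 := by
  have := Λ.mainPort_lt (G.vt e b)
  have h' : Λ.port e b ≠ 2 := by omega
  simp [nStub, nVert, h]
  omega

theorem numFrom_end {e : Fin G.m} {b : Bool} {i : ℕ} (h : Λ.NumFrom e b 0 i) :
    (i = 0 ∧ G.vt e b = G.src e) ∨ (i = Λ.drawing.bends e ∧ G.vt e b = G.tgt e) := by
  cases b
  · exact Or.inl ⟨by simpa [NumFrom] using h, rfl⟩
  · exact Or.inr ⟨by simpa [NumFrom] using h, rfl⟩

/-- The lane pieces of an edge whose ends are in one row are the same. -/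
theorem numFrom_main {e : Fin G.m} {b : Bool} {i : ℕ} (hw : ¬ Λ.wr e)
    (h : Λ.NumFrom e b (Λ.nStub e b + Λ.nVert e b) i) (c : Bool) :
    Λ.NumFrom e c (Λ.nStub e c + Λ.nVert e c) i := by
  have hb := Λ.bends_eq e
  simp only [nWrap, hw, if_false] at hb
  cases b <;> cases c <;> simp only [NumFrom, if_true, if_false, Bool.false_eq_true] at h ⊢ <;> omega

/-- A stub or a vertical piece stays within one column of its own vertex and in the band of that
vertex's row, so it can meet no other vertex. A lane piece that passes through a vertex belongs to
its main edge and is then a first or last segment. The margin columns are to the right of all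
vertices. -/
theorem avoids (v : Fin G.n) (e : Fin G.m) (i : ℕ) (hi : i ≤ Λ.drawing.bends e)
    (hv : Λ.drawing.pos v ∈ Λ.drawing.seg e i) :
    (i = 0 ∧ v = G.src e) ∨ (i = Λ.drawing.bends e ∧ v = G.tgt e) := by
  have hn : Λ.px v - 1 ≤ (Λ.drawing.pos v).1 ∧ (Λ.drawing.pos v).1 ≤ Λ.px v + 1 := by
    simp [drawing]
  have hb : 2 * (Λ.L : ℤ) * Λ.row v ≤ -(Λ.drawing.pos v).2 ∧
      -(Λ.drawing.pos v).2 < 2 * (Λ.L : ℤ) * Λ.row v + 2 * Λ.L := by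
    have := Λ.py_band v
    simpa [drawing] using this
  rcases Λ.seg_kind e i hi with ⟨b, hk, h⟩ | ⟨b, hk, h⟩ | ⟨b, hk, h⟩ | ⟨hk, h⟩
  · have h := h _ hv
    rw [Λ.vertex_eq hn hb h.near h.band]
    exact Λ.numFrom_end hk
  · have h := h _ hv
    have he := Λ.vertex_eq hn hb h.near h.band
    have h0 : Λ.nStub e b = 0 := by
      have h1 := h.2.1
      have h2 : (Λ.drawing.pos v).1 = Λ.px v := rfl
      by_contra hc
      have h3 : Λ.port e b = 2 := by
        by_contra hp; exact hc (by simp [nStub, hp])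
      rw [h2, he] at h1
      have := Λ.side_cases (G.vt e b)
      simp only [cx, h3, if_true] at h1
      omega
    rw [h0] at hk
    rw [he]
    exact Λ.numFrom_end hk
  · have h := h _ hv
    have he := Λ.main_near_vertex h rfl hn.1 hn.2
    have h1 := Λ.vt_main v
    have h2 := Λ.port_main v
    rw [← he] at h1 h2
    set d := (Λ.main v).2
    obtain ⟨h3, h4⟩ := Λ.nStub_zero (e := e) (b := d) (by rw [h1]; exact h2)
    have hd : Λ.NumFrom e d (Λ.nStub e d + Λ.nVert e d) i := by
      by_cases hw : Λ.wr e
      · rcases eq_or_eq_not b d with rfl | hbd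
        · exact hk
        · exfalso
          have h5 := h.band
          rw [hbd] at h5
          refine (Λ.wr_iff e d).1 hw ?_
          rw [h1]
          exact Λ.row_eq hb.1 hb.2 h5.1 h5.2
      · exact Λ.numFrom_main hw hk d
    rw [h3, h4] at hd
    rw [← h1]
    exact Λ.numFrom_end hd
  · exfalso
    have h1 := (h _ hv).2.1
    have h2 : (Λ.drawing.pos v).1 = Λ.px v := rfl
    have := Λ.idx_lt v
    unfold px at h2; unfold wx at h1
    omega

/-- Pieces of different kinds that can share a point are stub and vertical piece (`SV`), vertical
piece and lane piece (`VM`), lane piece and margin piece (`MW`), and these are consecutive. Stub and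
lane piece of one edge are kept apart by `main_stub`, which yields different edges. -/
theorem simple (e : Fin G.m) (i j : ℕ) (hi : i ≤ Λ.drawing.bends e) (hj : j ≤ Λ.drawing.bends e)
    (h : (Λ.drawing.seg e i ∩ Λ.drawing.seg e j).Nonempty) : i = j ∨ i + 1 = j ∨ j + 1 = i := by
  obtain ⟨p, hp, hq⟩ := h
  have hb := Λ.bends_eq e
  have same : ∀ b k, Λ.NumFrom e b k i → Λ.NumFrom e b k j → i = j := by
    intro b k h1 h2
    cases b <;> simp only [NumFrom, if_true, if_false, Bool.false_eq_true] at h1 h2 <;> omega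
  have SV : ∀ b c i j, Λ.NumFrom e b 0 i → Λ.NumFrom e c (Λ.nStub e c) j → Λ.Stub e b p →
      Λ.Vert e c p → i + 1 = j ∨ j + 1 = i := by
    intro b c i j h1 h2 h3 h4
    have hv := Λ.vertex_eq h3.near h3.band h4.near h4.band
    rcases eq_or_eq_not c b with rfl | rfl
    · have : Λ.nStub e c = 1 := by simp [nStub, h3.1]
      rw [this] at h2
      cases c <;> simp only [NumFrom, if_true, if_false, Bool.false_eq_true] at h1 h2 <;> omega
    · exact absurd hv (Λ.ne e b)
  have SW : ∀ b, Λ.Stub e b p → Λ.Wrap e p → False := by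
    intro b h1 h2
    have h3 := h1.near
    have h2 := h2.2.1
    have := Λ.idx_lt (G.vt e b)
    unfold px at h3; unfold wx at h2
    omega
  have VM : ∀ b c i j, Λ.NumFrom e b (Λ.nStub e b) i →
      Λ.NumFrom e c (Λ.nStub e c + Λ.nVert e c) j → Λ.Vert e b p → Λ.Main e c p →
      i + 1 = j ∨ j + 1 = i := by
    intro b c i j h1 h2 h3 h4
    have hbd : Λ.NumFrom e b (Λ.nStub e b + Λ.nVert e b) j := by
      by_cases hw : Λ.wr e
      · rcases eq_or_eq_not c b with rfl | hbd
        · exact h2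
        · exfalso
          have h5 := h4.band
          have h6 := h3.band
          rw [hbd] at h5
          exact (Λ.wr_iff e b).1 hw (Λ.row_eq h6.1 h6.2 h5.1 h5.2)
      · exact Λ.numFrom_main hw h2 b
    have : Λ.nVert e b = 1 := by simp [nVert, h3.1]
    rw [this] at hbd
    cases b <;> simp only [NumFrom, if_true, if_false, Bool.false_eq_true] at h1 hbd <;> omega
  have MW : ∀ b i j, Λ.NumFrom e b (Λ.nStub e b + Λ.nVert e b) i →
      Λ.NumFrom e false (Λ.nStub e false + Λ.nVert e false + 1) j → Λ.Wrap e p →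
      i + 1 = j ∨ j + 1 = i := by
    intro b i j h1 h2 h3
    have : Λ.nWrap e = 1 := by simp [nWrap, h3.1]
    cases b <;> simp only [NumFrom, if_true, if_false, Bool.false_eq_true] at h1 h2 <;> omega
  rcases Λ.seg_kind e i hi with ⟨b, hk, h⟩ | ⟨b, hk, h⟩ | ⟨b, hk, h⟩ | ⟨hk, h⟩ <;>
    rcases Λ.seg_kind e j hj with ⟨c, gk, g⟩ | ⟨c, gk, g⟩ | ⟨c, gk, g⟩ | ⟨gk, g⟩ <;>
    have h := h p hp <;> have g := g p hq
  · obtain rfl := (Λ.stub_stub h g).2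
    exact Or.inl (same _ _ hk gk)
  · exact Or.inr (SV _ _ _ _ hk gk h g)
  · exact absurd rfl (Λ.main_stub g h).1
  · exact (SW _ h g).elim
  · exact Or.inr (SV _ _ _ _ gk hk g h).symm
  · obtain rfl := (Λ.vert_vert h g).2
    exact Or.inl (same _ _ hk gk)
  · exact Or.inr (VM _ _ _ _ hk gk h g)
  · exact (Λ.vert_wrap h g).elim
  · exact absurd rfl (Λ.main_stub h g).1
  · exact Or.inr (VM _ _ _ _ gk hk g h).symm
  · by_cases hw : Λ.wr e
    · rcases eq_or_eq_not c b with rfl | hbd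
      · exact Or.inl (same _ _ hk gk)
      · exfalso
        have h5 := g.band
        have h6 := h.band
        rw [hbd] at h5
        exact (Λ.wr_iff e b).1 hw (Λ.row_eq h6.1 h6.2 h5.1 h5.2)
    · exact Or.inl (same _ _ hk (Λ.numFrom_main hw gk b))
  · exact Or.inr (MW _ _ _ hk gk g)
  · exact (SW _ g h).elim
  · exact (Λ.vert_wrap g h).elim
  · exact Or.inr (MW _ _ _ gk hk h).symm
  · exact Or.inl (same _ _ hk gk)

theorem left_mem (e : Fin G.m) (i : ℕ) : Λ.drawing.pt e i ∈ Λ.drawing.seg e i :=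
  Set.left_mem_uIcc

theorem right_mem (e : Fin G.m) (i : ℕ) : Λ.drawing.pt e (i + 1) ∈ Λ.drawing.seg e i :=
  Set.right_mem_uIcc

theorem bend_ne_pos (e : Fin G.m) (i : ℕ) (hi : i < Λ.drawing.bends e) (v : Fin G.n) :
    Λ.drawing.pt e (i + 1) ≠ Λ.drawing.pos v := by
  intro h
  rcases Λ.avoids v e i hi.le (h ▸ Λ.right_mem e i) with ⟨-, h1⟩ | ⟨h1, -⟩
  · rcases Λ.avoids v e (i + 1) hi (h ▸ Λ.left_mem e (i + 1)) with ⟨h2, -⟩ | ⟨-, h2⟩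
    · omega
    · exact Λ.ne e false (h1.symm.trans h2)
  · omega

theorem isOrthogonal : Λ.drawing.IsOrthogonal where
  pos_injective := Λ.pos_injective
  start := Λ.pt_zero
  finish := Λ.pt_last
  axis e := (Λ.axis_turn e).1
  turn e := (Λ.axis_turn e).2
  simple e i j hij hj h := by
    have := Λ.simple e i j (by omega) hj h
    omega
  avoids := Λ.avoids
  no_overlap e f hne i hi j hj := by
    rintro p ⟨hp, hp'⟩ q ⟨hq, hq'⟩
    rcases Λ.seg_kind e i hi with ⟨b, -, h⟩ | ⟨b, -, h⟩ | ⟨b, -, h⟩ | ⟨-, h⟩ <;>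
      rcases Λ.seg_kind f j hj with ⟨c, -, g⟩ | ⟨c, -, g⟩ | ⟨c, -, g⟩ | ⟨-, g⟩ <;>
      have h1 := h p hp <;> have g1 := g p hp' <;> have h2 := h q hq <;> have g2 := g q hq'
    · exact absurd (Λ.stub_stub h1 g1).1 hne
    · exact Prod.ext (g1.2.1.trans g2.2.1.symm) (h1.2.1.trans h2.2.1.symm)
    · exact (Λ.main_stub g1 h1).2.trans (Λ.main_stub g2 h2).2.symm
    · exact Prod.ext (g1.2.1.trans g2.2.1.symm) (h1.2.1.trans h2.2.1.symm)
    · exact Prod.ext (h1.2.1.trans h2.2.1.symm) (g1.2.1.trans g2.2.1.symm)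
    · exact absurd (Λ.vert_vert h1 g1).1 hne
    · exact Prod.ext (h1.2.1.trans h2.2.1.symm) (g1.1.trans g2.1.symm)
    · exact (Λ.vert_wrap h1 g1).elim
    · exact (Λ.main_stub h1 g1).2.trans (Λ.main_stub h2 g2).2.symm
    · exact Prod.ext (g1.2.1.trans g2.2.1.symm) (h1.1.trans h2.1.symm)
    · exact (Λ.main_main hne h1 g1).elim
    · exact Prod.ext (g1.2.1.trans g2.2.1.symm) (h1.1.trans h2.1.symm)
    · exact Prod.ext (h1.2.1.trans h2.2.1.symm) (g1.2.1.trans g2.2.1.symm)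
    · exact (Λ.vert_wrap g1 h1).elim
    · exact Prod.ext (h1.2.1.trans h2.2.1.symm) (g1.1.trans g2.1.symm)
    · exact absurd (Λ.wrap_wrap h1 g1) hne
  -- A bend lies on a horizontal and on a vertical piece of `e`. Whatever the direction of the
  -- segment of `f`, one of the two is parallel to it, so they could meet in a vertex only; but no
  -- bend is at a vertex.
  no_touch e f hne i hi j hj hmem := by
    have hr := Λ.right_mem e i
    have hl := Λ.left_mem e (i + 1)
    have ht := (Λ.axis_turn e).2 i hi
    have hHV : Λ.HPiece e (Λ.drawing.pt e (i + 1)) ∧ Λ.VPiece e (Λ.drawing.pt e (i + 1)) := by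
      rcases Λ.seg_piece e i hi.le with ⟨h1, h2⟩ | ⟨h1, h2⟩ <;>
        rcases Λ.seg_piece e (i + 1) hi with ⟨g1, g2⟩ | ⟨g1, g2⟩
      · exact absurd ((h2 _ (Λ.left_mem e i) _ hr).trans
          (g2 _ hl _ (Λ.right_mem e (i + 1)))) ht.2
      · exact ⟨h1 _ hr, g1 _ hl⟩
      · exact ⟨g1 _ hl, h1 _ hr⟩
      · exact absurd ((h2 _ (Λ.left_mem e i) _ hr).trans
          (g2 _ hl _ (Λ.right_mem e (i + 1)))) ht.1
    rcases Λ.seg_piece f j hj with ⟨h1, -⟩ | ⟨h1, -⟩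
    · obtain ⟨v, hv⟩ := Λ.hPiece_inter hne hHV.1 (h1 _ hmem)
      exact Λ.bend_ne_pos e i hi v hv
    · exact Λ.vPiece_inter hne hHV.2 (h1 _ hmem)

/-- At its source an edge starts with a stub, with a descent to a deeper lane, or in its lane, hence
never upwards. At a non-junction target its port is 2, so the last segment is a horizontal stub. -/
theorem isKnuthian : Λ.drawing.IsKnuthian where
  orthogonal := Λ.isOrthogonal
  no_up_out e _ hlt := by
    have hpt : ∀ i, Λ.drawing.pt e i = (Λ.path e).getD i 0 := fun _ => rfl
    rw [hpt, hpt, Λ.path_eq] at hlt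
    rcases Λ.port_cases e false with ⟨-, -, -, -, h, -⟩ | ⟨-, -, -, h, h'⟩ | ⟨h0, -, -, h⟩
    · rw [h] at hlt; simp at hlt
    · rw [h] at hlt; simp at hlt; omega
    · rw [h] at hlt
      by_cases hw : Λ.wr e
      · simp [hw] at hlt
      · have hl := Λ.not_wr hw
        rcases Λ.port_cases e true with ⟨-, -, -, -, g, -⟩ | ⟨-, -, -, g, -⟩ | ⟨-, -, -, g⟩ <;>
          simp [hw, g, hl] at hlt
  no_up_in e hJ hlt := by
    have hpt : ∀ i, Λ.drawing.pt e i = (Λ.path e).getD i 0 := fun _ => rfl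
    have h2 := Λ.port_in e hJ
    have hb := Λ.bends_eq e
    rw [hpt, hpt, Λ.path_eq, hb] at hlt
    rcases Λ.port_cases e true with ⟨-, -, g1, g2, g, -⟩ | ⟨-, g1, -⟩ | ⟨-, g1, -⟩
    · rcases Λ.port_cases e false with ⟨-, -, h1, h2, h, -⟩ | ⟨-, h1, h2, h, -⟩ | ⟨-, h1, h2, h⟩ <;>
        by_cases hw : Λ.wr e <;>
        simp [hw, g, h, h1, h2, g1, g2, nWrap] at hlt
    · simp [nStub, h2] at g1
    · simp [nStub, h2] at g1

end Layout
namespace Layout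

open Classical

variable {G : MDigraph} (Λ : Layout G)

/-! ### Size and number of bends -/

/-- The ports of a vertex cost nothing for the main port, one bend for the other one of the ports 0
and 1, and two for port 2. Different edge ends have different pairs of vertex and port, so the total
is at most three per vertex. -/
theorem sum_half_le :
    ∑ h : Fin G.m × Bool, (Λ.nStub h.1 h.2 + Λ.nVert h.1 h.2) ≤ 3 * G.n := by
  let w : Fin G.n × ℕ → ℕ := fun x =>
    (if x.2 = 2 then 1 else 0) + if x.2 ≠ Λ.mainPort x.1 then 1 else 0
  let g : Fin G.m × Bool → Fin G.n × ℕ := fun h => (G.vt h.1 h.2, Λ.port h.1 h.2)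
  have hg : Function.Injective g := by
    rintro ⟨e, b⟩ ⟨f, c⟩ h
    obtain ⟨h1, h2⟩ := Prod.ext_iff.1 h
    obtain ⟨h3, h4⟩ := Λ.port_inj e b f c h1 h2
    exact Prod.ext h3 h4
  calc ∑ h : Fin G.m × Bool, (Λ.nStub h.1 h.2 + Λ.nVert h.1 h.2) = ∑ h, w (g h) := rfl
    _ = ∑ x ∈ Finset.univ.image g, w x := (Finset.sum_image fun _ _ _ _ h => hg h).symm
    _ ≤ ∑ x ∈ (Finset.univ : Finset (Fin G.n)) ×ˢ Finset.range 3, w x := by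
        refine Finset.sum_le_sum_of_subset fun x hx => ?_
        obtain ⟨h, -, rfl⟩ := Finset.mem_image.1 hx
        exact Finset.mem_product.2 ⟨Finset.mem_univ _, Finset.mem_range.2 (Λ.port_lt _ _)⟩
    _ = ∑ v : Fin G.n, ∑ k ∈ Finset.range 3, w (v, k) := Finset.sum_product _ _ _
    _ = ∑ v : Fin G.n, 3 := by
        refine Finset.sum_congr rfl fun v _ => ?_
        have := Λ.mainPort_lt v
        simp only [Finset.sum_range_succ, Finset.sum_range_zero, w]
        interval_cases Λ.mainPort v <;> simp
    _ = 3 * G.n := by simp [mul_comm]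

theorem totalBends_le : Λ.drawing.totalBends ≤ 3 * G.n + 2 * ∑ e, Λ.nWrap e := by
  have h := Λ.sum_half_le
  rw [Fintype.sum_prod_type] at h
  simp only [Fintype.sum_bool, Finset.sum_add_distrib] at h
  simp only [Drawing.totalBends, bends_eq, Finset.sum_add_distrib, ← Finset.mul_sum]
  omega

/-- Edges that change rows and have their early ends in the same row all cross the boundary below
this row, so no two of them are disjoint on the line and their tracks differ. Early ends of such
edges are not in the last row. -/
theorem sum_wrap_le (N : ℕ) (hN : ∀ v, Λ.pos v ≤ N) : ∑ e, Λ.nWrap e ≤ N / Λ.W * Λ.L := by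
  have h1 : ∑ e, Λ.nWrap e = (Finset.univ.filter fun e => Λ.wr e).card := by
    simp [nWrap, Finset.sum_boole]
  rw [h1]
  -- the early end of an edge
  have hE : ∀ e, ∃ b, Λ.pos (G.vt e b) < Λ.pos (G.vt e (!b)) := fun e => by
    rcases lt_trichotomy (Λ.pos (G.vt e true)) (Λ.pos (G.vt e false)) with h | h | h
    · exact ⟨true, h⟩
    · exact absurd (Λ.pos_inj h) (Λ.ne e true)
    · exact ⟨false, h⟩
  choose b hb using hE
  have hlt : ∀ e, Λ.wr e → Λ.row (G.vt e (b e)) < Λ.row (G.vt e (!(b e))) := fun e hw =>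
    lt_of_le_of_ne (Λ.row_le (hb e).le) ((Λ.wr_iff e (b e)).1 hw)
  calc (Finset.univ.filter fun e => Λ.wr e).card
      ≤ (Finset.range (N / Λ.W) ×ˢ Finset.range Λ.L).card := by
        refine Finset.card_le_card_of_injOn (fun e => (Λ.row (G.vt e (b e)), Λ.track e)) ?_ ?_
        · intro e he
          have hw := (Finset.mem_filter.1 he).2
          refine Finset.mem_product.2 ⟨Finset.mem_range.2 ?_, Finset.mem_range.2 (Λ.track_lt e)⟩
          exact (hlt e hw).trans_le (Nat.div_le_div_right (hN _))
        · intro e he f hf h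
          have hw := (Finset.mem_filter.1 he).2
          have hw' := (Finset.mem_filter.1 hf).2
          obtain ⟨h1, h2⟩ := Prod.ext_iff.1 h
          simp only at h1 h2
          by_contra hne
          rcases Λ.track_disj e f hne h2 with h | h
          · have := Λ.row_le (h (!(b e)) (b f)).le
            have := hlt e hw
            omega
          · have := Λ.row_le (h (b e) (!(b f))).le
            have := hlt f hw'
            omega
    _ = N / Λ.W * Λ.L := by simp

theorem mem_points {p : ℤ × ℤ} (hp : p ∈ Λ.drawing.points) :
    ∃ e b, (p = (Λ.px (G.vt e b), -Λ.py (G.vt e b)) ∨ p = (Λ.cx e b, -Λ.py (G.vt e b)) ∨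
      p = (Λ.cx e b, -Λ.lane e b) ∨ p = (Λ.wx e, -Λ.lane e b)) := by
  rcases Finset.mem_union.1 hp with hp | hp
  · obtain ⟨v, -, rfl⟩ := Finset.mem_image.1 hp
    obtain ⟨e, b, h, -⟩ := Λ.port_zero v
    exact ⟨e, b, Or.inl (by rw [h]; rfl)⟩
  · obtain ⟨e, -, hp⟩ := Finset.mem_biUnion.1 hp
    obtain ⟨i, hi, rfl⟩ := Finset.mem_image.1 hp
    have hi := Finset.mem_range.1 hi
    rw [← Λ.path_length] at hi
    have h : Λ.drawing.pt e i ∈ Λ.path e := by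
      have : Λ.drawing.pt e i = (Λ.path e).getD i 0 := rfl
      rw [this, List.getD_eq_getElem _ _ hi]
      exact List.getElem_mem hi
    unfold path at h
    obtain ⟨x, hx, hx2⟩ := List.mem_map.1 h
    rw [← hx2]
    have hx := (List.mem_filter.1 hx).1
    have hb : ∃ b, x ∈ Λ.half e b := by
      rcases List.mem_append.1 hx with h | h
      · exact ⟨_, h⟩
      · exact ⟨_, List.mem_reverse.1 h⟩
    obtain ⟨b, hb⟩ := hb
    refine ⟨e, b, ?_⟩
    simp only [half, List.mem_cons, List.not_mem_nil, or_false] at hb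
    rcases hb with rfl | rfl | rfl | rfl <;> simp

theorem points_bound {N : ℕ} (hN : ∀ v, Λ.pos v ≤ N) {p : ℤ × ℤ} (hp : p ∈ Λ.drawing.points) :
    (0 ≤ p.1 ∧ p.1 < 3 * Λ.W + Λ.L) ∧ -(2 * Λ.L * (N / Λ.W + 1 : ℕ) : ℤ) < p.2 ∧ p.2 ≤ 0 := by
  obtain ⟨e, b, h⟩ := Λ.mem_points hp
  have h1 := Λ.cx_near e b
  have h2 := Λ.idx_lt (G.vt e b)
  have h3 := Λ.lane_band e b
  have h4 := Λ.py_band (G.vt e b)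
  have h5 := Λ.track_lt e
  have h6 : Λ.row (G.vt e b) < N / Λ.W + 1 := Nat.lt_succ_of_le (Nat.div_le_div_right (hN _))
  have h7 := Λ.band_lt h6
  have h8 : 0 ≤ 2 * (Λ.L : ℤ) * Λ.row (G.vt e b) := by positivity
  unfold px at *
  rcases h with rfl | rfl | rfl | rfl <;> simp only [wx] <;> omega

theorem width_le {N : ℕ} (hN : ∀ v, Λ.pos v ≤ N) : Λ.drawing.width ≤ 3 * Λ.W + Λ.L + 1 := by
  unfold Drawing.width
  refine Nat.add_le_add_right (Finset.sup_le fun q hq => ?_) 1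
  obtain ⟨h1, h2⟩ := Finset.mem_product.1 hq
  have := (Λ.points_bound hN h1).1
  have := (Λ.points_bound hN h2).1
  omega

theorem height_le {N : ℕ} (hN : ∀ v, Λ.pos v ≤ N) :
    Λ.drawing.height ≤ 2 * Λ.L * (N / Λ.W + 1) + 1 := by
  unfold Drawing.height
  refine Nat.add_le_add_right (Finset.sup_le fun q hq => ?_) 1
  obtain ⟨h1, h2⟩ := Finset.mem_product.1 hq
  have h1 := (Λ.points_bound hN h1).2
  have h2 := (Λ.points_bound hN h2).2
  have : (2 * Λ.L * (N / Λ.W + 1 : ℕ) : ℤ) = ((2 * Λ.L * (N / Λ.W + 1) : ℕ) : ℤ) := by push_cast; ring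
  omega

theorem pos_mem_points (v : Fin G.n) : (Λ.px v, -Λ.py v) ∈ Λ.drawing.points :=
  Finset.mem_union_left _ (Finset.mem_image.2 ⟨v, Finset.mem_univ _, rfl⟩)

theorem le_width (v w : Fin G.n) : (Λ.px v - Λ.px w).natAbs + 1 ≤ Λ.drawing.width :=
  Nat.add_le_add_right (Finset.le_sup (f := fun q : (ℤ × ℤ) × (ℤ × ℤ) => (q.1.1 - q.2.1).natAbs)
    (Finset.mk_mem_product (Λ.pos_mem_points v) (Λ.pos_mem_points w))) 1

theorem le_height (v w : Fin G.n) : (-Λ.py v - -Λ.py w).natAbs + 1 ≤ Λ.drawing.height :=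
  Nat.add_le_add_right (Finset.le_sup (f := fun q : (ℤ × ℤ) × (ℤ × ℤ) => (q.1.2 - q.2.2).natAbs)
    (Finset.mk_mem_product (Λ.pos_mem_points v) (Λ.pos_mem_points w))) 1

/-- The first and the last vertex of a full row. This bound and `le_height_of` are what the aspect
ratio needs beyond the upper bounds. -/
theorem le_width_of {v w : Fin G.n} (hv : Λ.pos v = 0) (hw : Λ.pos w = Λ.W - 1) :
    Λ.W ≤ Λ.drawing.width := by
  have h := Λ.le_width v w
  have := Λ.W_pos
  have h1 : Λ.idx v = 0 := by simp [idx, hv]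
  have h2 : Λ.idx w = Λ.W - 1 := by rw [idx, hw]; exact Nat.mod_eq_of_lt (by omega)
  unfold px at h
  omega

theorem le_height_of {v w : Fin G.n} {N : ℕ} (hv : Λ.pos v = 0) (hw : Λ.pos w = N) :
    2 * Λ.L * (N / Λ.W) ≤ Λ.drawing.height + 2 * Λ.L := by
  have h := Λ.le_height v w
  have h1 : Λ.row v = 0 := by simp [row, hv]
  have h2 : Λ.row w = N / Λ.W := by rw [row, hw]
  have h3 := Λ.py_band v
  have h4 := Λ.py_band w
  rw [h1] at h3
  rw [h2] at h4
  have : (2 * Λ.L * (N / Λ.W : ℕ) : ℤ) = ((2 * Λ.L * (N / Λ.W) : ℕ) : ℤ) := by push_cast; ring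
  simp only [Nat.cast_zero, mul_zero] at h3
  omega

end Layout

/-! ### Ports and tracks in digraphs of degree three -/

namespace MDigraph

open Classical

variable (G : MDigraph)

/-- The number of earlier edges with the same source. -/
def outIdx (e : Fin G.m) : ℕ := (Finset.univ.filter fun f => f < e ∧ G.src f = G.src e).card

/-- The number of earlier edges with the same target. -/
def inIdx (e : Fin G.m) : ℕ := (Finset.univ.filter fun f => f < e ∧ G.tgt f = G.tgt e).card

/-- The port by which an edge is attached to its end `b`. -/
noncomputable def port (e : Fin G.m) (b : Bool) : ℕ :=
  -- A junction has at most one outgoing edge and any other vertex at most one incoming edge,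
  -- because of the degree bound. This edge gets port 2, and the edges of the other direction are
  -- numbered from 0.
  if G.IsJunction (G.vt e b) then (if b then G.inIdx e else 2)
  else (if b then 2 else G.outIdx e)

variable {G}

theorem idx_lt_card {α : Type*} [DecidableEq α] (g : Fin G.m → α) (e : Fin G.m) :
    (Finset.univ.filter fun f => f < e ∧ g f = g e).card <
      (Finset.univ.filter fun f => g f = g e).card :=
  Finset.card_lt_card ⟨fun f hf => by simp only [Finset.mem_filter] at hf ⊢; exact ⟨hf.1, hf.2.2⟩,
    fun h => by simpa using h (show e ∈ _ by simp)⟩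

theorem idx_lt_idx {α : Type*} [DecidableEq α] (g : Fin G.m → α) {e f : Fin G.m} (hlt : e < f)
    (h : g e = g f) : (Finset.univ.filter fun x => x < e ∧ g x = g e).card <
      (Finset.univ.filter fun x => x < f ∧ g x = g f).card :=
  Finset.card_lt_card ⟨fun x hx => by
      simp only [Finset.mem_filter] at hx ⊢
      exact ⟨hx.1, hx.2.1.trans hlt, hx.2.2.trans h⟩,
    fun h' => by simpa using h' (show e ∈ _ by simp [hlt, h])⟩

theorem idx_inj {α : Type*} [DecidableEq α] (g : Fin G.m → α) {e f : Fin G.m} (h : g e = g f)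
    (hc : (Finset.univ.filter fun x => x < e ∧ g x = g e).card =
      (Finset.univ.filter fun x => x < f ∧ g x = g f).card) : e = f := by
  rcases lt_trichotomy e f with hl | hl | hl
  · have := idx_lt_idx g hl h; omega
  · exact hl
  · have := idx_lt_idx g hl h.symm; omega

theorem outIdx_lt (e : Fin G.m) : G.outIdx e < G.outDegree (G.src e) := by
  have := idx_lt_card G.src e
  unfold outIdx outDegree
  convert this

theorem inIdx_lt (e : Fin G.m) : G.inIdx e < G.inDegree (G.tgt e) := by
  have := idx_lt_card G.tgt e
  unfold inIdx inDegree
  convert this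

theorem outIdx_inj {e f : Fin G.m} (h : G.src e = G.src f) (hc : G.outIdx e = G.outIdx f) :
    e = f := by
  refine idx_inj G.src h ?_
  unfold outIdx at hc
  convert hc

theorem inIdx_inj {e f : Fin G.m} (h : G.tgt e = G.tgt f) (hc : G.inIdx e = G.inIdx f) :
    e = f := by
  refine idx_inj G.tgt h ?_
  unfold inIdx at hc
  convert hc

theorem exists_idx_zero {α : Type*} [DecidableEq α] (g : Fin G.m → α) (v : α)
    (h : 0 < (Finset.univ.filter fun f => g f = v).card) :
    ∃ e, g e = v ∧ (Finset.univ.filter fun x => x < e ∧ g x = g e).card = 0 := by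
  obtain ⟨e, he⟩ := Finset.exists_minimal (Finset.card_pos.1 h)
  have h1 := (Finset.mem_filter.1 he.1).2
  refine ⟨e, h1, Finset.card_eq_zero.2 (Finset.filter_eq_empty_iff.2 fun x _ hx => ?_)⟩
  have := he.2 (show x ∈ _ from Finset.mem_filter.2 ⟨Finset.mem_univ _, hx.2.trans h1⟩) hx.1.le
  exact absurd hx.1 (not_lt.2 this)

theorem one_lt_card {α : Type*} [DecidableEq α] (g : Fin G.m → α) {e f : Fin G.m} (hne : e ≠ f)
    (h : g e = g f) : 1 < (Finset.univ.filter fun x => g x = g f).card :=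
  Finset.one_lt_card.2 ⟨e, by simp [h], f, by simp, hne⟩

theorem port_lt (h3 : G.DegreeThree) (e : Fin G.m) (b : Bool) : G.port e b < 3 := by
  have h := h3 (G.vt e b)
  have h1 := outIdx_lt e
  have h2 := inIdx_lt e
  unfold port
  cases b <;> simp only [vt] at h ⊢ <;> split_ifs <;> simp_all <;> omega

theorem port_inj (h3 : G.DegreeThree) (e : Fin G.m) (b : Bool) (f : Fin G.m) (c : Bool)
    (hv : G.vt e b = G.vt f c) (hp : G.port e b = G.port f c) : e = f ∧ b = c := by
  have h := h3 (G.vt f c)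
  -- One of the two edges has port 2 by its direction. If the other one has port 2 by its index, it
  -- is the third of its direction, and the vertex has degree four.
  have mixed : ∀ e f, G.src e = G.tgt f → G.port e false = G.port f true → False := by
    intro e f hv hp
    have h := h3 (G.tgt f)
    have h1 := outIdx_lt e
    have h2 := inIdx_lt f
    simp only [port, vt, if_true, Bool.false_eq_true, if_false, hv] at hp
    rw [hv] at h1
    by_cases hJ : G.IsJunction (G.tgt f)
    · rw [if_pos hJ, if_pos hJ] at hp
      unfold IsJunction at hJ; omega
    · rw [if_neg hJ, if_neg hJ] at hp
      unfold IsJunction at hJ; omega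
  cases b <;> cases c
  · refine ⟨?_, rfl⟩
    simp only [vt, Bool.false_eq_true, if_false] at hv
    simp only [port, vt, Bool.false_eq_true, if_false, hv] at hp
    by_cases hJ : G.IsJunction (G.src f)
    · by_contra hne
      have h2 := one_lt_card G.src hne hv
      have h3 := h3 (G.src f)
      unfold IsJunction at hJ
      have : (Finset.univ.filter fun x => G.src x = G.src f).card = G.outDegree (G.src f) := by
        unfold outDegree; convert rfl
      omega
    · rw [if_neg hJ, if_neg hJ] at hp
      exact outIdx_inj hv hp
  · exact (mixed e f hv hp).elim
  · exact (mixed f e hv.symm hp.symm).elim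
  · refine ⟨?_, rfl⟩
    simp only [vt, if_true] at hv
    simp only [port, vt, if_true, hv] at hp
    by_cases hJ : G.IsJunction (G.tgt f)
    · rw [if_pos hJ, if_pos hJ] at hp
      exact inIdx_inj hv hp
    · by_contra hne
      have h2 := one_lt_card G.tgt hne hv
      have h3 := h3 (G.tgt f)
      unfold IsJunction at hJ
      have : (Finset.univ.filter fun x => G.tgt x = G.tgt f).card = G.inDegree (G.tgt f) := by
        unfold inDegree; convert rfl
      omega

/-- The numbered direction is never empty: a junction has an incoming edge, any other vertex of
positive degree an outgoing one. Thus every vertex has an edge from which it can take its height. -/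
theorem port_zero (hd : ∀ v, 0 < G.inDegree v + G.outDegree v) (v : Fin G.n) :
    ∃ e b, G.vt e b = v ∧ G.port e b = 0 := by
  have hd := hd v
  by_cases hJ : G.IsJunction v
  · have : 0 < G.inDegree v := by unfold IsJunction at hJ; omega
    obtain ⟨e, h1, h2⟩ := exists_idx_zero G.tgt v (by unfold inDegree at this; convert this)
    refine ⟨e, true, h1, ?_⟩
    have : G.vt e true = v := h1
    rw [port, this, if_pos hJ, if_pos rfl, ← h2, inIdx]
  · have : 0 < G.outDegree v := by unfold IsJunction at hJ; omega
    obtain ⟨e, h1, h2⟩ := exists_idx_zero G.src v (by unfold outDegree at this; convert this)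
    refine ⟨e, false, h1, ?_⟩
    have : G.vt e false = v := h1
    rw [port, this, if_neg hJ, if_neg (by simp), ← h2, outIdx]

/-- The end of the edge that comes first. -/
def earlyEnd (pos : Fin G.n → ℕ) (e : Fin G.m) : Bool :=
  decide (¬ pos (G.src e) < pos (G.tgt e))

/-- The layout given by the places of the vertices and their slots. -/
noncomputable def toLayout (h3 : G.DegreeThree)
    (hd : ∀ v, 0 < G.inDegree v + G.outDegree v) (ne : ∀ e, G.src e ≠ G.tgt e)
    (pos sg : Fin G.n → ℕ) (W S : ℕ) (hW : 0 < W) (hpos : Function.Injective pos)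
    (hsg : ∀ v, sg v < S)
    (hdisj : ∀ e f, G.vt e (earlyEnd pos e) ≠ G.vt f (earlyEnd pos f) →
      sg (G.vt e (earlyEnd pos e)) = sg (G.vt f (earlyEnd pos f)) →
      (∀ b c, pos (G.vt e b) < pos (G.vt f c)) ∨ (∀ b c, pos (G.vt f c) < pos (G.vt e b))) :
    Layout G where
  pos := pos
  -- Three tracks for each slot, one for every port. Ports are less than 3, so the track determines
  -- both the slot and the port of the early end.
  track e := 3 * sg (G.vt e (earlyEnd pos e)) + G.port e (earlyEnd pos e)
  port := G.port
  W := W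
  L := 3 * S
  W_pos := hW
  track_lt e := by
    have := hsg (G.vt e (earlyEnd pos e))
    have := port_lt h3 e (earlyEnd pos e)
    omega
  pos_inj := hpos
  port_lt := port_lt h3
  port_inj := port_inj h3
  port_zero := port_zero hd
  port_in e hJ := by
    have : G.vt e true = G.tgt e := rfl
    rw [port, this, if_neg hJ, if_pos rfl]
  track_disj e f hne h := by
    have h1 := port_lt h3 e (earlyEnd pos e)
    have h2 := port_lt h3 f (earlyEnd pos f)
    refine hdisj e f (fun hv => hne ?_) (by omega)
    exact (port_inj h3 _ _ _ _ hv (by rw [hv] at h; omega)).1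
  ne e b := by
    cases b
    · exact ne e
    · exact (ne e).symm

end MDigraph

/-! ### The layout of a series-parallel digraph -/

namespace SPTree

theorem vt_val (T : SPTree) (e : Fin T.graph.m) (b : Bool) :
    (T.graph.vt e b : ℕ) = if b then (T.edges.get e).2 else (T.edges.get e).1 := by
  cases b <;> rfl

theorem numNodes_pos_degree (T : SPTree) (v : Fin T.graph.n) :
    0 < T.graph.inDegree v + T.graph.outDegree v := by
  have key : ∃ p ∈ T.edges, p.1 = (v : ℕ) ∨ p.2 = (v : ℕ) := by
    have hv : (v : ℕ) < T.inner + 2 := v.2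
    rcases Nat.lt_or_ge (v : ℕ) 2 with h | h
    · rcases Nat.lt_or_ge (v : ℕ) 1 with h' | h'
      · obtain ⟨p, hp, h⟩ := T.exists_source (s := 0) (t := 1) (k := 2)
        exact ⟨p, hp, Or.inl (by omega)⟩
      · obtain ⟨p, hp, h⟩ := T.exists_sink (s := 0) (t := 1) (k := 2)
        exact ⟨p, hp, Or.inr (by omega)⟩
    · obtain ⟨p, hp, h⟩ := T.exists_inner (s := 0) (t := 1) (k := 2) v h (by omega)
      exact ⟨p, hp, Or.inl h⟩
  obtain ⟨p, hp, h⟩ := key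
  obtain ⟨e, rfl⟩ := List.get_of_mem hp
  rcases h with h | h
  · have : 0 < T.graph.outDegree v :=
      Finset.card_pos.2 ⟨e, Finset.mem_filter.2 ⟨Finset.mem_univ _, Fin.ext h⟩⟩
    omega
  · have : 0 < T.graph.inDegree v :=
      Finset.card_pos.2 ⟨e, Finset.mem_filter.2 ⟨Finset.mem_univ _, Fin.ext h⟩⟩
    omega

/-- Places and slots of all vertices. -/
structure Placed (T : SPTree) (pos sg : ℕ → ℕ) : Prop where
  pos_source : pos 0 = 0
  pos_sink : pos 1 = 1
  sg_source : sg 0 = 0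
  sg_sink : sg 1 = 1
  -- The terminals of the whole digraph have the numbers, places and slots 0 and 1. Numbers and
  -- places of inner vertices start at 2, and their pools at 1, since pool 0 holds the slots of the
  -- terminals.
  cons : T.Cons pos sg 0 1 2 2 1

variable {T : SPTree} {pos sg : ℕ → ℕ}

theorem Placed.pos_lt (h : T.Placed pos sg) {v : ℕ} (hv : v < T.numNodes) :
    pos v < T.numNodes := by
  unfold numNodes at *
  rcases Nat.lt_or_ge v 2 with h' | h'
  · have := h.pos_source; have := h.pos_sink
    interval_cases v <;> omega
  · have := h.cons.pos_mem v h' (by omega); omega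

theorem Placed.pos_inj (h : T.Placed pos sg) {v w : ℕ} (hv : v < T.numNodes)
    (hw : w < T.numNodes) (he : pos v = pos w) : v = w := by
  unfold numNodes at *
  have := h.pos_source; have := h.pos_sink
  rcases Nat.lt_or_ge v 2 with h' | h' <;> rcases Nat.lt_or_ge w 2 with h'' | h''
  · interval_cases v <;> interval_cases w <;> omega
  · have := h.cons.pos_mem w h'' (by omega)
    interval_cases v <;> omega
  · have := h.cons.pos_mem v h' (by omega)
    interval_cases w <;> omega
  · exact h.cons.pos_inj v w h' (by omega) h'' (by omega) he

theorem Placed.sg_lt (h : T.Placed pos sg) {v : ℕ} (hv : v < T.numNodes) :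
    sg v < 3 * (Nat.log 2 T.numNodes + 2) := by
  have h0 := h.sg_source; have h1 := h.sg_sink
  rcases Nat.lt_or_ge v 2 with h' | h'
  · interval_cases v <;> omega
  · have := h.cons.sg_lt (Nat.log 2 T.numNodes + 1) (by
      have := Nat.lt_pow_succ_log_self (b := 2) (by norm_num) T.numNodes
      unfold numNodes at *; omega) v h' (by unfold numNodes at hv; omega)
    omega

theorem Placed.disj (h : T.Placed pos sg) {p q : ℕ × ℕ} (hp : p ∈ T.edges) (hq : q ∈ T.edges)
    (hne : early pos p ≠ early pos q) (hs : sg (early pos p) = sg (early pos q)) :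
    Before pos p q ∨ Before pos q p := by
  have h0 := h.sg_source; have h1 := h.sg_sink
  have h2 := h.pos_source; have h3 := h.pos_sink
  exact h.cons.before (by omega) (by omega) (by omega) (by omega) (by omega) (by omega) (by omega)
    p hp q hq hne hs

/-- The layout of the digraph. -/
noncomputable def layout (T : SPTree) (h3 : T.graph.DegreeThree) {pos sg : ℕ → ℕ}
    (h : T.Placed pos sg) (W : ℕ) (hW : 0 < W) : Layout T.graph :=
  MDigraph.toLayout h3 T.numNodes_pos_degree
    (fun e he => T.edgesFrom_ne (by norm_num) (by norm_num) (by norm_num) _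
      (List.get_mem T.edges e) (Fin.ext_iff.1 he))
    (fun v => pos v) (fun v => sg v) W (3 * (Nat.log 2 T.numNodes + 2)) hW
    (fun _ _ hvw => Fin.ext (h.pos_inj (Fin.is_lt _) (Fin.is_lt _) hvw))
    (fun v => h.sg_lt v.2)
    (by
      have hE : ∀ e : Fin T.graph.m, (T.graph.vt e (MDigraph.earlyEnd (fun v => pos v) e) : ℕ) =
          early pos (T.edges.get e) := by
        intro e
        rw [vt_val]
        unfold MDigraph.earlyEnd early
        have h1 : ((T.graph.src e : Fin T.graph.n) : ℕ) = (T.edges.get e).1 := rfl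
        have h2 : ((T.graph.tgt e : Fin T.graph.n) : ℕ) = (T.edges.get e).2 := rfl
        simp only [h1, h2]
        by_cases hc : pos (T.edges.get e).1 < pos (T.edges.get e).2 <;> simp [hc]
      intro e f hne hs
      simp only [hE] at hs
      have hne' : early pos (T.edges.get e) ≠ early pos (T.edges.get f) := fun h' =>
        hne (Fin.ext (by rw [hE, hE, h']))
      rcases h.disj (List.get_mem T.edges e) (List.get_mem T.edges f) hne' hs with hb | hb
      · left
        intro b c
        rw [vt_val, vt_val]
        unfold Before at hb
        cases b <;> cases c <;> simp only [if_true, if_false, Bool.false_eq_true] <;> omega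
      · right
        intro b c
        rw [vt_val, vt_val]
        unfold Before at hb
        cases b <;> cases c <;> simp only [if_true, if_false, Bool.false_eq_true] <;> omega)

end SPTree

/-! ### Programs made of passes -/

namespace RExpr

/-- `1` if `a < b`, and `0` otherwise. -/
def lt (a b : RExpr) : RExpr :=
  minus (const 0) (quot (minus a b) (plus (times (minus a b) (minus a b)) (const 1)))

/-- As `|x| < x * x + 1`, the quotient rounded down is `-1` for negative `x` and `0` otherwise. With
this, comparisons are values of expressions and bodies of loops need no branches. -/
theorem ediv_sq_succ (x : ℤ) : 0 - x / (x * x + 1) = if x < 0 then 1 else 0 := by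
  split_ifs with h
  · have : x / (x * x + 1) = -1 := by
      rw [Int.ediv_eq_iff_of_pos (by nlinarith)]
      constructor <;> nlinarith
    omega
  · have : x / (x * x + 1) = 0 := Int.ediv_eq_zero_of_lt (by omega) (by nlinarith)
    omega

theorem eval_lt (s : State) (a b : RExpr) :
    (lt a b).eval s = if a.eval s < b.eval s then 1 else 0 := by
  simp only [lt, eval, ediv_sq_succ, sub_neg]

/-- `0` for `1` and `1` for `0`. -/
def not (a : RExpr) : RExpr := minus (const 1) a

/-- `1` if the value is not zero, and `0` otherwise. -/
def nz (a : RExpr) : RExpr := plus (lt (const 0) a) (lt a (const 0))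

theorem eval_not (s : State) (a : RExpr) : (not a).eval s = 1 - a.eval s := rfl

theorem eval_nz (s : State) (a : RExpr) :
    (nz a).eval s = if a.eval s = 0 then 0 else 1 := by
  simp only [nz, eval, eval_lt]
  split_ifs <;> omega

/-- `1` if the values are equal, and `0` otherwise. -/
def eq (a b : RExpr) : RExpr := not (nz (minus a b))

theorem eval_eq (s : State) (a b : RExpr) :
    (eq a b).eval s = if a.eval s = b.eval s then 1 else 0 := by
  simp only [eq, eval_not, eval_nz, eval]
  split_ifs <;> omega

/-- The value, or `0` if its absolute value exceeds register 4. -/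
def guard (a : RExpr) : RExpr :=
  times a (times (not (lt (reg 4) a)) (not (lt a (minus (const 0) (reg 4)))))

/-- All arrays read by the expression satisfy `ok`. -/
def readsOk (ok : ℕ → Bool) : RExpr → Bool
  | const _ => true
  | reg _ => true
  | get a i => ok a && i.readsOk ok
  | plus e f => e.readsOk ok && f.readsOk ok
  | minus e f => e.readsOk ok && f.readsOk ok
  | times e f => e.readsOk ok && f.readsOk ok
  | quot e f => e.readsOk ok && f.readsOk ok

theorem eval_congr {ok : ℕ → Bool} {r : ℕ → ℤ} {m m' : ℕ → ℤ → ℤ}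
    (h : ∀ a, ok a = true → m a = m' a) : ∀ e : RExpr, e.readsOk ok = true →
      e.eval ⟨r, m⟩ = e.eval ⟨r, m'⟩ := by
  intro e
  induction e with
  | const _ => intro _; rfl
  | reg _ => intro _; rfl
  | get a i ih =>
    intro he
    simp only [readsOk, Bool.and_eq_true] at he
    simp only [eval, ih he.2, h a he.1]
  | plus e f ihe ihf | minus e f ihe ihf | times e f ihe ihf | quot e f ihe ihf =>
    intro he
    simp only [readsOk, Bool.and_eq_true] at he
    simp only [eval, ihe he.1, ihf he.2]

end RExpr

/-- A store of a value at an address of an array. -/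
structure Sto where
  a : ℕ
  i : RExpr
  e : RExpr

/-- Stores that are carried out for all values of a counter. -/
abbrev Pass := List Sto

abbrev Mem := ℕ → ℤ → ℤ

/-- The contents of the registers that do not change. -/
structure Env where
  N : ℤ
  A : ℤ
  Q : ℕ
  M : ℤ

namespace Env

variable (E : Env)

def regs (c : ℤ) (x : ℕ) : ℤ :=
  if x = 0 then E.N else if x = 1 then E.A else if x = 2 then c else if x = 3 then E.Q else
    if x = 4 then E.M else 0

theorem update_regs (c d : ℤ) : Function.update (E.regs c) 2 d = E.regs d := by
  funext x
  by_cases h : x = 2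
  · subst h; simp [regs]
  · simp [regs, h]

/-- The value of an expression when the counter is `c`. -/
def ev (c : ℤ) (m : Mem) (e : RExpr) : ℤ := e.eval ⟨E.regs c, m⟩

def gv (x : ℤ) : ℤ := if |x| ≤ E.M then x else 0

theorem gv_of_le {x : ℤ} (h : |x| ≤ E.M) : E.gv x = x := if_pos h

theorem eval_guard (c : ℤ) (m : Mem) (e : RExpr) :
    e.guard.eval ⟨E.regs c, m⟩ = E.gv (E.ev c m e) := by
  have h4 : E.regs c 4 = E.M := rfl
  simp only [RExpr.guard, RExpr.eval, RExpr.eval_not, RExpr.eval_lt, gv, ev, h4, abs_le]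
  split_ifs <;> omega

def stoSem (c : ℤ) (m : Mem) (s : Sto) : Mem :=
  Function.update m s.a
    (Function.update (m s.a) (E.gv (E.ev c m s.i)) (E.gv (E.ev c m s.e)))

def bodySem (p : Pass) (c : ℤ) (m : Mem) : Mem := p.foldl (E.stoSem c) m

def iter (p : Pass) (m : Mem) : ℕ → Mem
  | 0 => m
  | c + 1 => E.bodySem p c (iter p m c)

def passSem (m : Mem) (p : Pass) : Mem := E.iter p m E.Q

def runSem (L : List Pass) (m : Mem) : Mem := L.foldl E.passSem m

end Env

namespace Sto

def prog (s : Sto) : Prog := Prog.store s.a s.i.guard s.e.guard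

def cost (s : Sto) : ℕ := s.i.guard.cost + s.e.guard.cost + 1

end Sto

def incr : Prog := Prog.assign 2 (RExpr.plus (RExpr.reg 2) (RExpr.const 1))

def bodyProg : Pass → Prog
  | [] => incr
  | s :: p => Prog.seq s.prog (bodyProg p)

def bodyCost : Pass → ℕ
  | [] => 4
  | s :: p => s.cost + bodyCost p

def passProg (p : Pass) : Prog :=
  Prog.seq (Prog.assign 2 (RExpr.const 0))
    (Prog.loop (RExpr.minus (RExpr.reg 3) (RExpr.reg 2)) (bodyProg p))

def passesProg : List Pass → Prog
  | [] => Prog.skip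
  | p :: L => Prog.seq (passProg p) (passesProg L)

section Exec

variable {E : Env} {B : ℤ}

theorem Env.abs_gv_le (hM : 0 ≤ E.M) (x : ℤ) : |E.gv x| ≤ E.M := by
  unfold Env.gv; split_ifs with h
  · exact h
  · simpa using hM

/-- The guards bound all stored values and addresses by `E.M`, whatever the memory contains. So
running time and size of numbers can be bounded without knowing what the program computes. -/
theorem exec_body (hM : 0 ≤ E.M) (hMB : E.M ≤ B) {c : ℕ} (hc : (c : ℤ) + 1 ≤ B) (p : Pass) :
    ∀ m, Exec B (bodyProg p) ⟨E.regs c, m⟩ ⟨E.regs (c + 1), E.bodySem p c m⟩ (bodyCost p) := by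
  induction p with
  | nil =>
    intro m
    have h := Exec.assign (B := B) 2 (RExpr.plus (RExpr.reg 2) (RExpr.const 1)) ⟨E.regs c, m⟩
      (by
        have : E.regs c 2 = c := rfl
        simp only [RExpr.eval, this]
        rw [abs_of_nonneg (by omega)]; exact hc)
    simp only [Env.update_regs, RExpr.eval] at h
    exact h
  | cons s p ih =>
    intro m
    refine Exec.seq (s₂ := ⟨E.regs c, E.stoSem c m s⟩) ?_ (ih _)
    have h := Exec.store (B := B) s.a s.i.guard s.e.guard ⟨E.regs c, m⟩
      (by rw [Env.eval_guard]; exact (Env.abs_gv_le hM _).trans hMB)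
      (by rw [Env.eval_guard]; exact (Env.abs_gv_le hM _).trans hMB)
    rw [Env.eval_guard, Env.eval_guard] at h
    exact h

theorem exec_loop (hM : 0 ≤ E.M) (hMB : E.M ≤ B) (hQ : (E.Q : ℤ) ≤ B) (p : Pass) (m : Mem) (k : ℕ) :
    ∀ c, c + k = E.Q →
      Exec B (Prog.loop (RExpr.minus (RExpr.reg 3) (RExpr.reg 2)) (bodyProg p))
        ⟨E.regs c, E.iter p m c⟩ ⟨E.regs E.Q, E.iter p m E.Q⟩ (k * (4 + bodyCost p) + 4) := by
  have hev : ∀ c : ℤ, ∀ m : Mem, (RExpr.minus (RExpr.reg 3) (RExpr.reg 2)).eval ⟨E.regs c, m⟩ =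
    E.Q - c := fun c m => rfl
  induction k with
  | zero =>
    intro c hc
    obtain rfl : c = E.Q := by omega
    have h := Exec.loop_done (B := B) (e := RExpr.minus (RExpr.reg 3) (RExpr.reg 2))
      (p := bodyProg p) (s := ⟨E.regs E.Q, E.iter p m E.Q⟩) (by rw [hev]; omega)
    rw [zero_mul]
    exact h
  | succ k ih =>
    intro c hc
    have h := Exec.loop_step (B := B) (e := RExpr.minus (RExpr.reg 3) (RExpr.reg 2))
      (by rw [hev]; omega) (exec_body hM hMB (c := c) (by omega) p (E.iter p m c))
      (ih (c + 1) (by omega))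
    have ht : (RExpr.minus (RExpr.reg 3) (RExpr.reg 2)).cost + 1 + bodyCost p +
        (k * (4 + bodyCost p) + 4) = (k + 1) * (4 + bodyCost p) + 4 := by
      simp only [RExpr.cost]; ring
    rw [ht] at h
    exact h

theorem exec_pass (hM : 0 ≤ E.M) (hMB : E.M ≤ B) (hQ : (E.Q : ℤ) ≤ B) (p : Pass) (m : Mem) (c : ℤ) :
    Exec B (passProg p) ⟨E.regs c, m⟩ ⟨E.regs E.Q, E.passSem m p⟩
      (2 + (E.Q * (4 + bodyCost p) + 4)) := by
  have h := Exec.assign (B := B) 2 (RExpr.const 0) ⟨E.regs c, m⟩ (by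
    simp only [RExpr.eval, abs_zero]; omega)
  rw [Env.update_regs] at h
  exact Exec.seq h (exec_loop hM hMB hQ p m E.Q 0 (by omega))

/-- A bound for the time of the passes for each value of the counter. -/
def passesCost : List Pass → ℕ
  | [] => 1
  | p :: L => 10 + bodyCost p + passesCost L

theorem exec_passes (hM : 0 ≤ E.M) (hMB : E.M ≤ B) (hQ : (E.Q : ℤ) ≤ B) (L : List Pass) :
    ∀ (m : Mem) (c : ℤ), ∃ c' t, Exec B (passesProg L) ⟨E.regs c, m⟩ ⟨E.regs c', E.runSem L m⟩ t ∧
      t ≤ passesCost L * (E.Q + 1) := by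
  induction L with
  | nil => intro m c; exact ⟨c, 1, Exec.skip _, by simp [passesCost]⟩
  | cons p L ih =>
    intro m c
    obtain ⟨c', t, h, ht⟩ := ih (E.passSem m p) E.Q
    refine ⟨c', _, Exec.seq (exec_pass hM hMB hQ p m c) h, ?_⟩
    simp only [passesCost]
    nlinarith

end Exec

/-! ### The arrays after the program -/

def Pass.writes (p : Pass) : List ℕ := p.map Sto.a

/-- Every pass writes arrays which are not in `w` and are not written by other passes, and reads
arrays which are in `w` or have been written. -/
def wellFormed : List ℕ → List Pass → Bool
  | _, [] => true
  | w, p :: L =>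
    p.all (fun s => s.i.readsOk (fun a => w.contains a || p.writes.contains a) &&
      s.e.readsOk (fun a => w.contains a || p.writes.contains a) && !w.contains s.a) &&
    wellFormed (p.writes ++ w) L

namespace Env

variable (E : Env)

/-- `F` is a possible memory at the end, as far as the pass `p` is concerned. -/
def Trace (m₀ : Mem) (F : Mem) (p : Pass) : Prop :=
  ∃ Ms : ℕ → Mem, (∀ c, ∀ b, b ∉ p.writes → Ms c b = F b) ∧
    (∀ b ∈ p.writes, Ms 0 b = m₀ b ∧ Ms E.Q b = F b) ∧
    ∀ c, c < E.Q → Ms (c + 1) = E.bodySem p c (Ms c)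

theorem bodySem_frame (p : Pass) (c : ℤ) : ∀ (m : Mem) (b : ℕ), b ∉ p.writes →
    E.bodySem p c m b = m b := by
  induction p with
  | nil => intro m b _; rfl
  | cons s p ih =>
    intro m b hb
    simp only [Pass.writes, List.map_cons, List.mem_cons, not_or] at hb
    have : E.bodySem (s :: p) c m = E.bodySem p c (E.stoSem c m s) := rfl
    rw [this, ih _ b hb.2, stoSem, Function.update_of_ne hb.1]

theorem iter_frame (p : Pass) (m : Mem) (b : ℕ) (hb : b ∉ p.writes) : ∀ c, E.iter p m c b = m b := by
  intro c
  induction c with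
  | zero => rfl
  | succ c ih => rw [iter, E.bodySem_frame p c _ b hb, ih]

theorem runSem_frame (L : List Pass) : ∀ (w : List ℕ) (m : Mem),
    wellFormed w L = true → ∀ b ∈ w, E.runSem L m b = m b := by
  induction L with
  | nil => intro w m _ b _; rfl
  | cons p L ih =>
    intro w m hw b hb
    simp only [wellFormed, Bool.and_eq_true, List.all_eq_true] at hw
    have : E.runSem (p :: L) m = E.runSem L (E.passSem m p) := rfl
    rw [this, ih _ _ hw.2 b (by simp [hb])]
    refine E.iter_frame p m b (fun h => ?_) _
    obtain ⟨s, hs, rfl⟩ := List.mem_map.1 h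
    have := (hw.1 s hs).2
    simp [hb] at this

theorem bodySem_congr {ok : ℕ → Bool} (p : Pass) (c : ℤ)
    (hp : ∀ s ∈ p, s.i.readsOk ok = true ∧ s.e.readsOk ok = true ∧ ok s.a = true) :
    ∀ m m' : Mem, (∀ a, ok a = true → m a = m' a) →
      ∀ a, ok a = true → E.bodySem p c m a = E.bodySem p c m' a := by
  induction p with
  | nil => intro m m' h a ha; exact h a ha
  | cons s p ih =>
    intro m m' h
    obtain ⟨h1, h2, h3⟩ := hp s (by simp)
    refine ih (fun s hs => hp s (by simp [hs])) (E.stoSem c m s) (E.stoSem c m' s) ?_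
    intro a ha
    unfold stoSem ev
    rw [RExpr.eval_congr h _ h1, RExpr.eval_congr h _ h2]
    by_cases hs : a = s.a
    · subst hs; simp [h _ h3]
    · simp [Function.update_of_ne hs, h a ha]

/-- When a pass runs, the arrays that it reads but does not write have their final contents already,
and the arrays that it writes are untouched before and not changed afterwards. So its run can be
replayed inside the final memory. -/
theorem trace_of_wellFormed (m₀ : Mem) (L : List Pass) : ∀ (w : List ℕ) (m : Mem),
    wellFormed w L = true → (∀ b, b ∉ w → m b = m₀ b) →
    ∀ p ∈ L, E.Trace m₀ (E.runSem L m) p := by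
  induction L with
  | nil => intro w m _ _ p hp; simp at hp
  | cons q L ih =>
    intro w m hw hm p hp
    have hrun : E.runSem (q :: L) m = E.runSem L (E.passSem m q) := rfl
    have hw' := hw
    simp only [wellFormed, Bool.and_eq_true, List.all_eq_true] at hw'
    have hnot : ∀ b ∈ w, b ∉ q.writes := fun b hb h => by
      obtain ⟨s, hs, rfl⟩ := List.mem_map.1 h
      have := (hw'.1 s hs).2
      simp [hb] at this
    rcases List.mem_cons.1 hp with rfl | hp
    · set F := E.runSem (p :: L) m
      have hFw : ∀ b ∈ w, F b = m b := fun b hb => E.runSem_frame (p :: L) w m hw b hb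
      have hFp : ∀ b ∈ p.writes, F b = E.passSem m p b := fun b hb => by
        have := E.runSem_frame L _ (E.passSem m p) hw'.2 b (by simp [hb])
        rw [← hrun] at this; exact this
      refine ⟨fun c b => if b ∈ p.writes then E.iter p m c b else F b, ?_, ?_, ?_⟩
      · intro c b hb; simp [hb]
      · intro b hb
        refine ⟨?_, ?_⟩
        · simp only [hb, if_true, iter]
          exact hm b fun h => hnot b h hb
        · simp only [hb, if_true]
          exact (hFp b hb).symm
      · intro c hc
        funext b
        by_cases hb : b ∈ p.writes
        · simp only [hb, if_true, iter]
          refine E.bodySem_congr (ok := fun a => w.contains a || p.writes.contains a) p c ?_ _ _ ?_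
            b (by simp [hb])
          · intro s hs
            obtain ⟨⟨h1, h2⟩, h3⟩ := hw'.1 s hs
            exact ⟨h1, h2, by simp [Pass.writes]; exact Or.inr ⟨s, hs, rfl⟩⟩
          · intro a ha
            by_cases ha' : a ∈ p.writes
            · simp [ha']
            · have haw : a ∈ w := by simpa [ha'] using ha
              simp only [ha', if_false]
              rw [E.iter_frame p m a ha', hFw a haw]
        · rw [E.bodySem_frame p c _ b hb]
          simp [hb]
    · rw [hrun]
      refine ih _ _ hw'.2 (fun b hb => ?_) p hp
      simp only [List.mem_append, not_or] at hb
      rw [passSem, E.iter_frame q m b hb.1, hm b hb.2]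

variable {E}

/-- What a pass with a single store does, if the address does not depend on the array written. -/
theorem Trace.single {m₀ F : Mem} {a : ℕ} {i e : RExpr} (h : E.Trace m₀ F [⟨a, i, e⟩]) (ι : ℕ → ℤ)
    (hι : ∀ c < E.Q, ∀ m, E.gv (E.ev c (Function.update F a m) i) = ι c) :
    (∀ c < E.Q, ∃ m : ℤ → ℤ, (∀ z, (∀ c', c ≤ c' → c' < E.Q → ι c' ≠ z) → m z = F a z) ∧
      ((∀ c', c < c' → c' < E.Q → ι c' ≠ ι c) →
        F a (ι c) = E.gv (E.ev c (Function.update F a m) e))) ∧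
    ∀ z, (∀ c < E.Q, ι c ≠ z) → F a z = m₀ a z := by
  obtain ⟨Ms, h1, h2, h3⟩ := h
  have hMs : ∀ c, Ms c = Function.update F a (Ms c a) := by
    intro c; funext b
    by_cases hb : b = a
    · subst hb; simp
    · rw [Function.update_of_ne hb, h1 c b (by simpa [Pass.writes] using hb)]
  have hstep : ∀ c < E.Q, Ms (c + 1) a = Function.update (Ms c a) (ι c)
      (E.gv (E.ev c (Function.update F a (Ms c a)) e)) := by
    intro c hc
    rw [h3 c hc]
    simp only [bodySem, List.foldl_cons, List.foldl_nil, stoSem, Function.update_self]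
    rw [← hι c hc (Ms c a), ← hMs]
  obtain ⟨h4, h5⟩ := h2 a (by simp [Pass.writes])
  have hkeep : ∀ k c, c + k = E.Q → ∀ z, (∀ c', c ≤ c' → c' < E.Q → ι c' ≠ z) →
      Ms c a z = F a z := by
    intro k
    induction k with
    | zero => intro c hc z _; rw [← h5]; rw [show c = E.Q by omega]
    | succ k ih =>
      intro c hc z hz
      rw [← ih (c + 1) (by omega) z (fun c' h => hz c' (by omega)), hstep c (by omega),
        Function.update_of_ne (hz c le_rfl (by omega)).symm]
  refine ⟨fun c hc => ⟨Ms c a, hkeep (E.Q - c) c (by omega), fun hlast => ?_⟩, fun z hz => ?_⟩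
  · rw [← hkeep (E.Q - (c + 1)) (c + 1) (by omega) (ι c) (fun c' h => hlast c' (by omega)),
      hstep c hc, Function.update_self]
  · rw [← hkeep E.Q 0 (by omega) z (fun c' _ h => hz c' h), h4]

end Env

/-! ### The program -/

namespace Env

variable (E : Env) (c : ℤ) (m : Mem)

@[simp] theorem ev_const (x : ℤ) : E.ev c m (RExpr.const x) = x := rfl
@[simp] theorem ev_reg_zero : E.ev c m (RExpr.reg 0) = E.N := rfl
@[simp] theorem ev_reg_one : E.ev c m (RExpr.reg 1) = E.A := rfl
@[simp] theorem ev_reg_two : E.ev c m (RExpr.reg 2) = c := rfl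
@[simp] theorem ev_get (a : ℕ) (i : RExpr) : E.ev c m (RExpr.get a i) = m a (E.ev c m i) := rfl
@[simp] theorem ev_plus (e f : RExpr) : E.ev c m (e.plus f) = E.ev c m e + E.ev c m f := rfl
@[simp] theorem ev_minus (e f : RExpr) : E.ev c m (e.minus f) = E.ev c m e - E.ev c m f := rfl
@[simp] theorem ev_times (e f : RExpr) : E.ev c m (e.times f) = E.ev c m e * E.ev c m f := rfl
@[simp] theorem ev_quot (e f : RExpr) : E.ev c m (e.quot f) = E.ev c m e / E.ev c m f := rfl
@[simp] theorem ev_lt (e f : RExpr) :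
    E.ev c m (e.lt f) = if E.ev c m e < E.ev c m f then 1 else 0 := RExpr.eval_lt _ _ _
@[simp] theorem ev_eq (e f : RExpr) :
    E.ev c m (e.eq f) = if E.ev c m e = E.ev c m f then 1 else 0 := RExpr.eval_eq _ _ _
@[simp] theorem ev_nz (e : RExpr) :
    E.ev c m e.nz = if E.ev c m e = 0 then 0 else 1 := RExpr.eval_nz _ _
@[simp] theorem ev_not (e : RExpr) : E.ev c m e.not = 1 - E.ev c m e := rfl

end Env

namespace Draw

open RExpr

/-- The counter. -/
abbrev cnt : RExpr := reg 2

/-! The arrays are: 0 the code; 7 the length and 8 the number of inner vertices of the subtree at a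
position; 9 and 10 the numbers of series nodes and of leaves before a position; 11 and 12 the parent;
13 and 14 the terminals; 15 the place where the inner vertices begin; 16 the depth of the pool;
17 and 18 the ends of the edges; 19 and 20 the places and slots of inner vertices; 21 to 24 the
indices of the edges at their ends and the degrees; 25 logarithms; 26 and 27 the length of the rows
and the number of tracks; 28 to 30 the place, the row and the column of a vertex; 31 and 32 the
ports; 33 whether the source of an edge comes first; 34 the slots; 35 the tracks; 36 whether the ends
of an edge are in different rows; 37 and 38 the lanes; 39 to 42 the lanes and directions by vertex
and port; 43 the main ports; 44 the depths and 45 the sides of the vertices; 46 to 52 the corners. -/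

/-- The position that is treated when positions are treated from right to left. -/
abbrev back : RExpr := minus (minus (reg 0) (const 1)) cnt

def lenPass : Pass := [⟨7, back, plus (const 1) (times (nz (get 0 back))
  (plus (get 7 (plus back (const 1)))
    (get 7 (plus (plus back (const 1)) (get 7 (plus back (const 1)))))))⟩]

def innerPass : Pass := [⟨8, back, plus (eq (get 0 back) (const 1)) (times (nz (get 0 back))
  (plus (get 8 (plus back (const 1)))
    (get 8 (plus (plus back (const 1)) (get 7 (plus back (const 1)))))))⟩]

def seriesPass : Pass := [⟨9, plus cnt (const 1), plus (get 9 cnt) (eq (get 0 cnt) (const 1))⟩]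

def leavesPass : Pass := [⟨10, plus cnt (const 1), plus (get 10 cnt) (eq (get 0 cnt) (const 0))⟩]

/-- A composition announces itself at the position where its right part begins. At leaves the store
goes to the waste address `-1`. -/
def rightPass : Pass := [⟨11, minus (times (nz (get 0 cnt))
  (plus (plus cnt (const 2)) (get 7 (plus cnt (const 1))))) (const 1), cnt⟩]

/-- Whether the position is that of a left part. -/
abbrev isLeft : RExpr := nz (get 0 (minus cnt (const 1)))

def parentPass : Pass := [⟨12, cnt, plus (times isLeft (minus cnt (const 1)))
  (times (not isLeft) (get 11 cnt))⟩]

abbrev parent : RExpr := get 12 cnt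

/-- Whether the parent is a series composition. -/
abbrev inSeries : RExpr := eq (get 0 parent) (const 1)

def ite (b x y : RExpr) : RExpr := plus (times b x) (times (not b) y)

def sourcePass : Pass := [⟨13, cnt, times (nz cnt)
  (ite (times (not isLeft) inSeries) (plus (get 9 parent) (const 2)) (get 13 parent))⟩]

def sinkPass : Pass := [⟨14, cnt, ite (nz cnt)
  (ite (times isLeft inSeries) (plus (get 9 parent) (const 2)) (get 14 parent)) (const 1)⟩]

/-- The other part of the parent. -/
abbrev sibling : RExpr := ite isLeft (plus cnt (get 7 cnt)) (plus parent (const 1))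

/-- Whether this part comes after the other part of the parent. -/
abbrev isSecond : RExpr := lt (get 8 sibling) (plus (get 8 cnt) (not isLeft))

/-- A part begins after the base of its parent, after the new vertex in the case of a series
composition, and after the sibling if this comes first. In `isSecond` the summand `not isLeft` makes
the comparison weak for right parts, in accordance with the tie rule of `offL`. -/
def basePass : Pass := [⟨15, cnt, ite (nz cnt)
  (plus (plus (get 15 parent) inSeries) (times isSecond (get 8 sibling))) (const 2)⟩]

def depthPass : Pass := [⟨16, cnt, ite (nz cnt) (plus (get 16 parent) (not isSecond)) (const 1)⟩]

/-- The number of the edge if the position is that of an edge, and `-1` otherwise. -/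
abbrev edgeNo : RExpr := minus (times (times (eq (get 0 cnt) (const 0)) (lt cnt (reg 0)))
  (plus (get 10 cnt) (const 1))) (const 1)

def edgeSrcPass : Pass := [⟨17, edgeNo, get 13 cnt⟩]

def edgeTgtPass : Pass := [⟨18, edgeNo, get 14 cnt⟩]

/-- The number of the vertex made by a series composition, and `-1` for other positions. -/
abbrev vertexNo : RExpr := minus (times (eq (get 0 cnt) (const 1))
  (plus (get 9 cnt) (const 3))) (const 1)

def posPass : Pass := [⟨19, vertexNo, get 15 cnt⟩]

/-- Array 20 is filled for inner vertices only and is 0 at both terminals of the whole digraph; the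
slot 1 of the sink has to be added. -/
abbrev slotOf (v : RExpr) : RExpr := plus (get 20 v) (eq v (const 1))

/-- Whether neither terminal has slot `x`. -/
abbrev isFree (x : RExpr) : RExpr :=
  times (nz (minus (slotOf (get 13 cnt)) x)) (nz (minus (slotOf (get 14 cnt)) x))

abbrev pool : RExpr := times (const 3) (get 16 cnt)

def slotPass : Pass := [⟨20, vertexNo, ite (isFree pool) pool
  (ite (isFree (plus pool (const 1))) (plus pool (const 1)) (plus pool (const 2)))⟩]

abbrev numV : RExpr := plus (get 9 (reg 0)) (const 2)

abbrev numE : RExpr := get 10 (reg 0)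

/-- The address `i` if the counter is the number of an edge, and `-1` otherwise. -/
abbrev ifEdge (i : RExpr) : RExpr := minus (times (lt cnt numE) (plus i (const 1))) (const 1)

/-- The running count at the end of edge `c` is the index of this edge, and the final count is the
degree. If the counter is not the number of an edge, the increment goes to the waste address. -/
def countPass (v idx deg : ℕ) : Pass :=
  [⟨idx, cnt, get deg (get v cnt)⟩,
   ⟨deg, ifEdge (get v cnt), plus (get deg (get v cnt)) (const 1)⟩]

def logPass : Pass :=
  [⟨25, cnt, times (lt (const 1) cnt) (plus (get 25 (quot cnt (const 2))) (const 1))⟩]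

/-- The minimum of `A` and the number of vertices keeps the numbers small when `A` is huge. The
factor 200 makes rows at least four times as long as the number of tracks when `A ≤ n`. -/
def rowLenPass : Pass := [⟨26, const 0, times (const 200)
  (ite (lt numV (reg 1)) numV (reg 1))⟩]

def tracksPass : Pass := [⟨27, const 0, times (const 9) (plus (get 25 numV) (const 2))⟩]

abbrev rowLen : RExpr := get 26 (const 0)

abbrev tracks : RExpr := get 27 (const 0)

def placePass : Pass := [⟨28, cnt, plus (get 19 cnt) (eq cnt (const 1))⟩]

def rowPass : Pass := [⟨29, cnt, quot (get 28 cnt) rowLen⟩]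

def colPass : Pass := [⟨30, cnt, plus (times (const 3)
  (minus (get 28 cnt) (times rowLen (get 29 cnt)))) (const 1)⟩]

abbrev src : RExpr := get 17 cnt

abbrev tgt : RExpr := get 18 cnt

def portSrcPass : Pass := [⟨31, cnt, ite (lt (get 22 src) (get 24 src)) (const 2) (get 21 cnt)⟩]

def portTgtPass : Pass := [⟨32, cnt, ite (lt (get 22 tgt) (get 24 tgt)) (get 23 cnt) (const 2)⟩]

def earlyPass : Pass := [⟨33, cnt, lt (get 28 src) (get 28 tgt)⟩]

def slotsPass : Pass := [⟨34, cnt, plus (get 20 cnt) (eq cnt (const 1))⟩]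

def trackPass : Pass := [⟨35, cnt, ite (get 33 cnt)
  (plus (times (const 3) (get 34 src)) (get 31 cnt))
  (plus (times (const 3) (get 34 tgt)) (get 32 cnt))⟩]

def wrapPass : Pass := [⟨36, cnt, nz (minus (get 29 src) (get 29 tgt))⟩]

abbrev laneOf (v late : RExpr) : RExpr :=
  plus (plus (times (times (const 2) tracks) (get 29 v)) (get 35 cnt))
    (ite late (const 0) tracks)

def laneSrcPass : Pass := [⟨37, cnt, laneOf src (times (get 36 cnt) (not (get 33 cnt)))⟩]

def laneTgtPass : Pass := [⟨38, cnt, laneOf tgt (times (get 36 cnt) (get 33 cnt))⟩]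

abbrev atSrc : RExpr := ifEdge (plus (times (const 3) src) (get 31 cnt))

abbrev atTgt : RExpr := ifEdge (plus (times (const 3) tgt) (get 32 cnt))

/-- Sources and targets have arrays of their own because an array may be written by one pass only. A
port is used by a single edge end, so the sum of both arrays is the entry of this end. Adding one to
the lane makes `0` mean that the port is free. -/
def laneAtSrcPass : Pass := [⟨39, atSrc, plus (get 37 cnt) (const 1)⟩]

def laneAtTgtPass : Pass := [⟨40, atTgt, plus (get 38 cnt) (const 1)⟩]

def rightAtSrcPass : Pass := [⟨41, atSrc, ite (get 36 cnt) (const 1) (get 33 cnt)⟩]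

def rightAtTgtPass : Pass := [⟨42, atTgt, ite (get 36 cnt) (const 1) (not (get 33 cnt))⟩]

/-- The lane, increased by one, of the edge at port `x` of the vertex. -/
abbrev laneAt (x : RExpr) : RExpr :=
  plus (get 39 (plus (times (const 3) cnt) x)) (get 40 (plus (times (const 3) cnt) x))

abbrev rightAt (x : RExpr) : RExpr :=
  plus (get 41 (plus (times (const 3) cnt) x)) (get 42 (plus (times (const 3) cnt) x))

def mainPass : Pass := [⟨43, cnt, times (lt (const 0) (laneAt (const 1)))
  (lt (laneAt (const 1)) (laneAt (const 0)))⟩]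

def depthYPass : Pass := [⟨44, cnt, minus (laneAt (get 43 cnt)) (const 1)⟩]

def sidePass : Pass := [⟨45, cnt, minus (const 1) (times (const 2) (rightAt (get 43 cnt)))⟩]

def stubSrcPass : Pass := [⟨46, cnt, eq (get 31 cnt) (const 2)⟩]

def stubTgtPass : Pass := [⟨47, cnt, eq (get 32 cnt) (const 2)⟩]

def vertSrcPass : Pass := [⟨48, cnt, nz (minus (get 31 cnt) (get 43 src))⟩]

def vertTgtPass : Pass := [⟨49, cnt, nz (minus (get 32 cnt) (get 43 tgt))⟩]

def cxSrcPass : Pass := [⟨50, cnt, plus (get 30 src) (times (get 46 cnt) (get 45 src))⟩]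

def cxTgtPass : Pass := [⟨51, cnt, plus (get 30 tgt) (times (get 47 cnt) (get 45 tgt))⟩]

def wxPass : Pass := [⟨52, cnt, plus (times (const 3) rowLen) (get 35 cnt)⟩]

def outXPass : Pass := [⟨1, cnt, get 30 cnt⟩]

def outYPass : Pass := [⟨2, cnt, minus (const 0) (get 44 cnt)⟩]

def bendsPass : Pass := [⟨3, cnt, plus (plus (plus (get 46 cnt) (get 48 cnt))
  (times (const 2) (get 36 cnt))) (plus (get 49 cnt) (get 47 cnt))⟩]

def startPass : Pass := [⟨4, cnt, times (const 8) cnt⟩]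

/-- Stores of the values whose flags are `1` at consecutive addresses. -/
def emit (a : ℕ) : List (RExpr × RExpr) → RExpr → Pass
  | [], _ => []
  | x :: l, p => ⟨a, ifEdge p, x.2⟩ :: emit a l (plus p x.1)

def flags : List RExpr :=
  [const 1, get 46 cnt, get 48 cnt, get 36 cnt, get 36 cnt, get 49 cnt, get 47 cnt, const 1]

def xs : List RExpr := [get 30 src, get 50 cnt, get 50 cnt, get 52 cnt, get 52 cnt, get 51 cnt,
  get 51 cnt, get 30 tgt]

def ys : List RExpr := [minus (const 0) (get 44 src), minus (const 0) (get 44 src),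
  minus (const 0) (get 37 cnt), minus (const 0) (get 37 cnt), minus (const 0) (get 38 cnt),
  minus (const 0) (get 38 cnt), minus (const 0) (get 44 tgt), minus (const 0) (get 44 tgt)]

def passes : List Pass :=
  [lenPass, innerPass, seriesPass, leavesPass, rightPass, parentPass, sourcePass, sinkPass, basePass,
   depthPass, edgeSrcPass, edgeTgtPass, posPass, slotPass, countPass 17 21 22, countPass 18 23 24,
   logPass, rowLenPass, tracksPass, placePass, rowPass, colPass, portSrcPass, portTgtPass, earlyPass,
   slotsPass, trackPass, wrapPass, laneSrcPass, laneTgtPass, laneAtSrcPass, laneAtTgtPass,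
   rightAtSrcPass, rightAtTgtPass, mainPass, depthYPass, sidePass, stubSrcPass, stubTgtPass,
   vertSrcPass, vertTgtPass, cxSrcPass, cxTgtPass, wxPass, outXPass, outYPass, bendsPass, startPass,
   emit 5 (flags.zip xs) (times (const 8) cnt), emit 6 (flags.zip ys) (times (const 8) cnt)]

theorem passes_wellFormed : wellFormed [0] passes = true := by decide +kernel

/-- Register 3 gets the number of values of the counter and register 4 the bound for the numbers. -/
def prog : Prog :=
  -- So many steps reach all positions of the code, all edges and vertices, and also the number of
  -- vertices itself, at which the array of logarithms is read.
  Prog.seq (Prog.assign 3 (plus (reg 0) (const 3)))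
    (Prog.seq (Prog.assign 4 (times (const 10000) (times (reg 3) (reg 3)))) (passesProg passes))

end Draw

/-! ### Codes -/

namespace SPTree

def leaves : SPTree → ℕ
  | edge => 1
  | series l r => l.leaves + r.leaves
  | parallel l r => l.leaves + r.leaves

theorem leaves_pos (T : SPTree) : 0 < T.leaves := by
  induction T <;> simp only [leaves] <;> omega

theorem edgesFrom_length (T : SPTree) : ∀ s t k, (T.edgesFrom s t k).length = T.leaves := by
  induction T with
  | edge => intro s t k; rfl
  | series l r ihl ihr | parallel l r ihl ihr =>
    intro s t k; simp [edgesFrom, leaves, ihl, ihr]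

theorem code_length (T : SPTree) : T.code.length + 1 = 2 * T.leaves := by
  induction T with
  | edge => rfl
  | series l r ihl ihr | parallel l r ihl ihr =>
    simp only [code, leaves, List.length_cons, List.length_append]; omega

theorem inner_lt (T : SPTree) : T.inner < T.leaves := by
  induction T <;> simp only [inner, leaves] <;> omega

theorem code_length_pos (T : SPTree) : 0 < T.code.length := by
  have := T.code_length; have := T.leaves_pos; omega

/-- The code of `T` occurs in `C` at position `o`. -/
def At (C : List ℤ) (o : ℕ) (T : SPTree) : Prop := T.code <+: C.drop o

variable {C : List ℤ} {o : ℕ} {l r T : SPTree}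

theorem at_zero (T : SPTree) : At T.code 0 T := by simp [At]

theorem At.le (h : At C o T) : o + T.code.length ≤ C.length := by
  have h1 := h.length_le
  have := T.code_length_pos
  rw [List.length_drop] at h1
  omega

theorem At.getD (h : At C o T) {i : ℕ} (hi : i < T.code.length) :
    C.getD (o + i) 0 = T.code.getD i 0 := by
  have h1 := h.le
  have h2 := h.getElem hi
  rw [List.getD_eq_getElem _ _ hi, List.getD_eq_getElem _ _ (by omega), h2, List.getElem_drop]

theorem at_parts {x : ℤ} {a b : List ℤ} (h : (x :: (a ++ b)) <+: C.drop o) :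
    C.getD o 0 = x ∧ a <+: C.drop (o + 1) ∧ b <+: C.drop (o + 1 + a.length) := by
  obtain ⟨rest, h⟩ := h
  have h1 : C.drop (o + 1) = a ++ (b ++ rest) := by
    have : C.drop (o + 1) = (C.drop o).tail := by rw [List.tail_drop]
    rw [this, ← h]; simp
  refine ⟨?_, ⟨b ++ rest, h1.symm⟩, ⟨rest, ?_⟩⟩
  · have : (C.drop o).getD 0 0 = x := by rw [← h]; simp
    simpa [List.getD_eq_getElem?_getD] using this
  · rw [← List.drop_drop, h1, List.drop_left]

theorem At.series (h : At C o (series l r)) :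
    C.getD o 0 = 1 ∧ At C (o + 1) l ∧ At C (o + 1 + l.code.length) r := at_parts h

theorem At.parallel (h : At C o (parallel l r)) :
    C.getD o 0 = 2 ∧ At C (o + 1) l ∧ At C (o + 1 + l.code.length) r := at_parts h

theorem At.edge (h : At C o edge) : C.getD o 0 = 0 := by
  simpa [code] using h.getD (i := 0) (by simp [code])

theorem code_last (T : SPTree) : T.code.getD (T.code.length - 1) 0 = 0 := by
  have key : ∀ T : SPTree, T.code.getLast? = some 0 := by
    intro T
    induction T with
    | edge => rfl
    | series l r _ ihr | parallel l r _ ihr =>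
      simp only [code, List.getLast?_cons, List.getLast?_append, ihr]; simp
  have h := key T
  rw [List.getLast?_eq_getElem?] at h
  rw [List.getD_eq_getElem?_getD, h]; rfl

/-- This gives control over arbitrary positions, including those that are not reached in an
induction over a particular subtree. -/
theorem exists_at (T : SPTree) : ∀ o, At C o T → ∀ i < T.code.length,
    ∃ T', At C (o + i) T' ∧ i + T'.code.length ≤ T.code.length := by
  induction T with
  | edge =>
    intro o h i hi
    have : i = 0 := by simpa [code] using hi
    subst this
    exact ⟨_, h, by simp⟩
  | series l r ihl ihr | parallel l r ihl ihr =>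
    intro o h i hi
    have h' : At C (o + 1) l ∧ At C (o + 1 + l.code.length) r :=
      (at_parts h).2
    simp only [code, List.length_cons, List.length_append] at hi ⊢
    rcases Nat.eq_zero_or_pos i with rfl | h0
    · exact ⟨_, h, by simp [code]⟩
    rcases Nat.lt_or_ge i (1 + l.code.length) with h1 | h1
    · obtain ⟨T', h2, h3⟩ := ihl _ h'.1 (i - 1) (by omega)
      refine ⟨T', ?_, by omega⟩
      rwa [show o + 1 + (i - 1) = o + i by omega] at h2
    · obtain ⟨T', h2, h3⟩ := ihr _ h'.2 (i - 1 - l.code.length) (by omega)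
      refine ⟨T', ?_, by omega⟩
      rwa [show o + 1 + l.code.length + (i - 1 - l.code.length) = o + i by omega] at h2

end SPTree

/-! ### The final memory and the sizes of subtrees -/

namespace Draw

open SPTree

/-- `F` is the memory when the program has finished. -/
structure Final (T : SPTree) (E : Env) (F : Mem) : Prop where
  hN : E.N = T.code.length
  hQ : E.Q = T.code.length + 3
  hM : E.M = 10000 * (E.Q * E.Q)
  code : ∀ i : ℕ, F 0 i = T.code.getD i 0
  trace : ∃ m₀ : Mem, (∀ b ≠ 0, m₀ b = 0) ∧ ∀ p ∈ passes, E.Trace m₀ F p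

variable {T : SPTree} {E : Env} {F : Mem}

theorem Final.gv (H : Final T E F) {x : ℤ} (h1 : -(10000 * (E.Q : ℤ)) ≤ x)
    (h2 : x ≤ 10000 * (E.Q : ℤ)) : E.gv x = x := by
  refine E.gv_of_le (abs_le.2 ?_)
  have h3 := H.hQ
  have : (1 : ℤ) ≤ E.Q := by omega
  rw [H.hM]
  constructor <;> nlinarith

/-- A pass with a single store. -/
theorem Final.single (H : Final T E F) {a : ℕ} {i e : RExpr} (hp : [⟨a, i, e⟩] ∈ passes)
    (ha : a ≠ 0) (ι : ℕ → ℤ) (hι : ∀ c < E.Q, ∀ m, E.gv (E.ev c (Function.update F a m) i) = ι c) :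
    (∀ c < E.Q, ∃ m : ℤ → ℤ, (∀ z, (∀ c', c ≤ c' → c' < E.Q → ι c' ≠ z) → m z = F a z) ∧
      ((∀ c', c < c' → c' < E.Q → ι c' ≠ ι c) →
        F a (ι c) = E.gv (E.ev c (Function.update F a m) e))) ∧
    ∀ z, (∀ c < E.Q, ι c ≠ z) → F a z = 0 := by
  obtain ⟨m₀, h0, h⟩ := H.trace
  have := (h _ hp).single ι hι
  rw [h0 a ha] at this
  exact this

/-- A pass that fills an array from left to right. -/
theorem Final.forward (H : Final T E F) {a : ℕ} {e : RExpr} (hp : [⟨a, cnt, e⟩] ∈ passes)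
    (ha : a ≠ 0) (c : ℕ) (hc : c < E.Q) : ∃ m : ℤ → ℤ, (∀ z < (c : ℤ), m z = F a z) ∧
      F a c = E.gv (E.ev c (Function.update F a m) e) := by
  obtain ⟨m, h1, h2⟩ := (H.single hp ha (fun c => c) (fun c hc m => by
    rw [cnt, Env.ev_reg_two]; exact H.gv (by omega) (by omega))).1 c hc
  exact ⟨m, fun z hz => h1 z fun c' h _ => by omega, h2 fun c' h _ => by omega⟩

/-- A pass that fills an array from right to left. -/
theorem Final.backward (H : Final T E F) {a : ℕ} {e : RExpr} (hp : [⟨a, back, e⟩] ∈ passes)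
    (ha : a ≠ 0) (i : ℕ) (hi : i < T.code.length) : ∃ m : ℤ → ℤ, (∀ z, (i : ℤ) < z → m z = F a z) ∧
      F a i = E.gv (E.ev (E.N - 1 - i) (Function.update F a m) e) := by
  have hQ := H.hQ
  have hN := H.hN
  obtain ⟨m, h1, h2⟩ := (H.single hp ha (fun c => E.N - 1 - c) (fun c hc m => by
    simp only [back, cnt, Env.ev_reg_two, Env.ev_minus, Env.ev_reg_zero, Env.ev_const]
    exact H.gv (by omega) (by omega))).1 (T.code.length - 1 - i) (by omega)
  have h3 : E.N - 1 - ((T.code.length - 1 - i : ℕ) : ℤ) = i := by omega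
  have h4 : ((T.code.length - 1 - i : ℕ) : ℤ) = E.N - 1 - i := by omega
  rw [h3, h4] at h2
  exact ⟨m, fun z hz => h1 z fun c' h _ => by omega, h2 fun c' h _ => by omega⟩

theorem Final.len_rec (H : Final T E F) (i : ℕ) (hi : i < T.code.length) :
    ∃ m : ℤ → ℤ, (∀ z, (i : ℤ) < z → m z = F 7 z) ∧ F 7 i = E.gv (1 +
      (if F 0 i = 0 then 0 else 1) * (m (i + 1) + m (i + 1 + m (i + 1)))) := by
  obtain ⟨m, h1, h2⟩ := H.backward (show lenPass ∈ passes by simp [passes]) (by norm_num) i hi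
  exact ⟨m, h1, by simpa [Function.update_apply] using h2⟩

theorem Final.inner_rec (H : Final T E F) (i : ℕ) (hi : i < T.code.length) :
    ∃ m : ℤ → ℤ, (∀ z, (i : ℤ) < z → m z = F 8 z) ∧ F 8 i = E.gv ((if F 0 i = 1 then 1 else 0) +
      (if F 0 i = 0 then 0 else 1) * (m (i + 1) + m (i + 1 + F 7 (i + 1)))) := by
  obtain ⟨m, h1, h2⟩ := H.backward (show innerPass ∈ passes by simp [passes]) (by norm_num) i hi
  exact ⟨m, h1, by simpa [Function.update_apply] using h2⟩

/-- Both parts of a composition begin to the right of it, where a pass from right to left has left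
the final entries; the length of the left part tells where the right part begins. -/
theorem Final.len_eq (H : Final T E F) (S : SPTree) : ∀ o : ℕ, At T.code o S →
    F 7 o = S.code.length := by
  have hQ := H.hQ
  induction S with
  | edge =>
    intro o h
    have h1 := h.le
    obtain ⟨m, -, h3⟩ := H.len_rec o (by simp only [SPTree.code, List.length_singleton] at h1; omega)
    rw [H.code, h.edge, if_pos rfl, H.gv (by omega) (by omega)] at h3
    rw [h3]; simp [SPTree.code]
  | series l r ihl ihr | parallel l r ihl ihr =>
    intro o h
    have h1 := h.le
    obtain ⟨h4, h5, h6⟩ := at_parts h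
    simp only [SPTree.code, List.length_cons, List.length_append] at h1
    obtain ⟨m, h2, h3⟩ := H.len_rec o (by omega)
    have h7 := ihl _ h5
    have h8 := ihr _ h6
    push_cast at h7 h8
    have h9 : m (o + 1) = l.code.length := by rw [h2 _ (by omega), h7]
    rw [H.code, h4, if_neg (by norm_num), h9, h2 _ (by omega), h8,
      H.gv (by omega) (by omega)] at h3
    rw [h3]; simp only [SPTree.code, List.length_cons, List.length_append]; push_cast; ring

theorem Final.inner_eq (H : Final T E F) (S : SPTree) : ∀ o : ℕ, At T.code o S →
    F 8 o = S.inner := by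
  have hQ := H.hQ
  induction S with
  | edge =>
    intro o h
    have h1 := h.le
    obtain ⟨m, -, h3⟩ := H.inner_rec o (by simp only [SPTree.code, List.length_singleton] at h1; omega)
    rw [H.code, h.edge, if_pos rfl, if_neg (by norm_num), H.gv (by omega) (by omega)] at h3
    rw [h3]; simp [SPTree.inner]
  | series l r ihl ihr | parallel l r ihl ihr =>
    intro o h
    have h1 := h.le
    obtain ⟨h4, h5, h6⟩ := at_parts h
    simp only [SPTree.code, List.length_cons, List.length_append] at h1
    obtain ⟨m, h2, h3⟩ := H.inner_rec o (by omega)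
    have h7 := ihl _ h5
    have h8 := ihr _ h6
    have h9 := H.len_eq l _ h5
    have := l.inner_lt; have := r.inner_lt; have := l.code_length; have := r.code_length
    push_cast at h7 h8 h9
    rw [H.code, h4, h9, h2 _ (by omega), h2 _ (by omega), h7, h8] at h3
    norm_num at h3
    rw [H.gv (by omega) (by omega)] at h3
    rw [h3]; simp only [SPTree.inner]; push_cast; ring

/-- A pass that counts the positions with a certain symbol. -/
theorem Final.count_rec (H : Final T E F) {a : ℕ} {x : ℤ} (ha : a ≠ 0)
    (hp : [⟨a, RExpr.plus cnt (RExpr.const 1),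
      RExpr.plus (RExpr.get a cnt) (RExpr.eq (RExpr.get 0 cnt) (RExpr.const x))⟩] ∈ passes) :
    F a 0 = 0 ∧ ∀ c : ℕ, c < E.Q → (0 ≤ F a c ∧ F a c ≤ c) ∧
      F a (c + 1) = F a c + if F 0 c = x then 1 else 0 := by
  obtain ⟨h1, h2⟩ := H.single hp ha (fun c => c + 1) (fun c hc m => by
    simp only [cnt, Env.ev_reg_two, Env.ev_plus, Env.ev_const]
    exact H.gv (by omega) (by omega))
  have h0 : F a 0 = 0 := h2 0 fun c _ => by omega
  refine ⟨h0, fun c => ?_⟩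
  -- The recursion holds as long as the guard does not cut off the value. So it is proved together
  -- with the bounds on the count.
  have step : ∀ c : ℕ, c < E.Q → 0 ≤ F a c → F a c ≤ c →
      F a (c + 1) = F a c + if F 0 c = x then 1 else 0 := by
    intro c hc h3 h4
    obtain ⟨m, h5, h6⟩ := h1 c hc
    have h7 := h6 fun c' h _ => by omega
    simp only [cnt, Env.ev_reg_two, Env.ev_plus, Env.ev_const, Env.ev_get, Env.ev_eq,
      Function.update_self, Function.update_of_ne ha.symm] at h7
    rw [h5 c fun c' h _ => by omega] at h7
    rw [h7]
    exact H.gv (by split_ifs <;> omega) (by split_ifs <;> omega)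
  induction c with
  | zero => intro hc; exact ⟨by simp [h0], step 0 hc (by simp [h0]) (by simp [h0])⟩
  | succ c ih =>
    intro hc
    obtain ⟨⟨h3, h4⟩, h5⟩ := ih (by omega)
    have h6 : 0 ≤ F a ((c + 1 : ℕ) : ℤ) ∧ F a ((c + 1 : ℕ) : ℤ) ≤ (c + 1 : ℕ) := by
      push_cast; rw [h5]; split_ifs <;> omega
    exact ⟨h6, step (c + 1) hc h6.1 h6.2⟩

theorem Final.series_rec (H : Final T E F) : F 9 0 = 0 ∧ ∀ c : ℕ, c < E.Q →
    (0 ≤ F 9 c ∧ F 9 c ≤ c) ∧ F 9 (c + 1) = F 9 c + if F 0 c = 1 then 1 else 0 :=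
  H.count_rec (by norm_num) (show seriesPass ∈ passes by simp [passes])

theorem Final.leaves_rec (H : Final T E F) : F 10 0 = 0 ∧ ∀ c : ℕ, c < E.Q →
    (0 ≤ F 10 c ∧ F 10 c ≤ c) ∧ F 10 (c + 1) = F 10 c + if F 0 c = 0 then 1 else 0 :=
  H.count_rec (by norm_num) (show leavesPass ∈ passes by simp [passes])

theorem mono_of_rec {f : ℤ → ℤ} {Q : ℕ} {p : ℕ → Prop} [DecidablePred p]
    (h : ∀ c : ℕ, c < Q → f (c + 1) = f c + if p c then 1 else 0) (c : ℕ) :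
    ∀ d : ℕ, c ≤ d → d ≤ Q → f c ≤ f d := by
  intro d hd
  induction d, hd using Nat.le_induction with
  | base => intro _; exact le_rfl
  | succ d hd ih =>
    intro hQ
    have h1 := h d (by omega)
    have h2 := ih (by omega)
    push_cast
    rw [h1]; split_ifs <;> omega

theorem Final.count_eq (H : Final T E F) (S : SPTree) : ∀ o : ℕ, At T.code o S →
    F 9 (o + S.code.length) = F 9 o + S.inner ∧ F 10 (o + S.code.length) = F 10 o + S.leaves := by
  have hQ := H.hQ
  induction S with
  | edge =>
    intro o h
    have h1 := h.le
    simp only [SPTree.code, List.length_singleton] at h1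
    have h2 := (H.series_rec.2 o (by omega)).2
    have h3 := (H.leaves_rec.2 o (by omega)).2
    rw [H.code, h.edge] at h2 h3
    simpa [SPTree.code, SPTree.inner, SPTree.leaves] using And.intro h2 h3
  | series l r ihl ihr | parallel l r ihl ihr =>
    intro o h
    have h1 := h.le
    obtain ⟨h4, h5, h6⟩ := at_parts h
    simp only [SPTree.code, List.length_cons, List.length_append] at h1
    have h2 := (H.series_rec.2 o (by omega)).2
    have h3 := (H.leaves_rec.2 o (by omega)).2
    rw [H.code, h4] at h2 h3
    have h7 := ihl _ h5
    have h8 := ihr _ h6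
    push_cast at h7 h8
    have h9 : (o : ℤ) + ((l.code.length + r.code.length + 1 : ℕ) : ℤ) =
      o + 1 + l.code.length + r.code.length := by push_cast; ring
    simp only [SPTree.code, List.length_cons, List.length_append, SPTree.inner, SPTree.leaves]
    rw [h9, h8.1, h8.2, h7.1, h7.2, h2, h3]
    constructor <;> norm_num <;> ring

end Draw

@[simp] theorem Env.ev_ite (E : Env) (c : ℤ) (m : Mem) (b x y : RExpr) :
    E.ev c m (Draw.ite b x y) = E.ev c m b * E.ev c m x + (1 - E.ev c m b) * E.ev c m y := rfl

namespace Draw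

open SPTree

variable {T : SPTree} {E : Env} {F : Mem}

/-! ### Parents -/

theorem Final.code_cases (H : Final T E F) (c : ℕ) (hc : F 0 c ≠ 0) :
    ∃ l r : SPTree, At T.code (c + 1) l ∧ c + 1 + l.code.length + r.code.length ≤ T.code.length ∧
      F 7 (c + 1) = l.code.length := by
  have h1 : c < T.code.length := by
    by_contra h
    rw [H.code, List.getD_eq_default _ _ (by omega)] at hc
    exact hc rfl
  obtain ⟨S, h2, -⟩ := exists_at T 0 (at_zero T) c h1
  rw [zero_add] at h2
  cases S with
  | edge => exact absurd (by rw [H.code, h2.edge]) hc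
  | series l r | parallel l r =>
    have h3 := h2.le
    obtain ⟨-, h4, -⟩ := at_parts h2
    simp only [SPTree.code, List.length_cons, List.length_append] at h3
    refine ⟨l, r, h4, by omega, ?_⟩
    have := H.len_eq l _ h4
    push_cast at this
    exact this

/-- The position `o` is that of a composition of `l` and `r`. -/
structure Comp (T : SPTree) (F : Mem) (o : ℕ) (l r : SPTree) : Prop where
  code : F 0 o ≠ 0
  left : At T.code (o + 1) l
  right : At T.code (o + 1 + l.code.length) r

theorem Final.comp_series (H : Final T E F) {o : ℕ} {l r : SPTree}
    (h : At T.code o (series l r)) : Comp T F o l r ∧ F 0 o = 1 := by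
  obtain ⟨h1, h2, h3⟩ := h.series
  have : F 0 o = 1 := by rw [H.code, h1]
  exact ⟨⟨by rw [this]; norm_num, h2, h3⟩, this⟩

theorem Final.comp_parallel (H : Final T E F) {o : ℕ} {l r : SPTree}
    (h : At T.code o (parallel l r)) : Comp T F o l r ∧ F 0 o = 2 := by
  obtain ⟨h1, h2, h3⟩ := h.parallel
  have : F 0 o = 2 := by rw [H.code, h1]
  exact ⟨⟨by rw [this]; norm_num, h2, h3⟩, this⟩

/-- A left part directly follows its parent, whose symbol is not `0`. A right part directly follows
the last symbol of the left part, which is a leaf. This is how the program tells them apart. -/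
theorem Final.last_left (H : Final T E F) {o : ℕ} {l r : SPTree} (h : Comp T F o l r) :
    F 0 ((o + 1 + l.code.length : ℕ) - 1 : ℤ) = 0 := by
  have h1 := l.code_length_pos
  have h2 := h.left.getD (i := l.code.length - 1) (by omega)
  rw [code_last, show o + 1 + (l.code.length - 1) = o + l.code.length by omega] at h2
  rw [show ((o + 1 + l.code.length : ℕ) - 1 : ℤ) = ((o + l.code.length : ℕ) : ℤ) by push_cast; ring,
    H.code, h2]

/-- The composition at `o` stores its own position at the beginning of its right part, and no later
position overwrites this entry. -/
theorem Final.right_parent (H : Final T E F) {o : ℕ} {l r : SPTree} (h : Comp T F o l r) :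
    F 11 ((o + 1 + l.code.length : ℕ) : ℤ) = o := by
  have hQ := H.hQ
  have hlast : ∀ c : ℕ, F 0 c ≠ 0 → 1 ≤ F 7 (c + 1) ∧ c + 1 + F 7 (c + 1) ≤ E.Q := by
    intro c hc
    obtain ⟨l', r', -, h2, h3⟩ := H.code_cases c hc
    have := l'.code_length_pos
    rw [h3]; omega
  obtain ⟨h1, -⟩ := H.single (show rightPass ∈ passes by simp [passes]) (by norm_num)
    (fun c => if F 0 c = 0 then -1 else c + 1 + F 7 (c + 1)) (by
      intro c hc m
      have h2 := hlast c
      simp only [cnt, Env.ev_reg_two, Env.ev_plus, Env.ev_const, Env.ev_get, Env.ev_minus,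
        Env.ev_times, Env.ev_nz, Function.update_of_ne (show (0 : ℕ) ≠ 11 by norm_num),
        Function.update_of_ne (show (7 : ℕ) ≠ 11 by norm_num)]
      split_ifs with h0
      · rw [zero_mul, H.gv] <;> omega
      · have := h2 h0
        rw [H.gv (by omega) (by omega)]; ring)
  have hle := h.right.le
  have h7 := H.len_eq l _ h.left
  push_cast at h7
  obtain ⟨m, -, h3⟩ := h1 o (by omega)
  simp only [h.code, if_false, h7] at h3
  -- A later composition inside the left part has its right part inside the left part, too. One that
  -- begins with the right part or later has its own right part further to the right.
  have h4 := h3 (by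
    intro c hc hcQ
    split_ifs with h0
    · omega
    · obtain ⟨l', r', h5, h6, h8⟩ := H.code_cases c h0
      rw [h8]
      rcases Nat.lt_or_ge c (o + 1 + l.code.length) with h9 | h9
      · obtain ⟨S, h10, h11⟩ := exists_at l (o + 1) h.left (c - (o + 1)) (by omega)
        rw [show o + 1 + (c - (o + 1)) = c by omega] at h10
        cases S with
        | edge => exact absurd (by rw [H.code, h10.edge]) h0
        | series l'' r'' | parallel l'' r'' =>
          have h12 := (at_parts h10).2.1
          have h13 := H.len_eq l'' _ h12
          have := r''.code_length_pos
          push_cast at h13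
          rw [h8] at h13
          simp only [SPTree.code, List.length_cons, List.length_append] at h11
          omega
      · have := l'.code_length_pos
        omega)
  rw [show ((o + 1 + l.code.length : ℕ) : ℤ) = (o : ℤ) + 1 + l.code.length by push_cast; ring, h4]
  simp only [cnt, Env.ev_reg_two]
  exact H.gv (by omega) (by omega)

/-- A pass of the form `a[c] := e`, where `e` does not read `a`. -/
theorem Final.fill (H : Final T E F) {a : ℕ} {e : RExpr} (hp : [⟨a, cnt, e⟩] ∈ passes)
    (ha : a ≠ 0) {c : ℕ} (hc : c < E.Q) {x : ℤ}
    (hx : ∀ m, E.ev c (Function.update F a m) e = x) : F a c = E.gv x := by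
  obtain ⟨m, -, h⟩ := H.forward hp ha c hc
  rw [h, hx]

theorem Final.parent_rec (H : Final T E F) (c : ℕ) (hc : c < E.Q) :
    F 12 c = E.gv ((if F 0 (c - 1) = 0 then 0 else 1) * (c - 1) +
      (1 - (if F 0 (c - 1) = 0 then 0 else 1)) * F 11 c) :=
  H.fill (show parentPass ∈ passes by simp [passes]) (by norm_num) hc fun m => by
    simp

theorem Final.parent_left (H : Final T E F) {o : ℕ} {l r : SPTree} (h : Comp T F o l r) :
    F 12 ((o + 1 : ℕ) : ℤ) = o := by
  have := h.left.le; have hQ := H.hQ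
  rw [H.parent_rec _ (by omega), show ((o + 1 : ℕ) : ℤ) - 1 = o by push_cast; ring,
    if_neg h.code, H.gv] <;> omega

theorem Final.parent_right (H : Final T E F) {o : ℕ} {l r : SPTree} (h : Comp T F o l r) :
    F 12 ((o + 1 + l.code.length : ℕ) : ℤ) = o := by
  have := h.right.le; have hQ := H.hQ; have := r.code_length_pos
  rw [H.parent_rec _ (by omega), H.last_left h, if_pos rfl, H.right_parent h, H.gv] <;> omega

/-! ### What is passed down the tree -/

/-- The values at a position `c` whose parent is at `o`. -/
theorem Final.child (H : Final T E F) {c o : ℕ} (hc : c < E.Q) (hoc : o < c) (hp : F 12 c = o)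
    {u v x : ℤ} (hu : (if F 0 (c - 1) = 0 then 0 else 1) = u)
    (hv : (if F 0 o = 1 then 1 else 0) = v) (hx : F 8 (u * (c + F 7 c) + (1 - u) * (o + 1)) = x) :
    F 13 c = E.gv ((1 - u) * v * (F 9 o + 2) + (1 - (1 - u) * v) * F 13 o) ∧
    F 14 c = E.gv (u * v * (F 9 o + 2) + (1 - u * v) * F 14 o) ∧
    F 15 c = E.gv (F 15 o + v + (if x < F 8 c + (1 - u) then 1 else 0) * x) ∧
    F 16 c = E.gv (F 16 o + (1 - if x < F 8 c + (1 - u) then 1 else 0)) := by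
  have hc0 : (c : ℤ) ≠ 0 := by omega
  have hcn : c ≠ 0 := by omega
  have hoc' : (o : ℤ) < c := by omega
  refine ⟨?_, ?_, ?_, ?_⟩
  · obtain ⟨m, h1, h2⟩ := H.forward (show sourcePass ∈ passes by simp [passes]) (by norm_num) c hc
    rw [h2]
    congr 1
    simp [hp, hu, hv, hcn, h1 _ hoc']
  · obtain ⟨m, h1, h2⟩ := H.forward (show sinkPass ∈ passes by simp [passes]) (by norm_num) c hc
    rw [h2]
    congr 1
    simp [hp, hu, hv, hcn, h1 _ hoc']
  · obtain ⟨m, h1, h2⟩ := H.forward (show basePass ∈ passes by simp [passes]) (by norm_num) c hc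
    rw [h2]
    congr 1
    simp only [sibling, isSecond, isLeft, inSeries, parent, cnt, Env.ev_ite, Env.ev_plus,
      Env.ev_times, Env.ev_const, Env.ev_nz, Env.ev_eq, Env.ev_lt, Env.ev_not, Env.ev_get,
      Env.ev_minus, Env.ev_reg_two, Function.update_self,
      Function.update_of_ne (show (0 : ℕ) ≠ 15 by norm_num),
      Function.update_of_ne (show (7 : ℕ) ≠ 15 by norm_num),
      Function.update_of_ne (show (8 : ℕ) ≠ 15 by norm_num),
      Function.update_of_ne (show (12 : ℕ) ≠ 15 by norm_num), hp, hu, hv, hx, hc0, h1 _ hoc',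
      if_false]
    ring
  · obtain ⟨m, h1, h2⟩ := H.forward (show depthPass ∈ passes by simp [passes]) (by norm_num) c hc
    rw [h2]
    congr 1
    simp only [sibling, isSecond, isLeft, parent, cnt, Env.ev_ite, Env.ev_plus,
      Env.ev_const, Env.ev_nz, Env.ev_lt, Env.ev_not, Env.ev_get,
      Env.ev_minus, Env.ev_reg_two, Function.update_self,
      Function.update_of_ne (show (0 : ℕ) ≠ 16 by norm_num),
      Function.update_of_ne (show (7 : ℕ) ≠ 16 by norm_num),
      Function.update_of_ne (show (8 : ℕ) ≠ 16 by norm_num),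
      Function.update_of_ne (show (12 : ℕ) ≠ 16 by norm_num), hp, hu, hx, hc0, h1 _ hoc',
      if_false]
    ring

/-- The arrays have the intended values at the position `o` of `S`. -/
structure Node (T : SPTree) (E : Env) (F : Mem) (o : ℕ) (S : SPTree) (s t k b d : ℕ) : Prop where
  occurs : At T.code o S
  source : F 13 o = s
  sink : F 14 o = t
  first : F 9 o + 2 = k
  base : F 15 o = b
  depth : F 16 o = d
  source_lt : s < k
  sink_lt : t < k
  base_le : b + S.inner ≤ E.Q
  depth_le : d ≤ o + 1

theorem Final.root (H : Final T E F) : Node T E F 0 T 0 1 2 2 1 := by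
  have hQ := H.hQ
  have hz : (0 : ℕ) < E.Q := by omega
  have := T.inner_lt; have := T.code_length
  refine ⟨at_zero T, ?_, ?_, ?_, ?_, ?_, by norm_num, by norm_num, by omega, by norm_num⟩
  · obtain ⟨m, -, h2⟩ := H.forward (show sourcePass ∈ passes by simp [passes]) (by norm_num) 0 hz
    rw [h2]; simp [Env.gv]
  · obtain ⟨m, -, h2⟩ := H.forward (show sinkPass ∈ passes by simp [passes]) (by norm_num) 0 hz
    rw [h2]; simp
    exact H.gv (by omega) (by omega)
  · have := H.series_rec.1
    simp [this]
  · obtain ⟨m, -, h2⟩ := H.forward (show basePass ∈ passes by simp [passes]) (by norm_num) 0 hz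
    rw [h2]; simp
    exact H.gv (by omega) (by omega)
  · obtain ⟨m, -, h2⟩ := H.forward (show depthPass ∈ passes by simp [passes]) (by norm_num) 0 hz
    rw [h2]; simp
    exact H.gv (by omega) (by omega)

/-- The values at the two parts of a composition. -/
theorem Final.parts (H : Final T E F) {o : ℕ} {l r S : SPTree} {s t k b d : ℕ}
    (hn : Node T E F o S s t k b d) (h : Comp T F o l r) {v : ℕ}
    (hv : (if F 0 o = 1 then 1 else 0) = (v : ℤ)) (hv1 : v ≤ 1)
    (hi : S.inner = l.inner + r.inner + v) :
    Node T E F (o + 1) l s (if v = 1 then k else t) (k + v) (b + v + offL l r) (d + stepL l r) ∧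
    Node T E F (o + 1 + l.code.length) r (if v = 1 then k else s) t (k + v + l.inner)
      (b + v + offR l r) (d + stepR l r) := by
  obtain ⟨-, h13, h14, h9, h15, h16, hs, ht, hb, hd⟩ := hn
  have hQ := H.hQ
  have hl := h.left.le; have hr := h.right.le
  have h1 := r.code_length_pos; have h2 := l.code_length_pos
  have h8l := H.inner_eq l _ h.left
  have h8r := H.inner_eq r _ h.right
  have h7l := H.len_eq l _ h.left
  have hser := H.series_rec.2 o (by omega)
  rw [hv] at hser
  have hcl := (H.count_eq l _ h.left).1
  have hoff := off_cases l r
  push_cast at hcl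
  -- In `child` the number `u` is 1 for a left part and 0 for a right part, `v` is 1 for a series
  -- composition, and `x` is the number of inner vertices of the sibling.
  obtain ⟨a1, a2, a3, a4⟩ := H.child (c := o + 1) (by omega) (by omega) (H.parent_left h)
    (u := 1) (x := r.inner) (by
      rw [show ((o + 1 : ℕ) : ℤ) - 1 = o by push_cast; ring, if_neg h.code]) hv (by
      rw [h7l, ← h8r]; congr 1; push_cast; ring)
  obtain ⟨b1, b2, b3, b4⟩ := H.child (c := o + 1 + l.code.length) (by omega) (by omega)
    (H.parent_right h) (u := 0) (x := l.inner) (by rw [H.last_left h, if_pos rfl]) hv (by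
      rw [← h8l]; congr 1; push_cast; ring)
  rw [h8l] at a3 a4
  rw [h8r] at b3 b4
  rw [h9, h13] at a1 b1
  rw [h9, h14] at a2 b2
  rw [h15] at a3 b3
  rw [h16] at a4 b4
  have hk : k ≤ o + 2 := by omega
  refine ⟨⟨h.left, ?_, ?_, ?_, ?_, ?_, by omega, by split_ifs <;> omega, by omega, by omega⟩,
    ⟨h.right, ?_, ?_, ?_, ?_, ?_, by split_ifs <;> omega, by omega, by omega, by omega⟩⟩
  · rw [a1, H.gv] <;> omega
  · rw [a2]
    rcases (by omega : v = 0 ∨ v = 1) with rfl | rfl <;> norm_num <;> rw [H.gv] <;> omega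
  · push_cast; omega
  · rw [a3]
    split_ifs with hc
    · rw [H.gv] <;> omega
    · rw [H.gv] <;> omega
  · rw [a4]
    split_ifs with hc
    · rw [H.gv] <;> omega
    · rw [H.gv] <;> omega
  · rw [b1]
    rcases (by omega : v = 0 ∨ v = 1) with rfl | rfl <;> norm_num <;> rw [H.gv] <;> omega
  · rw [b2, H.gv] <;> omega
  · push_cast; omega
  · rw [b3]
    split_ifs with hc
    · rw [H.gv] <;> omega
    · rw [H.gv] <;> omega
  · rw [b4]
    split_ifs with hc
    · rw [H.gv] <;> omega
    · rw [H.gv] <;> omega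

theorem Final.series_parts (H : Final T E F) {o : ℕ} {l r : SPTree} {s t k b d : ℕ}
    (hn : Node T E F o (series l r) s t k b d) :
    Node T E F (o + 1) l s k (k + 1) (b + 1 + offL l r) (d + stepL l r) ∧
    Node T E F (o + 1 + l.code.length) r k t (k + 1 + l.inner) (b + 1 + offR l r)
      (d + stepR l r) := by
  obtain ⟨h1, h2⟩ := H.comp_series hn.occurs
  simpa using H.parts hn h1 (v := 1) (by simp [h2]) le_rfl rfl

theorem Final.parallel_parts (H : Final T E F) {o : ℕ} {l r : SPTree} {s t k b d : ℕ}
    (hn : Node T E F o (parallel l r) s t k b d) :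
    Node T E F (o + 1) l s t k (b + offL l r) (d + stepL l r) ∧
    Node T E F (o + 1 + l.code.length) r s t (k + l.inner) (b + offR l r) (d + stepR l r) := by
  obtain ⟨h1, h2⟩ := H.comp_parallel hn.occurs
  simpa using H.parts hn h1 (v := 0) (by simp [h2]) zero_le_one rfl

/-! ### Edges, places and slots -/

/-- A pass that stores values at increasing addresses. -/
theorem Final.scatter (H : Final T E F) {a : ℕ} {i e : RExpr} (hp : [⟨a, i, e⟩] ∈ passes)
    (ha : a ≠ 0) {p : ℕ → Prop} [DecidablePred p] {f : ℤ → ℤ}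
    (hι : ∀ c < E.Q, ∀ m, E.gv (E.ev c (Function.update F a m) i) = if p c then f c else -1)
    (hf : ∀ c c' : ℕ, c < c' → c' < E.Q → p c → f c < f c') (hf0 : ∀ c : ℕ, c < E.Q → 0 ≤ f c) :
    (∀ c : ℕ, c < E.Q → p c → ∃ m : ℤ → ℤ, (∀ z, 0 ≤ z → (∀ c' : ℕ, c ≤ c' → c' < E.Q → z < f c') →
      m z = F a z) ∧ F a (f c) = E.gv (E.ev c (Function.update F a m) e)) ∧
    ∀ z, 0 ≤ z → (∀ c : ℕ, c < E.Q → z < f c) → F a z = 0 := by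
  obtain ⟨h1, h2⟩ := H.single hp ha _ hι
  refine ⟨fun c hc hpc => ?_, fun z hz hlt => h2 z fun c hc => ?_⟩
  · obtain ⟨m, h3, h4⟩ := h1 c hc
    refine ⟨m, fun z hz hlt => h3 z fun c' hcc hc' => ?_, ?_⟩
    · have := hlt c' hcc hc'
      split_ifs <;> omega
    · have h5 := h4 (fun c' hcc hc' => by
        have h6 := hf c c' hcc hc' hpc
        have h7 := hf0 c hc
        rw [if_pos hpc]
        split_ifs <;> omega)
      rwa [if_pos hpc] at h5
  · have := hlt c hc
    split_ifs <;> omega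

theorem Final.series_mono (H : Final T E F) {c d : ℕ} (h : c ≤ d) (hd : d ≤ E.Q) : F 9 c ≤ F 9 d :=
  mono_of_rec (p := fun c => F 0 c = 1) (fun c hc => (H.series_rec.2 c hc).2) c d h hd

theorem Final.leaves_mono (H : Final T E F) {c d : ℕ} (h : c ≤ d) (hd : d ≤ E.Q) :
    F 10 c ≤ F 10 d :=
  mono_of_rec (p := fun c => F 0 c = 0) (fun c hc => (H.leaves_rec.2 c hc).2) c d h hd

/-- The number of an edge is the number of leaves before it, which increases strictly from leaf to
leaf, so nothing is overwritten. Beyond the code array 0 contains `0` as well; these positions are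
excluded by the comparison with the length. -/
theorem Final.edge_scatter (H : Final T E F) {a : ℕ} {e : RExpr} (hp : [⟨a, edgeNo, e⟩] ∈ passes)
    (h0 : a ≠ 0) (h10 : a ≠ 10) {o : ℕ} (ho : o < T.code.length) (hc : F 0 o = 0) {x : ℤ}
    (hx : ∀ m, E.ev o (Function.update F a m) e = x) : F a (F 10 o) = E.gv x := by
  have hQ := H.hQ
  have hN := H.hN
  obtain ⟨m, -, h⟩ := (H.scatter hp h0 (p := fun c => F 0 c = 0 ∧ c < T.code.length) (f := F 10) (by
    intro c hc m
    have := (H.leaves_rec.2 c hc).1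
    simp only [edgeNo, cnt, Env.ev_minus, Env.ev_times, Env.ev_eq, Env.ev_get, Env.ev_reg_two,
      Env.ev_const, Env.ev_lt, Env.ev_reg_zero, Env.ev_plus, Function.update_of_ne h0.symm,
      Function.update_of_ne h10.symm, hN, Nat.cast_lt]
    by_cases h1 : F 0 c = 0 <;> by_cases h2 : c < T.code.length <;> simp only [h1, h2, if_true,
      if_false, and_true, and_false] <;> rw [H.gv] <;> omega) (by
    intro c c' hcc hc' hpc
    have h1 := (H.leaves_rec.2 c (by omega)).2
    rw [if_pos hpc.1] at h1
    have h2 := H.leaves_mono (c := c + 1) (d := c') (by omega) (by omega)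
    push_cast at h2
    omega) (fun c hc => (H.leaves_rec.2 c hc).1.1)).1 o (by omega) ⟨hc, ho⟩
  rw [h, hx]

/-- Vertices are numbered in preorder, so entries of smaller numbers are final when a vertex is
treated. The numbers 0 and 1 are never used as addresses and keep the entry 0. -/
theorem Final.vertex_scatter (H : Final T E F) {a : ℕ} {e : RExpr} (hp : [⟨a, vertexNo, e⟩] ∈ passes)
    (h0 : a ≠ 0) (h9 : a ≠ 9) :
    (∀ o : ℕ, o < E.Q → F 0 o = 1 → ∃ m : ℤ → ℤ, (∀ z, 0 ≤ z → z < F 9 o + 2 → m z = F a z) ∧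
      F a (F 9 o + 2) = E.gv (E.ev o (Function.update F a m) e)) ∧ F a 0 = 0 ∧ F a 1 = 0 := by
  have hQ := H.hQ
  obtain ⟨h1, h2⟩ := H.scatter hp h0 (p := fun c => F 0 c = 1) (f := fun z => F 9 z + 2) (by
    intro c hc m
    have := (H.series_rec.2 c hc).1
    simp only [vertexNo, cnt, Env.ev_minus, Env.ev_times, Env.ev_eq, Env.ev_get, Env.ev_reg_two,
      Env.ev_const, Env.ev_plus, Function.update_of_ne h0.symm,
      Function.update_of_ne h9.symm]
    by_cases h1 : F 0 c = 1 <;> simp only [h1, if_true, if_false] <;> rw [H.gv] <;> omega) (by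
    intro c c' hcc hc' hpc
    have h1 := (H.series_rec.2 c (by omega)).2
    rw [if_pos hpc] at h1
    have h2 := H.series_mono (c := c + 1) (d := c') (by omega) (by omega)
    push_cast at h2
    show F 9 c + 2 < F 9 c' + 2
    omega) (fun c hc => by
      have := (H.series_rec.2 c hc).1.1
      show 0 ≤ F 9 c + 2
      omega)
  have h3 : ∀ c : ℕ, c < E.Q → 0 ≤ F 9 c := fun c hc => (H.series_rec.2 c hc).1.1
  refine ⟨fun o ho hp => ?_, h2 0 le_rfl fun c hc => ?_, h2 1 zero_le_one fun c hc => ?_⟩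
  · obtain ⟨m, h4, h5⟩ := h1 o ho hp
    refine ⟨m, fun z hz hlt => h4 z hz fun c' hc hc' => ?_, h5⟩
    have := H.series_mono hc hc'.le
    show z < F 9 c' + 2
    omega
  · have := h3 c hc
    show 0 < F 9 c + 2
    omega
  · have := h3 c hc
    show 1 < F 9 c + 2
    omega

/-- The place of a vertex. -/
def place (F : Mem) (v : ℕ) : ℕ := (F 19 v + if v = 1 then 1 else 0).toNat

/-- The slot of a vertex. -/
def slot (F : Mem) (v : ℕ) : ℕ := (F 20 v + if v = 1 then 1 else 0).toNat

theorem Final.vertex_eq (H : Final T E F) {o : ℕ} {l r : SPTree} {s t k b d : ℕ}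
    (hn : Node T E F o (series l r) s t k b d) (hs : 0 ≤ F 20 s) (ht : 0 ≤ F 20 t) :
    F 19 k = b ∧ F 20 k = pick d (slot F s) (slot F t) := by
  have hQ := H.hQ
  have hle := hn.occurs.le
  simp only [SPTree.code, List.length_cons, List.length_append] at hle
  have h1 := (H.comp_series hn.occurs).2
  have hk := hn.first
  have hb := hn.base_le; have hd := hn.depth_le; have hs' := hn.source_lt; have ht' := hn.sink_lt
  obtain ⟨m, -, h2⟩ := (H.vertex_scatter (show posPass ∈ passes by simp [passes]) (by norm_num)
    (by norm_num)).1 o (by omega) h1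
  obtain ⟨m', h3, h4⟩ := (H.vertex_scatter (show slotPass ∈ passes by simp [passes]) (by norm_num)
    (by norm_num)).1 o (by omega) h1
  rw [hk] at h2 h4
  constructor
  · rw [h2]
    simp only [cnt, Env.ev_get, Env.ev_reg_two,
      Function.update_of_ne (show (15 : ℕ) ≠ 19 by norm_num), hn.base]
    exact H.gv (by omega) (by omega)
  · rw [h4]
    have h5 : m' s = F 20 s := h3 _ (by omega) (by omega)
    have h6 : m' t = F 20 t := h3 _ (by omega) (by omega)
    have h7 : F 20 s + (if (s : ℤ) = 1 then 1 else 0) = slot F s := by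
      unfold slot
      rw [Int.toNat_of_nonneg]
      · simp
      · split_ifs <;> omega
    have h8 : F 20 t + (if (t : ℤ) = 1 then 1 else 0) = slot F t := by
      unfold slot
      rw [Int.toNat_of_nonneg]
      · simp
      · split_ifs <;> omega
    simp only [cnt, pool, isFree, slotOf, Env.ev_get, Env.ev_reg_two, Env.ev_ite, Env.ev_times,
      Env.ev_plus, Env.ev_const, Env.ev_eq, Env.ev_nz, Env.ev_minus, Function.update_self,
      Function.update_of_ne (show (13 : ℕ) ≠ 20 by norm_num),
      Function.update_of_ne (show (14 : ℕ) ≠ 20 by norm_num),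
      Function.update_of_ne (show (16 : ℕ) ≠ 20 by norm_num), hn.source, hn.sink, hn.depth, h5, h6,
      h7, h8]
    generalize slot F s = x
    generalize slot F t = y
    have e2 : (3 : ℤ) * d = ((3 * d : ℕ) : ℤ) := by push_cast; ring
    have e3 : ((3 * d : ℕ) : ℤ) + 1 = ((3 * d + 1 : ℕ) : ℤ) := by push_cast; ring
    have e4 : ((3 * d : ℕ) : ℤ) + 2 = ((3 * d + 2 : ℕ) : ℤ) := by push_cast; ring
    rw [e2, e3, e4]
    unfold pick
    split_ifs <;> first | omega | (simp; rw [H.gv] <;> omega)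

theorem Final.edge_eq (H : Final T E F) {o s t k b d : ℕ} (hn : Node T E F o edge s t k b d) :
    F 17 (F 10 o) = s ∧ F 18 (F 10 o) = t := by
  have hQ := H.hQ
  have hle := hn.occurs.le
  simp only [SPTree.code, List.length_singleton] at hle
  have h1 : F 0 o = 0 := by rw [H.code, hn.occurs.edge]
  have h2 := (H.series_rec.2 o (by omega)).1
  have h3 := hn.first; have h4 := hn.source_lt; have h5 := hn.sink_lt
  constructor
  · rw [H.edge_scatter (show edgeSrcPass ∈ passes by simp [passes]) (by norm_num) (by norm_num)
      (by omega) h1 (x := s) (fun m => by simp [hn.source]), H.gv] <;> omega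
  · rw [H.edge_scatter (show edgeTgtPass ∈ passes by simp [passes]) (by norm_num) (by norm_num)
      (by omega) h1 (x := t) (fun m => by simp [hn.sink]), H.gv] <;> omega

/-- `Node` is the invariant of the descent. In the series case the slots of both terminals are
stored before that of the new vertex is chosen, which is why their entries are required to be
nonnegative and not to be known. -/
theorem Final.tree (H : Final T E F) (S : SPTree) : ∀ {o s t k b d : ℕ},
    Node T E F o S s t k b d → 2 ≤ k → 0 ≤ F 20 s → 0 ≤ F 20 t →
    S.Cons (place F) (slot F) s t k b d ∧ ∀ i : ℕ, i < S.leaves →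
      F 17 (F 10 o + i) = ((S.edgesFrom s t k).getD i (0, 0)).1 ∧
      F 18 (F 10 o + i) = ((S.edgesFrom s t k).getD i (0, 0)).2 := by
  -- The leaves of the right part are numbered directly after those of the left part, in accordance
  -- with the concatenation in `edgesFrom`.
  have join : ∀ {l r : SPTree} {o : ℕ} (p q : List (ℕ × ℕ)), Comp T F o l r → F 0 o ≠ 0 →
      p.length = l.leaves → (∀ i : ℕ, i < l.leaves →
        F 17 (F 10 (o + 1 : ℕ) + i) = (p.getD i (0, 0)).1 ∧
        F 18 (F 10 (o + 1 : ℕ) + i) = (p.getD i (0, 0)).2) → (∀ i : ℕ, i < r.leaves →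
        F 17 (F 10 (o + 1 + l.code.length : ℕ) + i) = (q.getD i (0, 0)).1 ∧
        F 18 (F 10 (o + 1 + l.code.length : ℕ) + i) = (q.getD i (0, 0)).2) →
      ∀ i : ℕ, i < l.leaves + r.leaves →
        F 17 (F 10 o + i) = ((p ++ q).getD i (0, 0)).1 ∧
        F 18 (F 10 o + i) = ((p ++ q).getD i (0, 0)).2 := by
    intro l r o p q hc h0 hlen hp hq i hi
    have hQ := H.hQ
    have hle := hc.left.le
    have h1 := (H.leaves_rec.2 o (by omega)).2
    have h2 := (H.count_eq l _ hc.left).2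
    rw [if_neg h0] at h1
    push_cast at h2 hp hq
    rcases Nat.lt_or_ge i l.leaves with h | h
    · have h3 := hp i h
      rw [h1, add_zero] at h3
      rwa [List.getD_append _ _ _ _ (by omega)]
    · have h3 := hq (i - l.leaves) (by omega)
      rw [h2, h1, show F 10 (o : ℤ) + 0 + (l.leaves : ℤ) + ((i - l.leaves : ℕ) : ℤ) = F 10 o + i by
        rw [Nat.cast_sub h]; ring] at h3
      rwa [List.getD_append_right _ _ _ _ (by omega), hlen]
  induction S with
  | edge =>
    intro o s t k b d hn _ _ _
    refine ⟨trivial, fun i hi => ?_⟩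
    obtain rfl : i = 0 := by simpa [leaves] using hi
    simpa [edgesFrom] using H.edge_eq hn
  | series l r ihl ihr =>
    intro o s t k b d hn hk hs ht
    obtain ⟨h1, h2⟩ := H.vertex_eq hn hs ht
    obtain ⟨h3, h4⟩ := H.series_parts hn
    have h5 : 0 ≤ F 20 k := by rw [h2]; omega
    obtain ⟨h6, h7⟩ := ihl h3 (by omega) hs h5
    obtain ⟨h8, h9⟩ := ihr h4 (by omega) h5 ht
    refine ⟨⟨?_, ?_, h6, h8⟩, ?_⟩
    · unfold place; rw [h1, if_neg (by omega)]; omega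
    · conv_lhs => unfold slot
      rw [h2, if_neg (by omega)]; omega
    · have hc := H.comp_series hn.occurs
      exact join _ _ hc.1 hc.1.code (edgesFrom_length _ _ _ _) h7 h9
  | parallel l r ihl ihr =>
    intro o s t k b d hn hk hs ht
    obtain ⟨h3, h4⟩ := H.parallel_parts hn
    obtain ⟨h6, h7⟩ := ihl h3 (by omega) hs ht
    obtain ⟨h8, h9⟩ := ihr h4 (by omega) hs ht
    have hc := H.comp_parallel hn.occurs
    exact ⟨⟨h6, h8⟩, join _ _ hc.1 hc.1.code (edgesFrom_length _ _ _ _) h7 h9⟩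

theorem Final.vertex_zero (H : Final T E F) :
    (F 19 0 = 0 ∧ F 19 1 = 0) ∧ F 20 0 = 0 ∧ F 20 1 = 0 :=
  ⟨(H.vertex_scatter (show posPass ∈ passes by simp [passes]) (by norm_num) (by norm_num)).2,
   (H.vertex_scatter (show slotPass ∈ passes by simp [passes]) (by norm_num) (by norm_num)).2⟩

theorem Final.placed (H : Final T E F) : T.Placed (place F) (slot F) := by
  obtain ⟨⟨h1, h2⟩, h3, h4⟩ := H.vertex_zero
  refine ⟨?_, ?_, ?_, ?_, (H.tree T H.root le_rfl ?_ ?_).1⟩ <;> simp [place, slot, h1, h2, h3, h4]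

end Draw

namespace Draw

open SPTree

variable {T : SPTree} {E : Env} {F : Mem}

/-! ### Numbers of vertices and edges -/

theorem graph_m (T : SPTree) : T.graph.m = T.leaves := edgesFrom_length T 0 1 2

theorem Final.numE_eq (H : Final T E F) : F 10 E.N = T.graph.m := by
  have h := (H.count_eq T 0 (at_zero T)).2
  have h0 := H.leaves_rec.1
  rw [H.hN, graph_m]
  simpa [h0] using h

theorem Final.numV_eq (H : Final T E F) : F 9 E.N + 2 = T.graph.n := by
  have h := (H.count_eq T 0 (at_zero T)).1
  have h0 := H.series_rec.1
  rw [H.hN]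
  simp only [Nat.cast_zero, zero_add, h0] at h
  rw [h]
  simp [SPTree.graph, numNodes]

theorem Final.n_le (H : Final T E F) : T.graph.n + 2 ≤ E.Q := by
  have h1 := H.hQ; have h2 := T.inner_lt; have h3 := T.code_length
  have h4 : T.graph.n = T.inner + 2 := rfl
  omega

theorem Final.m_le (H : Final T E F) : T.graph.m + 2 ≤ E.Q := by
  have h1 := H.hQ; have h3 := T.code_length; have h4 := graph_m T; have := T.leaves_pos
  omega

theorem Final.ends_eq (H : Final T E F) (e : Fin T.graph.m) :
    F 17 (e : ℕ) = (T.graph.src e : ℕ) ∧ F 18 (e : ℕ) = (T.graph.tgt e : ℕ) := by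
  obtain ⟨⟨h1, h2⟩, h3, h4⟩ := H.vertex_zero
  have h := (H.tree T H.root le_rfl (by simp [h3]) (by simp [h4])).2 e (by
    rw [← graph_m]; exact e.2)
  rw [Nat.cast_zero, H.leaves_rec.1, zero_add] at h
  have he : (T.edgesFrom 0 1 2).getD e (0, 0) = T.edges.get e :=
    List.getD_eq_getElem _ _ e.2
  rw [he] at h
  exact h

/-! ### Indices and degrees -/

/-- The number of edges before `c` whose value is `z`. -/
def countBefore {m : ℕ} (g : Fin m → ℕ) (c : ℕ) (z : ℤ) : ℕ :=
  (Finset.univ.filter fun f : Fin m => (f : ℕ) < c ∧ (g f : ℤ) = z).card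

theorem countBefore_zero {m : ℕ} (g : Fin m → ℕ) (z : ℤ) : countBefore g 0 z = 0 := by
  simp [countBefore]

theorem countBefore_le {m : ℕ} (g : Fin m → ℕ) (c : ℕ) (z : ℤ) : countBefore g c z ≤ m := by
  unfold countBefore
  exact (Finset.card_le_univ _).trans (by simp)

theorem countBefore_succ {m : ℕ} (g : Fin m → ℕ) (e : Fin m) (z : ℤ) :
    countBefore g (e + 1) z = countBefore g e z + if (g e : ℤ) = z then 1 else 0 := by
  unfold countBefore
  split_ifs with h
  · rw [← Finset.card_insert_of_notMem (s := Finset.univ.filter fun f : Fin m =>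
      (f : ℕ) < e ∧ (g f : ℤ) = z) (a := e) (by simp)]
    congr 1
    ext f
    simp only [Finset.mem_filter, Finset.mem_univ, true_and, Finset.mem_insert, Fin.ext_iff]
    constructor
    · rintro ⟨h1, h2⟩
      by_cases hf : (f : ℕ) = e
      · exact Or.inl hf
      · exact Or.inr ⟨by omega, h2⟩
    · rintro (h1 | ⟨h1, h2⟩)
      · obtain rfl := Fin.ext h1
        exact ⟨by omega, h⟩
      · exact ⟨by omega, h2⟩
  · rw [add_zero]
    congr 1
    ext f
    simp only [Finset.mem_filter, Finset.mem_univ, true_and]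
    constructor
    · rintro ⟨h1, h2⟩
      refine ⟨?_, h2⟩
      by_contra hf
      obtain rfl : f = e := Fin.ext (by omega)
      exact h h2
    · rintro ⟨h1, h2⟩
      exact ⟨by omega, h2⟩

/-- While the counter runs through the edges, the array `deg` contains the counts so far (`hdeg`).
After that it does not change at nonnegative addresses (`hdeg'`). An entry of `idx` is final once
the counter has passed it (`hidx`). -/
theorem Final.count (H : Final T E F) {v idx deg : ℕ} (hp : countPass v idx deg ∈ passes)
    (hd : deg ≠ 0) (hid : idx ≠ deg) (hvi : v ≠ idx) (hvd : v ≠ deg)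
    (hi9 : 10 ≠ idx) (hd9 : 10 ≠ deg) (g : Fin T.graph.m → ℕ) (hg : ∀ e : Fin T.graph.m, F v (e : ℕ) = g e)
    (hgQ : ∀ e, g e ≤ E.Q) :
    (∀ e : Fin T.graph.m, F idx (e : ℕ) = countBefore g e (g e)) ∧
    ∀ z : ℤ, 0 ≤ z → F deg z = countBefore g T.graph.m z := by
  obtain ⟨m₀, h0, h⟩ := H.trace
  obtain ⟨Ms, h1, h2, h3⟩ := h _ hp
  have hw : (countPass v idx deg).writes = [idx, deg] := rfl
  rw [hw] at h1 h2
  have hmQ := H.m_le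
  have hE := H.numE_eq
  have hv : ∀ c, Ms c v = F v := fun c => h1 c v (by simp [hvi, hvd])
  have h10 : ∀ c, Ms c 10 = F 10 := fun c => h1 c 10 (by simp [hi9, hd9])
  have hgv : ∀ c : ℕ, c < E.Q → E.gv (c : ℤ) = c := fun c hc => H.gv (by omega) (by omega)
  have hI : ∀ c < E.Q, Ms (c + 1) idx = Function.update (Ms c idx) c
      (E.gv (Ms c deg (F v c))) := by
    intro c hc
    rw [h3 c hc]
    simp only [Env.bodySem, countPass, List.foldl_cons, List.foldl_nil, Env.stoSem,
      Function.update_of_ne hid, Function.update_self, cnt, Env.ev_reg_two, Env.ev_get, hv,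
      hgv c hc]
  have hD : ∀ c < E.Q, Ms (c + 1) deg = Function.update (Ms c deg)
      (E.gv ((if (c : ℤ) < T.graph.m then 1 else 0) * (F v c + 1) - 1))
      (E.gv (Ms c deg (F v c) + 1)) := by
    intro c hc
    rw [h3 c hc]
    simp only [Env.bodySem, countPass, List.foldl_cons, List.foldl_nil, Env.stoSem, ifEdge, numE,
      Function.update_of_ne hid.symm, Function.update_of_ne hvi, Function.update_of_ne hi9,
      Function.update_self, cnt, Env.ev_reg_two, Env.ev_reg_zero, Env.ev_get, Env.ev_minus,
      Env.ev_plus, Env.ev_times, Env.ev_lt, Env.ev_const, hv, h10, hE]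
  have hdeg : ∀ c ≤ T.graph.m, ∀ z : ℤ, 0 ≤ z → Ms c deg z = countBefore g c z := by
    intro c
    induction c with
    | zero =>
      intro _ z _
      rw [(h2 deg (by simp)).1, h0 deg hd, countBefore_zero]; rfl
    | succ c ih =>
      intro hc z hz
      have ih := ih (by omega)
      have hg' := hg ⟨c, hc⟩
      have hgQ' := hgQ ⟨c, hc⟩
      have hs := countBefore_succ g ⟨c, hc⟩ z
      simp only at hg' hs
      rw [hD c (by omega), if_pos (by exact_mod_cast hc), hg', one_mul, add_sub_cancel_right,
        H.gv (by omega) (by omega), ih _ (by omega), hs]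
      have := countBefore_le g c (g ⟨c, hc⟩)
      rw [H.gv (by omega) (by omega)]
      by_cases hz' : (g ⟨c, hc⟩ : ℤ) = z
      · subst hz'; simp
      · rw [Function.update_of_ne (Ne.symm hz'), ih z hz]; simp [hz']
  have hdeg' : ∀ k c, c + k = E.Q → T.graph.m ≤ c → ∀ z : ℤ, 0 ≤ z → Ms c deg z = F deg z := by
    intro k
    induction k with
    | zero =>
      intro c hc _ z _
      obtain rfl : c = E.Q := by omega
      rw [(h2 deg (by simp)).2]
    | succ k ih =>
      intro c hc hm z hz
      rw [← ih (c + 1) (by omega) (by omega) z hz, hD c (by omega),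
        if_neg (by exact_mod_cast not_lt.2 hm), zero_mul, H.gv (by omega) (by omega),
        Function.update_of_ne (by omega)]
  have hidx : ∀ k c, c + k = E.Q → ∀ z : ℤ, z < c → Ms c idx z = F idx z := by
    intro k
    induction k with
    | zero =>
      intro c hc z _
      obtain rfl : c = E.Q := by omega
      rw [(h2 idx (by simp)).2]
    | succ k ih =>
      intro c hc z hz
      rw [← ih (c + 1) (by omega) z (by push_cast; omega), hI c (by omega),
        Function.update_of_ne (by omega)]
  refine ⟨fun e => ?_, fun z hz => ?_⟩
  · have he := e.2
    have := countBefore_le g e (g e)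
    rw [← hidx (E.Q - (e + 1)) (e + 1) (by omega) e (by push_cast; omega), hI e (by omega),
      Function.update_self, hg, hdeg e (by omega) _ (by omega), H.gv] <;> omega
  · rw [← hdeg' (E.Q - T.graph.m) T.graph.m (by omega) le_rfl z hz, hdeg _ le_rfl z hz]

theorem Final.out_eq (H : Final T E F) :
    (∀ e : Fin T.graph.m, F 21 (e : ℕ) = T.graph.outIdx e) ∧
    ∀ v : Fin T.graph.n, F 22 (v : ℕ) = T.graph.outDegree v := by
  have hn := H.n_le
  obtain ⟨h1, h2⟩ := H.count (show countPass 17 21 22 ∈ passes by simp [passes])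
    (by norm_num) (by norm_num) (by norm_num) (by norm_num) (by norm_num) (by norm_num)
    (fun e => (T.graph.src e : ℕ)) (fun e => (H.ends_eq e).1) (fun e => by
      have := (T.graph.src e).2; omega)
  refine ⟨fun e => ?_, fun v => ?_⟩
  · rw [h1, countBefore, MDigraph.outIdx]
    congr 2; ext f; simp [Fin.ext_iff]
  · rw [h2 _ (by omega), countBefore, MDigraph.outDegree]
    congr 2; ext f; simp [Fin.ext_iff]

theorem Final.in_eq (H : Final T E F) :
    (∀ e : Fin T.graph.m, F 23 (e : ℕ) = T.graph.inIdx e) ∧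
    ∀ v : Fin T.graph.n, F 24 (v : ℕ) = T.graph.inDegree v := by
  have hn := H.n_le
  obtain ⟨h1, h2⟩ := H.count (show countPass 18 23 24 ∈ passes by simp [passes])
    (by norm_num) (by norm_num) (by norm_num) (by norm_num) (by norm_num) (by norm_num)
    (fun e => (T.graph.tgt e : ℕ)) (fun e => (H.ends_eq e).2) (fun e => by
      have := (T.graph.tgt e).2; omega)
  refine ⟨fun e => ?_, fun v => ?_⟩
  · rw [h1, countBefore, MDigraph.inIdx]
    congr 2; ext f; simp [Fin.ext_iff]
  · rw [h2 _ (by omega), countBefore, MDigraph.inDegree]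
    congr 2; ext f; simp [Fin.ext_iff]

/-! ### The layout -/

/-- Depths are products of a number of tracks and a number of rows, so they are quadratic in the
length of the input. The bound in register 4 is quadratic for their sake. -/
theorem Final.gv_sq (H : Final T E F) {x : ℤ} (h1 : -(10000 * ((E.Q : ℤ) * E.Q)) ≤ x)
    (h2 : x ≤ 10000 * ((E.Q : ℤ) * E.Q)) : E.gv x = x :=
  E.gv_of_le (by rw [H.hM]; exact abs_le.2 ⟨h1, h2⟩)

theorem Final.log_eq (H : Final T E F) (c : ℕ) : c < E.Q → F 25 c = Nat.log 2 c := by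
  induction c using Nat.strong_induction_on with
  | _ c ih =>
    intro hc
    obtain ⟨m, h1, h2⟩ := H.forward (show logPass ∈ passes by simp [passes]) (by norm_num) c hc
    have key : E.ev c (Function.update F 25 m) (RExpr.times (RExpr.lt (RExpr.const 1) cnt)
        (RExpr.plus (RExpr.get 25 (RExpr.quot cnt (RExpr.const 2))) (RExpr.const 1))) =
        (if (1 : ℤ) < c then 1 else 0) * (m (c / 2) + 1) := by
      simp only [Env.ev_times, Env.ev_lt]; rfl
    rw [h2, key]
    rcases Nat.lt_or_ge 1 c with h | h
    · have h3 := ih (c / 2) (by omega) (by omega)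
      have h4 : Nat.log 2 c = Nat.log 2 (c / 2) + 1 := Nat.log_of_one_lt_of_le (by norm_num) h
      have h5 := Nat.log_le_self 2 (c / 2)
      push_cast at h3
      rw [if_pos (by omega), h1 _ (by omega), h3, one_mul, h4, H.gv (by omega) (by omega)]
      push_cast; rfl
    · rw [if_neg (by omega), zero_mul, H.gv (by omega) (by omega)]
      interval_cases c <;> simp

/-- A pass that always stores at the address `0`. -/
theorem Final.const (H : Final T E F) {a : ℕ} {e : RExpr} (hp : [⟨a, RExpr.const 0, e⟩] ∈ passes)
    (ha : a ≠ 0) {x : ℤ} (hx : ∀ c m, E.ev c (Function.update F a m) e = x) :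
    F a 0 = E.gv x := by
  have hQ := H.hQ
  obtain ⟨m, -, h⟩ := (H.single hp ha (fun _ => 0) (fun c _ m => by
    rw [Env.ev_const]; exact H.gv (by omega) (by omega))).1 (E.Q - 1) (by omega)
  rw [h fun c' h h' => by omega, hx]

/-- The arrays agree with a layout. -/
structure Matches (T : SPTree) (E : Env) (F : Mem) (Λ : Layout T.graph) : Prop where
  final : Final T E F
  pos_lt : ∀ v, Λ.pos v < T.graph.n
  W_le : Λ.W ≤ 200 * E.Q
  L_le : Λ.L ≤ 9 * E.Q
  W_eq : F 26 0 = Λ.W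
  L_eq : F 27 0 = Λ.L
  pos_eq : ∀ v : Fin T.graph.n, F 28 (v : ℕ) = Λ.pos v
  src_port : ∀ e : Fin T.graph.m, F 31 (e : ℕ) = Λ.port e false
  tgt_port : ∀ e : Fin T.graph.m, F 32 (e : ℕ) = Λ.port e true
  early : ∀ e : Fin T.graph.m, F 33 (e : ℕ) =
    if Λ.pos (T.graph.src e) < Λ.pos (T.graph.tgt e) then 1 else 0
  track_eq : ∀ e : Fin T.graph.m, F 35 (e : ℕ) = Λ.track e

theorem Final.place_eq (H : Final T E F) (v : Fin T.graph.n) :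
    F 19 (v : ℕ) + (if ((v : ℕ) : ℤ) = 1 then 1 else 0) = place F v ∧
    F 20 (v : ℕ) + (if ((v : ℕ) : ℤ) = 1 then 1 else 0) = slot F v := by
  obtain ⟨⟨h1, h2⟩, h3, h4⟩ := H.vertex_zero
  have hp := H.placed
  obtain ⟨v, hv⟩ := v
  have hv' : v < T.inner + 2 := hv
  simp only
  rcases Nat.lt_or_ge v 2 with h | h
  · interval_cases v
    · have e1 := hp.pos_source; have e2 := hp.sg_source
      rw [e1, e2]; simp [h1, h3]
    · have e1 := hp.pos_sink; have e2 := hp.sg_sink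
      rw [e1, e2]; simp [h2, h4]
  · have e1 := hp.cons.pos_mem v h (by omega)
    have e2 := hp.cons.le_sg v h (by omega)
    unfold place slot at *
    rw [if_neg (by omega)] at *
    omega

/-- This joins the program to the geometry: places, tracks and ports in memory are those of
`layout`. The passes that follow evaluate the definitions made for layouts. -/
theorem Final.matches (H : Final T E F) (h3 : T.graph.DegreeThree) {A : ℕ} (hA : E.A = A)
    (hW : 0 < 200 * min A T.numNodes) :
    Matches T E F (T.layout h3 H.placed (200 * min A T.numNodes) hW) := by
  have hn := H.n_le
  have hm := H.m_le
  have hnn : T.graph.n = T.numNodes := rfl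
  have hlog := Nat.log_le_self 2 T.numNodes
  have hV := H.numV_eq
  have hpos : ∀ v : Fin T.graph.n, F 28 (v : ℕ) = place F v := by
    intro v
    have hv := v.2
    have hp := H.placed.pos_lt v.2
    rw [H.fill (show placePass ∈ passes by simp [passes]) (by norm_num) (by omega)
      (x := place F v) (fun m => by simpa using (H.place_eq v).1), H.gv] <;> omega
  have hslot : ∀ v : Fin T.graph.n, F 34 (v : ℕ) = slot F v := by
    intro v
    have hv := v.2
    have hp := H.placed.sg_lt v.2
    rw [H.fill (show slotsPass ∈ passes by simp [passes]) (by norm_num) (by omega)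
      (x := slot F v) (fun m => by simpa using (H.place_eq v).2), H.gv] <;> omega
  have hs := fun e => (H.ends_eq e).1
  have ht := fun e => (H.ends_eq e).2
  have hps : ∀ e : Fin T.graph.m, F 31 (e : ℕ) = T.graph.port e false := by
    intro e
    have he := e.2
    have := MDigraph.port_lt h3 e false
    have hv : T.graph.vt e false = T.graph.src e := rfl
    rw [H.fill (show portSrcPass ∈ passes by simp [passes]) (by norm_num) (by omega)
      (x := T.graph.port e false) (fun m => by
        simp only [MDigraph.port, hv, MDigraph.IsJunction]
        simp [hs, H.out_eq.1, H.out_eq.2, H.in_eq.2]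
        split_ifs <;> simp), H.gv] <;> omega
  have hpt : ∀ e : Fin T.graph.m, F 32 (e : ℕ) = T.graph.port e true := by
    intro e
    have he := e.2
    have := MDigraph.port_lt h3 e true
    have hv : T.graph.vt e true = T.graph.tgt e := rfl
    rw [H.fill (show portTgtPass ∈ passes by simp [passes]) (by norm_num) (by omega)
      (x := T.graph.port e true) (fun m => by
        simp only [MDigraph.port, hv, MDigraph.IsJunction]
        simp [ht, H.in_eq.1, H.out_eq.2, H.in_eq.2]
        split_ifs <;> simp), H.gv] <;> omega
  have hearly : ∀ e : Fin T.graph.m, F 33 (e : ℕ) =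
      if place F (T.graph.src e) < place F (T.graph.tgt e) then 1 else 0 := by
    intro e
    have he := e.2
    rw [H.fill (show earlyPass ∈ passes by simp [passes]) (by norm_num) (by omega)
      (x := if place F (T.graph.src e) < place F (T.graph.tgt e) then 1 else 0) (fun m => by
        simp [hs, ht, hpos]), H.gv] <;> split_ifs <;> omega
  refine ⟨H, fun v => H.placed.pos_lt v.2, ?_, ?_, ?_, ?_, hpos, hps, hpt, hearly, fun e => ?_⟩
  · show 200 * min A T.numNodes ≤ _
    omega
  · show 3 * (3 * (Nat.log 2 T.numNodes + 2)) ≤ _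
    omega
  · show _ = ((200 * min A T.numNodes : ℕ) : ℤ)
    rw [H.const (show rowLenPass ∈ passes by simp [passes]) (by norm_num)
      (x := ((200 * min A T.numNodes : ℕ) : ℤ)) (fun c m => by
        simp [hV, hA, hnn]
        split_ifs with h
        · rw [min_eq_right (by exact_mod_cast h.le)]; simp
        · rw [min_eq_left (by exact_mod_cast not_lt.1 h)]; simp), H.gv] <;> omega
  · show _ = ((3 * (3 * (Nat.log 2 T.numNodes + 2)) : ℕ) : ℤ)
    rw [H.const (show tracksPass ∈ passes by simp [passes]) (by norm_num)
      (x := ((3 * (3 * (Nat.log 2 T.numNodes + 2)) : ℕ) : ℤ)) (fun c m => by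
        have := H.log_eq T.graph.n (by omega)
        rw [hnn] at this
        simp [hV, this, hnn]
        ring), H.gv] <;> omega
  · show _ = ((3 * slot F (T.graph.vt e (MDigraph.earlyEnd (fun v => place F v) e)) +
      T.graph.port e (MDigraph.earlyEnd (fun v => place F v) e) : ℕ) : ℤ)
    have he := e.2
    have h4 := H.placed.sg_lt (T.graph.vt e (MDigraph.earlyEnd (fun v => place F v) e)).2
    have h5 := MDigraph.port_lt h3 e (MDigraph.earlyEnd (fun v => place F v) e)
    rw [H.fill (show trackPass ∈ passes by simp [passes]) (by norm_num) (by omega)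
      (x := ((3 * slot F (T.graph.vt e (MDigraph.earlyEnd (fun v => place F v) e)) +
        T.graph.port e (MDigraph.earlyEnd (fun v => place F v) e) : ℕ) : ℤ)) (fun m => by
        simp only [MDigraph.earlyEnd]
        simp [hs, ht, hslot, hps, hpt, hearly]
        split_ifs with h
        · simp [not_le.2 h, MDigraph.vt]
        · simp [not_lt.1 h, MDigraph.vt]), H.gv] <;> omega

end Draw

namespace Draw

open SPTree
open scoped Classical

variable {T : SPTree} {E : Env} {F : Mem} {Λ : Layout T.graph}

/-! ### Lanes -/

/-- A pass of the form `a[c] := e`, where `e` does not read `a` and has a value that need not be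
cut off. -/
theorem Final.set (H : Final T E F) {a : ℕ} {e : RExpr} (hp : [⟨a, cnt, e⟩] ∈ passes)
    (ha : a ≠ 0) {c : ℕ} (hc : c < E.Q) {x : ℤ}
    (hx : ∀ m, E.ev c (Function.update F a m) e = x) (h1 : -(10000 * ((E.Q : ℤ) * E.Q)) ≤ x)
    (h2 : x ≤ 10000 * ((E.Q : ℤ) * E.Q)) : F a c = x := by
  rw [H.fill hp ha hc hx, H.gv_sq h1 h2]

namespace Matches

theorem n_le (M : Matches T E F Λ) : T.graph.n + 2 ≤ E.Q := M.final.n_le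

theorem m_le (M : Matches T E F Λ) : T.graph.m + 2 ≤ E.Q := M.final.m_le

theorem v_lt (M : Matches T E F Λ) (v : Fin T.graph.n) : (v : ℕ) < E.Q := by have := M.n_le; omega

theorem e_lt (M : Matches T E F Λ) (e : Fin T.graph.m) : (e : ℕ) < E.Q := by have := M.m_le; omega

theorem Q_le (M : Matches T E F Λ) : (E.Q : ℤ) ≤ E.Q * E.Q := by
  have := M.n_le
  nlinarith

theorem src_eq (M : Matches T E F Λ) (e : Fin T.graph.m) : F 17 (e : ℕ) = (T.graph.src e : ℕ) := (M.final.ends_eq e).1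

theorem tgt_eq (M : Matches T E F Λ) (e : Fin T.graph.m) : F 18 (e : ℕ) = (T.graph.tgt e : ℕ) := (M.final.ends_eq e).2

theorem row_le (M : Matches T E F Λ) (v : Fin T.graph.n) : Λ.row v < T.graph.n :=
  (Nat.div_le_self _ _).trans_lt (M.pos_lt v)

theorem row_eq (M : Matches T E F Λ) (v : Fin T.graph.n) : F 29 (v : ℕ) = Λ.row v := by
  have h1 := M.row_le v; have h2 := M.n_le; have h3 := M.Q_le
  refine M.final.set (show rowPass ∈ passes by simp [passes]) (by norm_num) (M.v_lt v)
    (fun m => ?_) ?_ ?_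
  · simp [M.pos_eq, M.W_eq, Layout.row]
  · omega
  · omega

theorem px_eq (M : Matches T E F Λ) (v : Fin T.graph.n) : F 30 (v : ℕ) = Λ.px v := by
  have h1 := M.pos_lt v; have h2 := M.n_le; have h3 := M.Q_le
  have h4 : Λ.idx v ≤ Λ.pos v := Nat.mod_le _ _
  have h5 : ((Λ.W * Λ.row v + Λ.idx v : ℕ) : ℤ) = Λ.pos v := by
    rw [show Λ.W * Λ.row v + Λ.idx v = Λ.pos v from Nat.div_add_mod _ _]
  push_cast at h5
  refine M.final.set (show colPass ∈ passes by simp [passes]) (by norm_num) (M.v_lt v)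
    (fun m => ?_) ?_ ?_
  · simp [M.pos_eq, M.W_eq, M.row_eq, Layout.px]
    linarith
  · unfold Layout.px; omega
  · unfold Layout.px; omega

theorem wrap_eq (M : Matches T E F Λ) (e : Fin T.graph.m) : F 36 (e : ℕ) = if Λ.wr e then 1 else 0 := by
  have h3 := M.Q_le; have h2 := M.n_le
  refine M.final.set (show wrapPass ∈ passes by simp [passes]) (by norm_num) (M.e_lt e)
    (fun m => ?_) (by split_ifs <;> omega) (by split_ifs <;> omega)
  by_cases h : Λ.row (T.graph.src e) = Λ.row (T.graph.tgt e) <;>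
    simp [M.src_eq, M.tgt_eq, M.row_eq, Layout.wr, sub_eq_zero, h]

theorem lane_bounds (M : Matches T E F Λ) (e : Fin T.graph.m) (b : Bool) :
    0 ≤ Λ.lane e b ∧ Λ.lane e b ≤ 100 * ((E.Q : ℤ) * E.Q) := by
  obtain ⟨h1, h2⟩ := Λ.lane_band e b
  have h3 := M.row_le (T.graph.vt e b); have h4 := M.n_le; have h5 := M.L_le
  have h6 : (Λ.row (T.graph.vt e b) : ℤ) + 1 ≤ E.Q := by omega
  have h7 : (Λ.L : ℤ) ≤ 9 * E.Q := by omega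
  have h8 : (Λ.L : ℤ) * (Λ.row (T.graph.vt e b) + 1) ≤ (9 * E.Q) * E.Q :=
    mul_le_mul h7 h6 (by positivity) (by positivity)
  have h9 : (0 : ℤ) ≤ (Λ.L : ℤ) * Λ.row (T.graph.vt e b) := by positivity
  constructor <;> nlinarith

theorem src_ne (Λ : Layout T.graph) (e : Fin T.graph.m) : Λ.pos (T.graph.src e) ≠ Λ.pos (T.graph.tgt e) := fun h =>
  Λ.ne e false (Λ.pos_inj h)

theorem late_false (Λ : Layout T.graph) (e : Fin T.graph.m) : Λ.late e false ↔
    Λ.wr e ∧ ¬ Λ.pos (T.graph.src e) < Λ.pos (T.graph.tgt e) := by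
  have := src_ne Λ e
  simp only [Layout.late, MDigraph.vt, Bool.not_false, if_true, Bool.false_eq_true, if_false]
  exact and_congr_right fun _ => by omega

theorem late_true (Λ : Layout T.graph) (e : Fin T.graph.m) : Λ.late e true ↔
    Λ.wr e ∧ Λ.pos (T.graph.src e) < Λ.pos (T.graph.tgt e) := Iff.rfl

theorem lane_src (M : Matches T E F Λ) (e : Fin T.graph.m) : F 37 (e : ℕ) = Λ.lane e false := by
  have h1 := M.lane_bounds e false; have h2 := M.n_le; have h3 := M.Q_le
  refine M.final.set (show laneSrcPass ∈ passes by simp [passes]) (by norm_num) (M.e_lt e)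
    (fun m => ?_) (by omega) (by omega)
  simp only [Layout.lane, late_false Λ e, MDigraph.vt]
  by_cases hw : Λ.wr e <;> by_cases hp : Λ.pos (T.graph.src e) < Λ.pos (T.graph.tgt e) <;>
    simp [M.src_eq, M.row_eq, M.L_eq, M.track_eq, M.wrap_eq, M.early, hw, hp]

theorem lane_tgt (M : Matches T E F Λ) (e : Fin T.graph.m) : F 38 (e : ℕ) = Λ.lane e true := by
  have h1 := M.lane_bounds e true; have h2 := M.n_le; have h3 := M.Q_le
  refine M.final.set (show laneTgtPass ∈ passes by simp [passes]) (by norm_num) (M.e_lt e)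
    (fun m => ?_) (by omega) (by omega)
  simp only [Layout.lane, late_true Λ e, MDigraph.vt]
  by_cases hw : Λ.wr e <;> by_cases hp : Λ.pos (T.graph.src e) < Λ.pos (T.graph.tgt e) <;>
    simp [M.tgt_eq, M.row_eq, M.L_eq, M.track_eq, M.wrap_eq, M.early, hw, hp]

/-! ### Values by vertex and port -/

/-- By `port_inj` no address is stored at twice, since edges with the same end at `b` have different
ports there. Addresses of free ports keep the initial value 0. -/
theorem by_port (M : Matches T E F Λ) {a : ℕ} {y x : RExpr} (b : Bool) (hp : [⟨a, ifEdge y, x⟩] ∈ passes) (ha : a ≠ 0)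
    (ha10 : 10 ≠ a) (hy : ∀ (e : Fin T.graph.m) m, E.ev (e : ℕ) (Function.update F a m) y =
      3 * (T.graph.vt e b : ℕ) + Λ.port e b) (val : Fin T.graph.m → ℤ)
    (hx : ∀ (e : Fin T.graph.m) m, E.ev (e : ℕ) (Function.update F a m) x = val e)
    (hval : ∀ e, -(10000 * ((E.Q : ℤ) * E.Q)) ≤ val e ∧ val e ≤ 10000 * ((E.Q : ℤ) * E.Q)) :
    (∀ e, F a (3 * (T.graph.vt e b : ℕ) + Λ.port e b) = val e) ∧
    ∀ (v : Fin T.graph.n) (k : ℕ), k < 3 → (∀ e, T.graph.vt e b = v → Λ.port e b ≠ k) →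
      F a (3 * (v : ℕ) + k) = 0 := by
  have hn := M.n_le; have hm := M.m_le
  have hE := M.final.numE_eq
  obtain ⟨h1, h2⟩ := M.final.single hp ha (fun c => if h : c < T.graph.m then
      3 * (T.graph.vt ⟨c, h⟩ b : ℕ) + Λ.port ⟨c, h⟩ b else -1) (by
    intro c hc m
    simp only [ifEdge, numE, cnt, Env.ev_minus, Env.ev_times, Env.ev_lt, Env.ev_reg_two, Env.ev_get,
      Env.ev_reg_zero, Env.ev_plus, Env.ev_const, Function.update_of_ne ha10, hE]
    by_cases h : c < T.graph.m
    · have h3 := hy ⟨c, h⟩ m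
      have h4 := (T.graph.vt ⟨c, h⟩ b).2
      have h5 := Λ.port_lt ⟨c, h⟩ b
      simp only at h3
      have h' : (c : ℤ) < T.graph.m := by exact_mod_cast h
      simp only [h, h', dif_pos, if_true, h3]
      rw [M.final.gv] <;> omega
    · have h' : ¬ (c : ℤ) < T.graph.m := by exact_mod_cast h
      simp only [h, h', dif_neg, if_false, not_false_eq_true]
      rw [M.final.gv] <;> omega)
  refine ⟨fun e => ?_, fun v k hk hv => h2 _ fun c hc => ?_⟩
  · obtain ⟨m, -, h3⟩ := h1 e (M.e_lt e)
    simp only [e.2, dif_pos, Fin.eta] at h3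
    rw [h3, hx, M.final.gv_sq (hval e).1 (hval e).2]
    intro c hc hcQ
    by_cases h : c < T.graph.m
    · simp only [h, dif_pos]
      intro h4
      have h5 := Λ.port_lt ⟨c, h⟩ b
      have h6 := Λ.port_lt e b
      have h7 := (Λ.port_inj ⟨c, h⟩ b e b (Fin.ext (by omega)) (by omega)).1
      have : c = (e : ℕ) := congrArg Fin.val h7
      omega
    · simp only [h, dif_neg, not_false_eq_true]
      omega
  · by_cases h : c < T.graph.m
    · simp only [h, dif_pos]
      intro h4
      have h5 := Λ.port_lt ⟨c, h⟩ b
      exact hv ⟨c, h⟩ (Fin.ext (by omega)) (by omega)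
    · simp only [h, dif_neg, not_false_eq_true]
      omega

/-- The combination of two arrays that contain the values of the sources and of the targets. -/
theorem at_port {f g : ℤ → ℤ} {val : Fin T.graph.m → Bool → ℤ}
    (hf : (∀ e, f (3 * (T.graph.vt e false : ℕ) + Λ.port e false) = val e false) ∧
      ∀ (v : Fin T.graph.n) (k : ℕ), k < 3 → (∀ e, T.graph.vt e false = v → Λ.port e false ≠ k) →
        f (3 * (v : ℕ) + k) = 0)
    (hg : (∀ e, g (3 * (T.graph.vt e true : ℕ) + Λ.port e true) = val e true) ∧
      ∀ (v : Fin T.graph.n) (k : ℕ), k < 3 → (∀ e, T.graph.vt e true = v → Λ.port e true ≠ k) →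
        g (3 * (v : ℕ) + k) = 0) :
    (∀ e b, f (3 * (T.graph.vt e b : ℕ) + Λ.port e b) + g (3 * (T.graph.vt e b : ℕ) + Λ.port e b) =
      val e b) ∧
    ∀ (v : Fin T.graph.n) (k : ℕ), k < 3 → (∀ e b, T.graph.vt e b = v → Λ.port e b ≠ k) →
      f (3 * (v : ℕ) + k) + g (3 * (v : ℕ) + k) = 0 := by
  refine ⟨fun e b => ?_, fun v k hk h => ?_⟩
  · cases b
    · rw [hf.1, hg.2 _ _ (Λ.port_lt e false) fun e' hv hq => ?_, add_zero]
      exact absurd (Λ.port_inj _ _ _ _ hv hq).2 (by simp)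
    · rw [hg.1, hf.2 _ _ (Λ.port_lt e true) fun e' hv hq => ?_, zero_add]
      exact absurd (Λ.port_inj _ _ _ _ hv hq).2 (by simp)
  · rw [hf.2 v k hk fun e => h e false, hg.2 v k hk fun e => h e true, add_zero]

theorem lane_at (M : Matches T E F Λ) : (∀ e b, F 39 (3 * (T.graph.vt e b : ℕ) + Λ.port e b) +
      F 40 (3 * (T.graph.vt e b : ℕ) + Λ.port e b) = Λ.lane e b + 1) ∧
    ∀ (v : Fin T.graph.n) (k : ℕ), k < 3 → (∀ e b, T.graph.vt e b = v → Λ.port e b ≠ k) →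
      F 39 (3 * (v : ℕ) + k) + F 40 (3 * (v : ℕ) + k) = 0 := by
  have h3 := M.Q_le; have hn := M.n_le
  refine at_port (val := fun e b => Λ.lane e b + 1)
    (M.by_port false (show laneAtSrcPass ∈ passes by simp [passes]) (by norm_num) (by norm_num)
      (fun e m => ?_) _ (fun e m => ?_) fun e => ?_)
    (M.by_port true (show laneAtTgtPass ∈ passes by simp [passes]) (by norm_num) (by norm_num)
      (fun e m => ?_) _ (fun e m => ?_) fun e => ?_)
  · simp [M.src_eq, M.src_port, MDigraph.vt]
  · simp [M.lane_src]
  · have := M.lane_bounds e false; constructor <;> omega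
  · simp [M.tgt_eq, M.tgt_port, MDigraph.vt]
  · simp [M.lane_tgt]
  · have := M.lane_bounds e true; constructor <;> omega

theorem right_at (M : Matches T E F Λ) : (∀ e b, F 41 (3 * (T.graph.vt e b : ℕ) + Λ.port e b) +
      F 42 (3 * (T.graph.vt e b : ℕ) + Λ.port e b) = if Λ.toRight e b then 1 else 0) ∧
    ∀ (v : Fin T.graph.n) (k : ℕ), k < 3 → (∀ e b, T.graph.vt e b = v → Λ.port e b ≠ k) →
      F 41 (3 * (v : ℕ) + k) + F 42 (3 * (v : ℕ) + k) = 0 := by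
  have h3 := M.Q_le; have hn := M.n_le
  refine at_port (val := fun e b => if Λ.toRight e b then 1 else 0)
    (M.by_port false (show rightAtSrcPass ∈ passes by simp [passes]) (by norm_num) (by norm_num)
      (fun e m => ?_) _ (fun e m => ?_) fun e => ?_)
    (M.by_port true (show rightAtTgtPass ∈ passes by simp [passes]) (by norm_num) (by norm_num)
      (fun e m => ?_) _ (fun e m => ?_) fun e => ?_)
  · simp [M.src_eq, M.src_port, MDigraph.vt]
  · simp only [Layout.toRight, MDigraph.vt]
    by_cases hw : Λ.wr e <;> by_cases hp : Λ.pos (T.graph.src e) < Λ.pos (T.graph.tgt e) <;>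
      simp [M.wrap_eq, M.early, hw, hp]
  · split_ifs <;> constructor <;> omega
  · simp [M.tgt_eq, M.tgt_port, MDigraph.vt]
  · have hne := src_ne Λ e
    have hiff : Λ.pos (T.graph.tgt e) < Λ.pos (T.graph.src e) ↔
      ¬ Λ.pos (T.graph.src e) < Λ.pos (T.graph.tgt e) := by omega
    simp only [Layout.toRight, MDigraph.vt, Bool.not_true, if_true, Bool.false_eq_true, if_false,
      hiff]
    by_cases hw : Λ.wr e <;> by_cases hp : Λ.pos (T.graph.src e) < Λ.pos (T.graph.tgt e) <;>
      simp [M.wrap_eq, M.early, hw, hp]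
  · split_ifs <;> constructor <;> omega

theorem main_eq (M : Matches T E F Λ) (v : Fin T.graph.n) : F 43 (v : ℕ) = Λ.mainPort v := by
  have h3 := M.Q_le; have hn := M.n_le
  have hlt := Λ.mainPort_lt v
  refine M.final.set (show mainPass ∈ passes by simp [passes]) (by norm_num) (M.v_lt v)
    (fun m => ?_) (by omega) (by omega)
  obtain ⟨e, b, h1, h2⟩ := Λ.port_zero v
  have h4 := M.lane_at.1 e b
  rw [h1, h2] at h4
  by_cases hex : ∃ f c, T.graph.vt f c = v ∧ Λ.port f c = 1
  · obtain ⟨f, c, h5, h6⟩ := hex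
    have h7 := M.lane_at.1 f c
    rw [h5, h6] at h7
    have h8 := (M.lane_bounds f c).1
    have hlow : Λ.low v ↔ Λ.lane f c < Λ.lane e b := by
      constructor
      · rintro ⟨e', b', f', c', a1, a2, a3, a4, a5⟩
        obtain ⟨rfl, rfl⟩ := Λ.port_inj e' b' e b (a1.trans h1.symm) (a2.trans h2.symm)
        obtain ⟨rfl, rfl⟩ := Λ.port_inj f' c' f c (a3.trans h5.symm) (a4.trans h6.symm)
        exact a5
      · exact fun h => ⟨e, b, f, c, h1, h2, h5, h6, h⟩
    push_cast at h4 h7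
    rw [add_zero] at h4
    unfold Layout.mainPort
    have hpos : 0 < Λ.lane f c + 1 := by omega
    by_cases h : Λ.lane f c < Λ.lane e b <;>
      simp [h4, h7, hlow, h, hpos]
  -- Without an edge at port 1 the entry is 0, so the first factor of the test vanishes and the main
  -- port is 0.
  · have h7 := M.lane_at.2 v 1 (by norm_num) fun f c h5 h6 => hex ⟨f, c, h5, h6⟩
    have hlow : ¬ Λ.low v := fun ⟨e', b', f', c', a1, a2, a3, a4, a5⟩ => hex ⟨f', c', a3, a4⟩
    push_cast at h7
    simp [h7, Layout.mainPort, hlow]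

theorem main_facts (M : Matches T E F Λ) (v : Fin T.graph.n) :
    F 39 (3 * (v : ℕ) + Λ.mainPort v) + F 40 (3 * (v : ℕ) + Λ.mainPort v) = Λ.py v + 1 ∧
    F 41 (3 * (v : ℕ) + Λ.mainPort v) + F 42 (3 * (v : ℕ) + Λ.mainPort v) =
      if Λ.toRight (Λ.main v).1 (Λ.main v).2 then 1 else 0 := by
  have h1 := M.lane_at.1 (Λ.main v).1 (Λ.main v).2
  have h2 := M.right_at.1 (Λ.main v).1 (Λ.main v).2
  rw [Λ.vt_main, Λ.port_main] at h1 h2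
  exact ⟨h1, h2⟩

theorem py_bounds (M : Matches T E F Λ) (v : Fin T.graph.n) : 0 ≤ Λ.py v ∧ Λ.py v ≤ 100 * ((E.Q : ℤ) * E.Q) :=
  M.lane_bounds _ _

theorem py_eq (M : Matches T E F Λ) (v : Fin T.graph.n) : F 44 (v : ℕ) = Λ.py v := by
  have h1 := M.py_bounds v; have h3 := M.Q_le; have hn := M.n_le
  exact M.final.set (show depthYPass ∈ passes by simp [passes]) (by norm_num) (M.v_lt v)
    (fun m => by simp [M.main_eq, (M.main_facts v).1]) (by omega) (by omega)

theorem side_eq (M : Matches T E F Λ) (v : Fin T.graph.n) : F 45 (v : ℕ) = Λ.side v := by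
  have h1 := Λ.side_cases v; have h3 := M.Q_le; have hn := M.n_le
  refine M.final.set (show sidePass ∈ passes by simp [passes]) (by norm_num) (M.v_lt v)
    (fun m => ?_) (by omega) (by omega)
  unfold Layout.side
  simp only [rightAt, cnt, Env.ev_minus, Env.ev_times, Env.ev_const, Env.ev_plus, Env.ev_get,
    Env.ev_reg_two, Function.update_of_ne (show (41 : ℕ) ≠ 45 by norm_num),
    Function.update_of_ne (show (42 : ℕ) ≠ 45 by norm_num),
    Function.update_of_ne (show (43 : ℕ) ≠ 45 by norm_num), M.main_eq, (M.main_facts v).2]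
  split_ifs <;> norm_num

/-! ### Corners -/

theorem stub_src (M : Matches T E F Λ) (e : Fin T.graph.m) : F 46 (e : ℕ) = Λ.nStub e false := by
  have h3 := M.Q_le; have hn := M.n_le
  have h : Λ.nStub e false ≤ 1 := by unfold Layout.nStub; split_ifs <;> omega
  refine M.final.set (show stubSrcPass ∈ passes by simp [passes]) (by norm_num) (M.e_lt e)
    (fun m => ?_) (by omega) (by omega)
  unfold Layout.nStub
  by_cases hp : Λ.port e false = 2 <;> simp [M.src_port, hp]
  exact_mod_cast hp

theorem stub_tgt (M : Matches T E F Λ) (e : Fin T.graph.m) : F 47 (e : ℕ) = Λ.nStub e true := by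
  have h3 := M.Q_le; have hn := M.n_le
  have h : Λ.nStub e true ≤ 1 := by unfold Layout.nStub; split_ifs <;> omega
  refine M.final.set (show stubTgtPass ∈ passes by simp [passes]) (by norm_num) (M.e_lt e)
    (fun m => ?_) (by omega) (by omega)
  unfold Layout.nStub
  by_cases hp : Λ.port e true = 2 <;> simp [M.tgt_port, hp]
  exact_mod_cast hp

theorem vert_src (M : Matches T E F Λ) (e : Fin T.graph.m) : F 48 (e : ℕ) = Λ.nVert e false := by
  have h3 := M.Q_le; have hn := M.n_le
  have h : Λ.nVert e false ≤ 1 := by unfold Layout.nVert; split_ifs <;> omega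
  refine M.final.set (show vertSrcPass ∈ passes by simp [passes]) (by norm_num) (M.e_lt e)
    (fun m => ?_) (by omega) (by omega)
  unfold Layout.nVert
  by_cases hp : Λ.port e false = Λ.mainPort (T.graph.src e) <;>
    simp [M.src_port, M.src_eq, M.main_eq, sub_eq_zero, MDigraph.vt, hp]

theorem vert_tgt (M : Matches T E F Λ) (e : Fin T.graph.m) : F 49 (e : ℕ) = Λ.nVert e true := by
  have h3 := M.Q_le; have hn := M.n_le
  have h : Λ.nVert e true ≤ 1 := by unfold Layout.nVert; split_ifs <;> omega
  refine M.final.set (show vertTgtPass ∈ passes by simp [passes]) (by norm_num) (M.e_lt e)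
    (fun m => ?_) (by omega) (by omega)
  unfold Layout.nVert
  by_cases hp : Λ.port e true = Λ.mainPort (T.graph.tgt e) <;>
    simp [M.tgt_port, M.tgt_eq, M.main_eq, sub_eq_zero, MDigraph.vt, hp]

theorem px_bounds (M : Matches T E F Λ) (v : Fin T.graph.n) : 0 ≤ Λ.px v ∧ Λ.px v ≤ 3 * E.Q := by
  have h1 := M.pos_lt v; have h2 := M.n_le
  have h4 : Λ.idx v ≤ Λ.pos v := Nat.mod_le _ _
  unfold Layout.px
  omega

theorem cx_bounds (M : Matches T E F Λ) (e : Fin T.graph.m) (b : Bool) : -1 ≤ Λ.cx e b ∧ Λ.cx e b ≤ 3 * E.Q + 1 := by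
  have h1 := M.px_bounds (T.graph.vt e b)
  have h2 := Λ.side_cases (T.graph.vt e b)
  unfold Layout.cx
  split_ifs <;> omega

theorem cx_src (M : Matches T E F Λ) (e : Fin T.graph.m) : F 50 (e : ℕ) = Λ.cx e false := by
  have h1 := M.cx_bounds e false; have h3 := M.Q_le; have hn := M.n_le
  refine M.final.set (show cxSrcPass ∈ passes by simp [passes]) (by norm_num) (M.e_lt e)
    (fun m => ?_) (by omega) (by omega)
  by_cases hp : Λ.port e false = 2 <;>
    simp [M.src_eq, M.px_eq, M.side_eq, M.stub_src, Layout.nStub, Layout.cx, MDigraph.vt, hp]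

theorem cx_tgt (M : Matches T E F Λ) (e : Fin T.graph.m) : F 51 (e : ℕ) = Λ.cx e true := by
  have h1 := M.cx_bounds e true; have h3 := M.Q_le; have hn := M.n_le
  refine M.final.set (show cxTgtPass ∈ passes by simp [passes]) (by norm_num) (M.e_lt e)
    (fun m => ?_) (by omega) (by omega)
  by_cases hp : Λ.port e true = 2 <;>
    simp [M.tgt_eq, M.px_eq, M.side_eq, M.stub_tgt, Layout.nStub, Layout.cx, MDigraph.vt, hp]

theorem wx_bounds (M : Matches T E F Λ) (e : Fin T.graph.m) : 0 ≤ Λ.wx e ∧ Λ.wx e ≤ 700 * E.Q := by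
  have h1 := M.W_le; have h2 := M.L_le; have h3 := Λ.track_lt e
  unfold Layout.wx
  omega

theorem wx_eq (M : Matches T E F Λ) (e : Fin T.graph.m) : F 52 (e : ℕ) = Λ.wx e := by
  have h1 := M.wx_bounds e; have h3 := M.Q_le; have hn := M.n_le
  exact M.final.set (show wxPass ∈ passes by simp [passes]) (by norm_num) (M.e_lt e)
    (fun m => by simp [M.W_eq, M.track_eq, Layout.wx]) (by omega) (by omega)

/-! ### The output -/

theorem out_vertex (M : Matches T E F Λ) (v : Fin T.graph.n) : F 1 (v : ℕ) = Λ.px v ∧ F 2 (v : ℕ) = -Λ.py v := by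
  have h1 := M.px_bounds v; have h2 := M.py_bounds v; have h3 := M.Q_le; have hn := M.n_le
  exact ⟨M.final.set (show outXPass ∈ passes by simp [passes]) (by norm_num) (M.v_lt v)
    (fun m => by simp [M.px_eq]) (by omega) (by omega),
    M.final.set (show outYPass ∈ passes by simp [passes]) (by norm_num) (M.v_lt v)
    (fun m => by simp [M.py_eq]) (by omega) (by omega)⟩

theorem out_bends (M : Matches T E F Λ) (e : Fin T.graph.m) :
    F 3 (e : ℕ) = Λ.drawing.bends e ∧ F 4 (e : ℕ) = 8 * (e : ℕ) := by
  have h3 := M.Q_le; have hn := M.n_le; have he := M.e_lt e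
  have hb := Λ.bends_eq e
  have h : ∀ b, Λ.nVert e b ≤ 1 ∧ Λ.nStub e b ≤ 1 := fun b => by
    unfold Layout.nVert Layout.nStub; constructor <;> split_ifs <;> omega
  have h4 := h true; have h5 := h false
  have h6 : Λ.nWrap e ≤ 1 := by unfold Layout.nWrap; split_ifs <;> omega
  have hw : F 36 (e : ℕ) = Λ.nWrap e := by rw [M.wrap_eq]; unfold Layout.nWrap; split_ifs <;> rfl
  constructor
  · refine M.final.set (show bendsPass ∈ passes by simp [passes]) (by norm_num) he
      (fun m => ?_) (by omega) (by omega)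
    rw [hb]
    simp [M.stub_src, M.stub_tgt, M.vert_src, M.vert_tgt, hw]
    ring
  · exact M.final.set (show startPass ∈ passes by simp [passes]) (by norm_num) he
      (fun m => by simp) (by omega) (by omega)

end Matches

end Draw

namespace Draw

open SPTree
open scoped Classical

variable {T : SPTree} {E : Env} {F : Mem} {Λ : Layout T.graph}

/-! ### Lists of corners -/

/-- The array after the flagged values have been stored at consecutive addresses from `P` on. -/
def writeAll : List (Bool × ℤ) → ℤ → (ℤ → ℤ) → ℤ → ℤ
  | [], _, f => f
  | x :: l, P, f => writeAll l (P + cond x.1 1 0) (Function.update f P x.2)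

theorem writeAll_lt (l : List (Bool × ℤ)) : ∀ (P : ℤ) (f : ℤ → ℤ) (z : ℤ), z < P →
    writeAll l P f z = f z := by
  induction l with
  | nil => intro P f z _; rfl
  | cons x l ih =>
    intro P f z hz
    rw [writeAll, ih _ _ _ (by cases x.1 <;> simp <;> omega), Function.update_of_ne (by omega)]

/-- After an unflagged value the address does not advance, and the next value overwrites it. So the
flagged values end up side by side. -/
theorem writeAll_get (l : List (Bool × ℤ)) : ∀ (P : ℤ) (f : ℤ → ℤ) (i : ℕ),
    i < ((l.filter Prod.fst).map Prod.snd).length →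
    writeAll l P f (P + i) = ((l.filter Prod.fst).map Prod.snd).getD i 0 := by
  induction l with
  | nil => intro P f i hi; simp at hi
  | cons x l ih =>
    intro P f i hi
    obtain ⟨b, y⟩ := x
    cases b
    · simp only [writeAll, cond_false, add_zero, List.filter_cons, Bool.false_eq_true, if_false]
        at hi ⊢
      exact ih _ _ _ hi
    · simp only [writeAll, cond_true, List.filter_cons, if_true, List.map_cons,
        List.length_cons] at hi ⊢
      cases i with
      | zero =>
        rw [writeAll_lt _ _ _ _ (by omega)]
        simp
      | succ i =>
        have := ih (P + 1) (Function.update f P y) i (by omega)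
        rw [List.getD_cons_succ, ← this]
        congr 1; push_cast; ring

theorem Final.emit_edge (H : Final T E F) {a : ℕ} (ha : 10 ≠ a) (e : Fin T.graph.m)
    {l : List (RExpr × RExpr)} {vals : List (Bool × ℤ)}
    (h : List.Forall₂ (fun x y => ∀ g, E.ev (e : ℕ) (Function.update F a g) x.1 = cond y.1 1 0 ∧
      E.gv (E.ev (e : ℕ) (Function.update F a g) x.2) = y.2) l vals) :
    ∀ (p : RExpr) (P : ℤ), (∀ g, E.ev (e : ℕ) (Function.update F a g) p = P) → 0 ≤ P →
      P + vals.length ≤ 10000 * E.Q → ∀ g, E.bodySem (emit a l p) (e : ℕ) (Function.update F a g) =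
        Function.update F a (writeAll vals P g) := by
  have hE := H.numE_eq
  have he : ((e : ℕ) : ℤ) < T.graph.m := by exact_mod_cast e.2
  induction h with
  | nil => intro p P _ _ _ g; rfl
  | @cons x y l vals hxy _ ih =>
    intro p P hp h0 hP g
    obtain ⟨h1, h2⟩ := hxy g
    simp only [List.length_cons] at hP
    push_cast at hP
    have h3 : E.ev (e : ℕ) (Function.update F a g) (ifEdge p) = P := by
      simp only [ifEdge, numE, cnt, Env.ev_minus, Env.ev_times, Env.ev_lt, Env.ev_reg_two,
        Env.ev_get, Env.ev_reg_zero, Env.ev_plus, Env.ev_const, Function.update_of_ne ha, hE, hp]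
      simp [he]
    have h4 : E.bodySem (emit a (x :: l) p) (e : ℕ) (Function.update F a g) =
        E.bodySem (emit a l (RExpr.plus p x.1)) (e : ℕ)
          (E.stoSem (e : ℕ) (Function.update F a g) ⟨a, ifEdge p, x.2⟩) := rfl
    rw [h4, Env.stoSem]
    simp only [Function.update_self, Function.update_idem, h3, h2]
    rw [H.gv (by omega) (by omega), ih (RExpr.plus p x.1) (P + cond y.1 1 0) ?_ ?_ ?_]
    · rfl
    · intro g
      rw [Env.ev_plus, hp, (hxy g).1]
    · cases y.1 <;> simp <;> omega
    · cases y.1 <;> simp <;> omega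

theorem Final.emit_other (H : Final T E F) {a : ℕ} (ha : 10 ≠ a) {c : ℕ} (hc : T.graph.m ≤ c)
    (l : List (RExpr × RExpr)) : ∀ (p : RExpr) (g : ℤ → ℤ),
    ∃ g', E.bodySem (emit a l p) c (Function.update F a g) = Function.update F a g' ∧
      ∀ z, 0 ≤ z → g' z = g z := by
  have hE := H.numE_eq
  have hc : ¬ (c : ℤ) < T.graph.m := by exact_mod_cast not_lt.2 hc
  have hQ := H.hQ
  induction l with
  | nil => intro p g; exact ⟨g, rfl, fun _ _ => rfl⟩
  | cons x l ih =>
    intro p g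
    have h3 : E.ev c (Function.update F a g) (ifEdge p) = -1 := by
      simp only [ifEdge, numE, cnt, Env.ev_minus, Env.ev_times, Env.ev_lt, Env.ev_reg_two,
        Env.ev_get, Env.ev_reg_zero, Env.ev_plus, Env.ev_const, Function.update_of_ne ha, hE]
      simp [hc]
    have h4 : E.bodySem (emit a (x :: l) p) c (Function.update F a g) =
        E.bodySem (emit a l (RExpr.plus p x.1)) c
          (E.stoSem c (Function.update F a g) ⟨a, ifEdge p, x.2⟩) := rfl
    rw [h4, Env.stoSem]
    simp only [Function.update_self, Function.update_idem, h3]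
    rw [H.gv (by omega) (by omega)]
    obtain ⟨g', h5, h6⟩ := ih (RExpr.plus p x.1)
      (Function.update g (-1) (E.gv (E.ev c (Function.update F a g) x.2)))
    exact ⟨g', h5, fun z hz => by rw [h6 z hz, Function.update_of_ne (by omega)]⟩

theorem emit_writes {a b : ℕ} {l : List (RExpr × RExpr)} : ∀ {p : RExpr},
    b ∈ (emit a l p).writes → b = a := by
  induction l with
  | nil => intro p h; simp [emit, Pass.writes] at h
  | cons x l ih =>
    intro p h
    simp only [emit, Pass.writes, List.map_cons, List.mem_cons] at h
    rcases h with h | h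
    · exact h
    · exact ih h

/-- Edge `e` owns the eight addresses from `8 * e` on. Later edges store above them, and counters
beyond the edges store at the waste address. -/
theorem Final.emit_eq (H : Final T E F) {a : ℕ} (ha : 10 ≠ a) {x : RExpr × RExpr}
    {l : List (RExpr × RExpr)}
    (hp : emit a (x :: l) (RExpr.times (RExpr.const 8) cnt) ∈ passes)
    (vals : Fin T.graph.m → List (Bool × ℤ)) (hlen : ∀ e, (vals e).length ≤ 8)
    (h : ∀ e : Fin T.graph.m, List.Forall₂ (fun x y => ∀ g,
      E.ev (e : ℕ) (Function.update F a g) x.1 = cond y.1 1 0 ∧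
      E.gv (E.ev (e : ℕ) (Function.update F a g) x.2) = y.2) (x :: l) (vals e))
    (e : Fin T.graph.m) (i : ℕ) (hi : i < (((vals e).filter Prod.fst).map Prod.snd).length) :
    F a (8 * (e : ℕ) + i) = (((vals e).filter Prod.fst).map Prod.snd).getD i 0 := by
  obtain ⟨m₀, -, ht⟩ := H.trace
  obtain ⟨Ms, h1, h2, h3⟩ := ht _ hp
  have hm := H.m_le
  have he := e.2
  have hi8 : i < 8 := by
    refine hi.trans_le ?_
    rw [List.length_map]
    exact (List.length_filter_le _ _).trans (hlen e)
  have hMs : ∀ c, Ms c = Function.update F a (Ms c a) := by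
    intro c; funext b
    by_cases hb : b = a
    · subst hb; simp
    · rw [Function.update_of_ne hb, h1 c b fun h => hb (emit_writes h)]
  have hstep : ∀ (f : Fin T.graph.m) , Ms (f + 1) a = writeAll (vals f) (8 * (f : ℕ)) (Ms f a) := by
    intro f
    have hf := f.2
    have hl := hlen f
    rw [h3 f (by omega), hMs f, H.emit_edge ha f (h f) _ (8 * (f : ℕ)) (fun g => rfl) (by omega)
      (by omega)]
    simp
  have hkeep : ∀ k c, c + k = E.Q → (e : ℕ) < c → Ms c a (8 * (e : ℕ) + i) = F a (8 * (e : ℕ) + i) := by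
    intro k
    induction k with
    | zero =>
      intro c hc _
      obtain rfl : c = E.Q := by omega
      rw [(h2 a (by simp [emit, Pass.writes])).2]
    | succ k ih =>
      intro c hc hec
      rw [← ih (c + 1) (by omega) (by omega)]
      rcases Nat.lt_or_ge c T.graph.m with hcm | hcm
      · rw [hstep ⟨c, hcm⟩, writeAll_lt]
        simp only; omega
      · obtain ⟨g', h5, h6⟩ := H.emit_other ha hcm (x :: l) (RExpr.times (RExpr.const 8) cnt) (Ms c a)
        rw [h3 c (by omega), hMs c, h5]
        simp only [Function.update_self]
        exact (h6 _ (by omega)).symm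
  rw [← hkeep (E.Q - (e + 1)) (e + 1) (by omega) (by omega), hstep e, writeAll_get _ _ _ _ hi]

theorem filter_map_snd (l : List (Bool × (ℤ × ℤ))) (φ : ℤ × ℤ → ℤ) :
    ((l.map fun x => (x.1, φ x.2)).filter Prod.fst).map Prod.snd =
      ((l.filter Prod.fst).map Prod.snd).map φ := by
  induction l with
  | nil => rfl
  | cons x l ih =>
    obtain ⟨b, y⟩ := x
    cases b <;> simp <;> simpa using ih

theorem forall₂_eight {α β : Type*} {R : α → β → Prop} {a₁ a₂ a₃ a₄ a₅ a₆ a₇ a₈ : α}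
    {b₁ b₂ b₃ b₄ b₅ b₆ b₇ b₈ : β} (h₁ : R a₁ b₁) (h₂ : R a₂ b₂) (h₃ : R a₃ b₃) (h₄ : R a₄ b₄)
    (h₅ : R a₅ b₅) (h₆ : R a₆ b₆) (h₇ : R a₇ b₇) (h₈ : R a₈ b₈) :
    List.Forall₂ R [a₁, a₂, a₃, a₄, a₅, a₆, a₇, a₈] [b₁, b₂, b₃, b₄, b₅, b₆, b₇, b₈] := by
  simp only [List.forall₂_cons, List.forall₂_nil_left_iff, and_true]
  exact ⟨h₁, h₂, h₃, h₄, h₅, h₆, h₇, h₈⟩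

namespace Matches

theorem flags_eq (M : Matches T E F Λ) (e : Fin T.graph.m) {a : ℕ} (h46 : 46 ≠ a) (h47 : 47 ≠ a)
    (h48 : 48 ≠ a) (h49 : 49 ≠ a) (h36 : 36 ≠ a) (g : ℤ → ℤ) :
    E.ev (e : ℕ) (Function.update F a g) (RExpr.get 46 cnt) =
      cond (decide (Λ.port e false = 2)) 1 0 ∧
    E.ev (e : ℕ) (Function.update F a g) (RExpr.get 48 cnt) =
      cond (decide (Λ.port e false ≠ Λ.mainPort (T.graph.vt e false))) 1 0 ∧
    E.ev (e : ℕ) (Function.update F a g) (RExpr.get 36 cnt) = cond (decide (Λ.wr e)) 1 0 ∧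
    E.ev (e : ℕ) (Function.update F a g) (RExpr.get 49 cnt) =
      cond (decide (Λ.port e true ≠ Λ.mainPort (T.graph.vt e true))) 1 0 ∧
    E.ev (e : ℕ) (Function.update F a g) (RExpr.get 47 cnt) =
      cond (decide (Λ.port e true = 2)) 1 0 := by
  simp only [cnt, Env.ev_get, Env.ev_reg_two, Function.update_of_ne h46, Function.update_of_ne h47,
    Function.update_of_ne h48, Function.update_of_ne h49, Function.update_of_ne h36, M.stub_src,
    M.stub_tgt, M.vert_src, M.vert_tgt, M.wrap_eq, Layout.nStub, Layout.nVert, Bool.cond_decide]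
  refine ⟨?_, ?_, trivial, ?_, ?_⟩ <;> split_ifs <;> norm_num

theorem corner_fst (M : Matches T E F Λ) (e : Fin T.graph.m) (i : ℕ) (hi : i < (Λ.path e).length) :
    F 5 (8 * (e : ℕ) + i) = ((Λ.path e).getD i 0).1 := by
  have hQ := M.Q_le; have hn := M.n_le
  have h := M.final.emit_eq (a := 5) (by norm_num)
    (show emit 5 (flags.zip xs) (RExpr.times (RExpr.const 8) cnt) ∈ passes by simp [passes])
    (fun e => (Λ.half e false ++ (Λ.half e true).reverse).map fun x => (x.1, x.2.1))
    (fun e => by simp [Layout.half]) (fun e => ?_) e i (by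
      rw [filter_map_snd, List.length_map]; exact hi)
  · rw [h, filter_map_snd _ Prod.fst]
    show (List.map Prod.fst (Λ.path e)).getD i 0 = _
    rw [List.getD_eq_getElem _ _ (by simpa using hi), List.getElem_map, List.getD_eq_getElem _ _ hi]
  · have hf := fun g => M.flags_eq e (a := 5) (by norm_num) (by norm_num) (by norm_num) (by norm_num)
      (by norm_num) g
    have h1 := M.px_bounds (T.graph.src e); have h2 := M.px_bounds (T.graph.tgt e)
    have h3 := M.cx_bounds e false; have h4 := M.cx_bounds e true
    have h5 := M.wx_bounds e
    have hpx : ∀ v, E.gv (Λ.px v) = Λ.px v := fun v => by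
      have := M.px_bounds v
      exact M.final.gv (by omega) (by omega)
    have hcx : ∀ b, E.gv (Λ.cx e b) = Λ.cx e b := fun b => by
      have := M.cx_bounds e b
      exact M.final.gv (by omega) (by omega)
    have hwx : E.gv (Λ.wx e) = Λ.wx e := M.final.gv (by omega) (by omega)
    refine forall₂_eight (fun g => ⟨rfl, ?_⟩) (fun g => ⟨(hf g).1, ?_⟩) (fun g => ⟨(hf g).2.1, ?_⟩)
      (fun g => ⟨(hf g).2.2.1, ?_⟩) (fun g => ⟨(hf g).2.2.1, ?_⟩) (fun g => ⟨(hf g).2.2.2.1, ?_⟩)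
      (fun g => ⟨(hf g).2.2.2.2, ?_⟩) (fun g => ⟨rfl, ?_⟩)
    · simp [M.src_eq, M.px_eq, hpx, MDigraph.vt]
    · simp [M.cx_src, hcx]
    · simp [M.cx_src, hcx]
    · simp [M.wx_eq, hwx]
    · simp [M.wx_eq, hwx]
    · simp [M.cx_tgt, hcx]
    · simp [M.cx_tgt, hcx]
    · simp [M.tgt_eq, M.px_eq, hpx, MDigraph.vt]

theorem corner_snd (M : Matches T E F Λ) (e : Fin T.graph.m) (i : ℕ) (hi : i < (Λ.path e).length) :
    F 6 (8 * (e : ℕ) + i) = ((Λ.path e).getD i 0).2 := by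
  have hQ := M.Q_le; have hn := M.n_le
  have h := M.final.emit_eq (a := 6) (by norm_num)
    (show emit 6 (flags.zip ys) (RExpr.times (RExpr.const 8) cnt) ∈ passes by simp [passes])
    (fun e => (Λ.half e false ++ (Λ.half e true).reverse).map fun x => (x.1, x.2.2))
    (fun e => by simp [Layout.half]) (fun e => ?_) e i (by
      rw [filter_map_snd, List.length_map]; exact hi)
  · rw [h, filter_map_snd _ Prod.snd]
    show (List.map Prod.snd (Λ.path e)).getD i 0 = _
    rw [List.getD_eq_getElem _ _ (by simpa using hi), List.getElem_map, List.getD_eq_getElem _ _ hi]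
  · have hf := fun g => M.flags_eq e (a := 6) (by norm_num) (by norm_num) (by norm_num) (by norm_num)
      (by norm_num) g
    have hpy : ∀ v, E.gv (-Λ.py v) = -Λ.py v := fun v => by
      have := M.py_bounds v
      exact M.final.gv_sq (by omega) (by omega)
    have hlane : ∀ b, E.gv (-Λ.lane e b) = -Λ.lane e b := fun b => by
      have := M.lane_bounds e b
      exact M.final.gv_sq (by omega) (by omega)
    refine forall₂_eight (fun g => ⟨rfl, ?_⟩) (fun g => ⟨(hf g).1, ?_⟩) (fun g => ⟨(hf g).2.1, ?_⟩)
      (fun g => ⟨(hf g).2.2.1, ?_⟩) (fun g => ⟨(hf g).2.2.1, ?_⟩) (fun g => ⟨(hf g).2.2.2.1, ?_⟩)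
      (fun g => ⟨(hf g).2.2.2.2, ?_⟩) (fun g => ⟨rfl, ?_⟩)
    · simp [M.src_eq, M.py_eq, hpy, MDigraph.vt]
    · simp [M.src_eq, M.py_eq, hpy, MDigraph.vt]
    · simp [M.lane_src, hlane]
    · simp [M.lane_src, hlane]
    · simp [M.lane_tgt, hlane]
    · simp [M.lane_tgt, hlane]
    · simp [M.tgt_eq, M.py_eq, hpy, MDigraph.vt]
    · simp [M.tgt_eq, M.py_eq, hpy, MDigraph.vt]

theorem encodes (M : Matches T E F Λ) (r : ℕ → ℤ) : Encodes ⟨r, F⟩ Λ.drawing where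
  vertex v := Prod.ext (M.out_vertex v).1 (M.out_vertex v).2
  bends e := (M.out_bends e).1
  corner e i hi := by
    have hl := Λ.path_length e
    have h4 := (M.out_bends e).2
    show (F 5 (F 4 (e : ℕ) + i), F 6 (F 4 (e : ℕ) + i)) = (Λ.path e).getD i 0
    rw [h4, M.corner_fst e i (by omega), M.corner_snd e i (by omega)]

end Matches

end Draw

/-! ### Size of the input -/

/-- Double counting of edge ends. This makes the length of the input, and with it the running time,
linear in the number of vertices. -/
theorem MDigraph.two_mul_m_le {G : MDigraph} (h : G.DegreeThree) : 2 * G.m ≤ 3 * G.n := by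
  have h1 : G.m = ∑ v, G.inDegree v := by
    have := Finset.card_eq_sum_card_fiberwise (f := G.tgt) (s := Finset.univ) (t := Finset.univ)
      (by simp)
    simpa [MDigraph.inDegree] using this
  have h2 : G.m = ∑ v, G.outDegree v := by
    have := Finset.card_eq_sum_card_fiberwise (f := G.src) (s := Finset.univ) (t := Finset.univ)
      (by simp)
    simpa [MDigraph.outDegree] using this
  have h3 : ∑ v, (G.inDegree v + G.outDegree v) ≤ ∑ _v : Fin G.n, 3 :=
    Finset.sum_le_sum fun v _ => h v
  rw [Finset.sum_add_distrib, ← h1, ← h2] at h3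
  simp at h3
  omega

namespace Draw

open SPTree

/-- The registers of the program on a given input. -/
def env (T : SPTree) (A : ℕ) : Env where
  N := T.code.length
  A := A
  Q := T.code.length + 3
  M := 10000 * (((T.code.length + 3 : ℕ) : ℤ) * ((T.code.length + 3 : ℕ) : ℤ))

/-- The memory at the end. -/
def result (T : SPTree) (A : ℕ) : Mem := (env T A).runSem passes (inputState T A).arr

theorem result_final (T : SPTree) (A : ℕ) : Final T (env T A) (result T A) := by
  have h0 : result T A 0 = (inputState T A).arr 0 :=
    (env T A).runSem_frame passes [0] _ passes_wellFormed 0 (by simp)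
  refine ⟨rfl, rfl, rfl, fun i => ?_, (inputState T A).arr, fun b hb => ?_, ?_⟩
  · rw [h0]; simp [inputState]
  · funext i; simp [inputState, hb]
  · exact (env T A).trace_of_wellFormed _ passes [0] _ passes_wellFormed fun _ _ => rfl

theorem exec_prog (T : SPTree) (A : ℕ) {B : ℤ} (hB : (env T A).M ≤ B) :
    ∃ c t, Exec B prog (inputState T A) ⟨(env T A).regs c, result T A⟩ t ∧
      t ≤ (passesCost passes + 20) * ((env T A).Q + 1) := by
  have hN : (0 : ℤ) ≤ T.code.length := by positivity
  have hM : (env T A).M = 10000 * (((T.code.length : ℤ) + 3) * ((T.code.length : ℤ) + 3)) := by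
    simp [env]
  have hQ : ((env T A).Q : ℤ) = T.code.length + 3 := by simp [env]
  have hQM : (T.code.length : ℤ) + 3 ≤ (env T A).M := by rw [hM]; nlinarith
  obtain ⟨c, t, h, ht⟩ := exec_passes (E := env T A) (B := B) (by omega) hB (by omega) passes
    (inputState T A).arr 0
  have h3 := Exec.assign (B := B) 3 (RExpr.plus (RExpr.reg 0) (RExpr.const 3)) (inputState T A) (by
    simp only [RExpr.eval, inputState, if_true]
    rw [abs_of_nonneg (by omega)]; omega)
  simp only [RExpr.eval, inputState, if_true] at h3
  have h4 := Exec.assign (B := B) 4 (RExpr.times (RExpr.const 10000)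
    (RExpr.times (RExpr.reg 3) (RExpr.reg 3))) ⟨Function.update (inputState T A).reg 3
      ((T.code.length : ℤ) + 3), (inputState T A).arr⟩ (by
    simp only [RExpr.eval, Function.update_self, ← hM]
    rw [abs_of_nonneg (by omega)]; exact hB)
  simp only [RExpr.eval, Function.update_self, ← hM] at h4
  have hr : Function.update (Function.update (inputState T A).reg 3 ((T.code.length : ℤ) + 3)) 4
      (env T A).M = (env T A).regs 0 := by
    funext x
    by_cases h4 : x = 4
    · subst h4; simp [Env.regs]
    by_cases h3 : x = 3
    · subst h3; simp [Env.regs, hQ]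
    simp [Env.regs, h3, h4, inputState, env]
  rw [hr] at h4
  refine ⟨c, _, Exec.seq h3 (Exec.seq h4 h), ?_⟩
  simp only [RExpr.cost]
  nlinarith

/-! ### Bounds -/

section Bounds

variable {T : SPTree} {A : ℕ} {F : Mem}

/-- An injection of a finite set into itself is onto, so all places are taken. The lower bounds for
width and height need vertices at given places. -/
theorem exists_pos {G : MDigraph} (Λ : Layout G) (h : ∀ v, Λ.pos v < G.n) {k : ℕ} (hk : k < G.n) :
    ∃ v, Λ.pos v = k := by
  have hinj : Function.Injective fun v => (⟨Λ.pos v, h v⟩ : Fin G.n) := fun v w hvw =>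
    Λ.pos_inj (congrArg Fin.val hvw)
  obtain ⟨v, hv⟩ := (Finite.injective_iff_surjective.1 hinj) ⟨k, hk⟩
  exact ⟨v, congrArg Fin.val hv⟩

/-- From `9 / log 2 < 13`, and from `18 < 26 * log 2` with `log 2 ≤ log n`; the constant is `13 +
26`. -/
theorem log_two_mul_le {n : ℕ} (hn : 2 ≤ n) :
    (9 * (Nat.log 2 n + 2) : ℝ) ≤ 39 * Real.log n := by
  have h1 : Real.log 2 * Nat.log 2 n ≤ Real.log n := by
    have h : ((2 ^ Nat.log 2 n : ℕ) : ℝ) ≤ n := by exact_mod_cast Nat.pow_log_le_self 2 (by omega)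
    have := Real.log_le_log (by positivity) h
    push_cast at this
    rwa [Real.log_pow, mul_comm] at this
  have h2 : Real.log 2 ≤ Real.log n := Real.log_le_log (by norm_num) (by exact_mod_cast hn)
  have h3 := Real.log_two_gt_d9
  have h4 : (0 : ℝ) ≤ Nat.log 2 n := by positivity
  have h5 : 0.69314718 * (Nat.log 2 n : ℝ) ≤ Real.log 2 * Nat.log 2 n :=
    mul_le_mul_of_nonneg_right (by linarith) h4
  norm_num at h3 h5 ⊢
  linarith

theorem log_le_log_two {n : ℕ} (hn : n ≠ 0) : Real.log n ≤ Nat.log 2 n + 1 := by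
  have h : (n : ℝ) ≤ ((2 ^ (Nat.log 2 n + 1) : ℕ) : ℝ) := by
    exact_mod_cast (Nat.lt_pow_succ_log_self (by norm_num) n).le
  have h1 := Real.log_le_log (by exact_mod_cast Nat.pos_of_ne_zero hn) h
  push_cast at h1
  rw [Real.log_pow] at h1
  have h2 := Real.log_two_lt_d9
  have h3 : (0 : ℝ) ≤ (Nat.log 2 n : ℝ) + 1 := by positivity
  push_cast at h1
  nlinarith

/-- A width for which the drawing has constant aspect ratio. -/
def balanced (n : ℕ) : ℕ := Nat.sqrt (n * Nat.log 2 n) + 1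

theorem log_le_balanced {n : ℕ} (hn : n ≠ 0) : Real.log n ≤ balanced n := by
  refine (log_le_log_two hn).trans ?_
  have h : Nat.log 2 n ≤ Nat.sqrt (n * Nat.log 2 n) :=
    Nat.le_sqrt.2 (Nat.mul_le_mul_right _ (Nat.log_le_self 2 n))
  unfold balanced
  exact_mod_cast Nat.succ_le_succ h

theorem million_mul_le (l : ℕ) (hl : 30 ≤ l) : 1000000 * l ≤ 2 ^ l := by
  induction l, hl using Nat.le_induction with
  | base => norm_num
  | succ l hl ih => rw [pow_succ]; omega

/-- For such `n` the logarithm is at most a millionth of `n`, so the square root is at most a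
thousandth. This makes the drawing have at least three rows. -/
theorem balanced_le {n : ℕ} (hl : 30 ≤ Nat.log 2 n) : 402 * balanced n ≤ n := by
  have hn : n ≠ 0 := by rintro rfl; simp at hl
  have h1 := (million_mul_le _ hl).trans (Nat.pow_log_le_self 2 hn)
  have h2 : Nat.sqrt (n * Nat.log 2 n) ≤ n / 1000 := by
    rw [Nat.le_div_iff_mul_le (by norm_num)]
    have h3 := Nat.sqrt_le (n * Nat.log 2 n)
    by_contra h
    push Not at h
    nlinarith
  unfold balanced
  omega

/-- The numbers in the bounds for a drawing with `n` vertices in rows of length `W`. -/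
structure Sizes (n A W L q w h : ℕ) : Prop where
  n_ge : 2 ≤ n
  A_pos : 0 < A
  W_eq : W = 200 * min A n
  L_eq : L = 9 * (Nat.log 2 n + 2)
  q_eq : q = (n - 1) / W
  w_le : w ≤ 3 * W + L + 1
  h_le : h ≤ 2 * L * (q + 1) + 1
  w_ge : W ≤ n → W ≤ w
  h_ge : 2 * L * q ≤ h + 2 * L
  w_pos : 0 < w
  h_pos : 0 < h

variable {n W L q w h : ℕ}

theorem Sizes.qW (S : Sizes n A W L q w h) : q * W ≤ n - 1 ∧ n - 1 < (q + 1) * W := by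
  have h1 := S.A_pos; have h2 := S.n_ge; have h3 := S.W_eq
  have hW : 0 < W := by omega
  rw [S.q_eq]
  exact ⟨Nat.div_mul_le_self _ _, by
    have := Nat.lt_div_mul_add hW (a := n - 1)
    rw [add_mul, one_mul]; exact this⟩

/-- The aspect ratio for `A = balanced n`. -/
theorem Sizes.aspect (S : Sizes n A W L q w h) (hA : A = balanced n) :
    w ≤ 10 ^ 13 * h ∧ h ≤ 10 ^ 13 * w := by
  have h1 := S.n_ge; have h2 := S.W_eq; have h3 := S.L_eq
  obtain ⟨h4, h5⟩ := S.qW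
  have hw := S.w_le; have hh := S.h_le; have hw' := S.w_ge; have hh' := S.h_ge
  have hw0 := S.w_pos; have hh0 := S.h_pos
  -- For `n < 2 ^ 30` width and height are bounded by constants, which is what the factor `10 ^ 13`
  -- pays for.
  rcases Nat.lt_or_ge (Nat.log 2 n) 30 with hl | hl
  · have hn : n < 2 ^ 30 := (Nat.lt_pow_succ_log_self (b := 2) (by norm_num) n).trans_le
      (Nat.pow_le_pow_right (by norm_num) hl)
    norm_num at hn
    have hq : q ≤ n := by rw [S.q_eq]; exact (Nat.div_le_self _ _).trans (Nat.sub_le _ _)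
    have hL : L ≤ 288 := by omega
    have : 2 * L * (q + 1) ≤ 2 * 288 * (1073741824 + 1) := Nat.mul_le_mul (by omega) (by omega)
    constructor <;> norm_num <;> omega
  · have h6 := balanced_le hl
    have hWA : W = 200 * A := by rw [h2, min_eq_left (by omega)]
    -- Otherwise `n - 1 < 2 * W = 400 * A`, against `402 * A ≤ n`. With `q ≥ 2` the lower bound `2 *
    -- L * q - 2 * L` for the height is at least `L * q`; then `e1` and `e2` compare `L * q` with
    -- `W`, both of order `√(n log n)`.
    have hq : 2 ≤ q := by
      by_contra hq
      have : (q + 1) * W ≤ 2 * W := Nat.mul_le_mul_right _ (by omega)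
      omega
    set l := Nat.log 2 n with hl'
    have hs1 := Nat.sqrt_le (n * l)
    have hs2 := Nat.lt_succ_sqrt (n * l)
    have hA' : A = Nat.sqrt (n * l) + 1 := hA
    have hs0 : l ≤ Nat.sqrt (n * l) := Nat.le_sqrt.2 (Nat.mul_le_mul_right _ (Nat.log_le_self 2 n))
    have hA2 : A * A ≤ 4 * (n * l) := by
      have h8 : A ≤ 2 * Nat.sqrt (n * l) := by omega
      have h9 := Nat.mul_le_mul h8 h8
      have h10 : 2 * Nat.sqrt (n * l) * (2 * Nat.sqrt (n * l)) =
        4 * (Nat.sqrt (n * l) * Nat.sqrt (n * l)) := by ring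
      omega
    have hA3 : n * l ≤ A * A := by rw [hA']; exact hs2.le
    have hW0 : 0 < W := by omega
    have hqW : n ≤ 2 * (q * W) := by
      have h8 : 1 * W ≤ q * W := Nat.mul_le_mul_right _ (by omega)
      rw [add_mul] at h5
      omega
    have hLq : L * 2 ≤ L * q := Nat.mul_le_mul_left _ hq
    have e1 : W ≤ 320000 * (L * q) := by
      refine Nat.le_of_mul_le_mul_right ?_ hW0
      have : n * l ≤ 2 * (q * W) * L := Nat.mul_le_mul hqW (by omega)
      calc W * W = 40000 * (A * A) := by rw [hWA]; ring
        _ ≤ 160000 * (n * l) := by omega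
        _ ≤ 160000 * (2 * (q * W) * L) := by omega
        _ = _ := by ring
    have e2 : L * q ≤ W := by
      refine Nat.le_of_mul_le_mul_right ?_ hW0
      have h7 : L ≤ 27 * l := by omega
      calc L * q * W = L * (q * W) := by ring
        _ ≤ 27 * l * n := Nat.mul_le_mul h7 (by omega)
        _ = 27 * (n * l) := by ring
        _ ≤ 40000 * (A * A) := by omega
        _ = W * W := by rw [hWA]; ring
    have e3 := hw' (by omega)
    have e4 : 2 * L * (q + 1) = 2 * (L * q) + 2 * L := by ring
    have e5 : 2 * L * q = 2 * (L * q) := by ring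
    constructor <;> norm_num <;> omega

theorem Sizes.q_zero (S : Sizes n A W L q w h) (hA : n < A) : q = 0 := by
  have h1 := S.n_ge; have h2 := S.W_eq; have h3 := S.q_eq
  rw [h3]
  exact Nat.div_eq_of_lt (by omega)

/-- With `a = min A n` the width is `O(a)`, because `log n ≤ a`, and the height is `O(log n * (q +
1))`. The area bound follows from `a * (q + 1) ≤ 2 * n`. If `n < A`, there is one row and `q = 0`.
-/
theorem Sizes.bounds (S : Sizes n A W L q w h) (hA : Real.log n ≤ A) :
    (w : ℝ) ≤ 10 ^ 6 * (A + Real.log n) ∧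
    (h : ℝ) ≤ 10 ^ 6 * (⌈(n : ℝ) / A⌉₊ * Real.log n) ∧
    ((w * h : ℕ) : ℝ) ≤ 10 ^ 6 * (n * Real.log n) ∧
    ((3 * n + 2 * (q * L) : ℕ) : ℝ) ≤ 7 / 2 * n := by
  have hn := S.n_ge
  have hn' : (2 : ℝ) ≤ n := by exact_mod_cast hn
  have hL : (L : ℝ) ≤ 39 * Real.log n := by
    have := log_two_mul_le hn
    rw [S.L_eq]; push_cast; exact this
  have hlog : 1 / 2 ≤ Real.log n := by
    have h2 : Real.log 2 ≤ Real.log n := Real.log_le_log (by norm_num) hn'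
    have h3 := Real.log_two_gt_d9
    norm_num at h3
    linarith
  have hlogn : Real.log n ≤ n := (Real.log_le_sub_one_of_pos (by linarith)).trans (by linarith)
  have hA0 : (0 : ℝ) < A := by linarith
  set ℓ := Real.log n
  obtain ⟨a, ha⟩ : ∃ a, a = min A n := ⟨_, rfl⟩
  have haℓ : ℓ ≤ a := by
    rw [ha, Nat.cast_min]; exact le_min hA hlogn
  have haA : (a : ℝ) ≤ A := by rw [ha]; exact_mod_cast min_le_left _ _
  have han : (a : ℝ) ≤ n := by rw [ha]; exact_mod_cast min_le_right _ _
  have hW : (W : ℝ) = 200 * a := by rw [S.W_eq, ← ha]; push_cast; ring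
  have hqW : (q : ℝ) * W ≤ n := by
    have := S.qW.1
    exact_mod_cast this.trans (Nat.sub_le _ _)
  have hw : (w : ℝ) ≤ 3 * W + L + 1 := by exact_mod_cast S.w_le
  have hh : (h : ℝ) ≤ 2 * L * (q + 1) + 1 := by exact_mod_cast S.h_le
  have hq0 : (0 : ℝ) ≤ q := by positivity
  have hh' : (h : ℝ) ≤ 80 * (ℓ * (q + 1)) := by
    have e1 : (L : ℝ) * (q + 1) ≤ 39 * ℓ * (q + 1) := mul_le_mul_of_nonneg_right hL (by linarith)
    have e2 : 0 ≤ ℓ * q := mul_nonneg (by linarith) hq0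
    nlinarith
  have hw' : (w : ℝ) ≤ 641 * a := by linarith
  refine ⟨by linarith, ?_, ?_, ?_⟩
  · have h1 : (1 : ℝ) ≤ ⌈(n : ℝ) / A⌉₊ := by
      exact_mod_cast Nat.one_le_iff_ne_zero.2 (Nat.ceil_pos.2 (by positivity)).ne'
    have h2 : (q : ℝ) ≤ ⌈(n : ℝ) / A⌉₊ := by
      rcases Nat.lt_or_ge n A with hlt | hge
      · rw [S.q_zero hlt, Nat.cast_zero]; linarith
      · refine le_trans ?_ (Nat.le_ceil _)
        rw [le_div_iff₀ hA0]
        have : (a : ℝ) = A := by rw [ha, min_eq_left hge]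
        rw [hW, this] at hqW
        nlinarith [mul_nonneg hq0 hA0.le]
    have h3 : ℓ * (q + 1) ≤ ℓ * (2 * ⌈(n : ℝ) / A⌉₊) :=
      mul_le_mul_of_nonneg_left (by linarith) (by linarith)
    have h4 : 0 ≤ (⌈(n : ℝ) / A⌉₊ : ℝ) * ℓ := mul_nonneg (by linarith) (by linarith)
    linarith
  · push_cast
    have h1 : (a : ℝ) * (q + 1) ≤ 2 * n := by
      rw [hW] at hqW
      nlinarith [mul_nonneg hq0 (show (0 : ℝ) ≤ a by linarith)]
    have h2 : (w : ℝ) * h ≤ 641 * a * (80 * (ℓ * (q + 1))) :=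
      mul_le_mul hw' hh' (by positivity) (by linarith)
    have h3 : 641 * a * (80 * (ℓ * (q + 1))) = 51280 * (ℓ * (a * (q + 1))) := by ring
    have h4 : ℓ * (a * (q + 1)) ≤ ℓ * (2 * n) := mul_le_mul_of_nonneg_left h1 (by linarith)
    have h5 : 0 ≤ (n : ℝ) * ℓ := mul_nonneg (by linarith) (by linarith)
    linarith
  · push_cast
    rcases Nat.lt_or_ge n A with hlt | hge
    · rw [S.q_zero hlt]
      simp only [Nat.cast_zero, zero_mul, mul_zero, add_zero]
      linarith
    -- Since `4 * 39 ≤ 200`. Hence `2 * q * L ≤ q * W / 2 ≤ n / 2`, the half bend per vertex in the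
    -- bound.
    · have h1 : 4 * (L : ℝ) ≤ W := by linarith
      have h2 : (q : ℝ) * (4 * L) ≤ q * W := mul_le_mul_of_nonneg_left h1 hq0
      linarith

end Bounds

/-! ### Conclusion -/

/-- The drawing computed by the program. -/
theorem exists_drawing (T : SPTree) (h3 : T.graph.DegreeThree) {A : ℕ} (hA : 0 < A) :
    ∃ (D : Drawing T.graph) (W L q : ℕ), D.IsKnuthian ∧
      (∀ C, 13 ≤ C → 5 * (passesCost passes + 20) ≤ C →
        Computes prog T A D (C * T.numNodes) ((T.numNodes + A) ^ C)) ∧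
      Sizes T.numNodes A W L q D.width D.height ∧
      D.totalBends ≤ 3 * T.numNodes + 2 * (q * L) := by
  have hn : 2 ≤ T.numNodes := Nat.le_add_left 2 _
  have hW : 0 < 200 * min A T.numNodes := by omega
  have H := result_final T A
  have M := H.matches h3 rfl hW
  have hnn : T.graph.n = T.numNodes := rfl
  set Λ := T.layout h3 H.placed (200 * min A T.numNodes) hW with hΛ
  have hpos : ∀ v, Λ.pos v ≤ T.numNodes - 1 := fun v => Nat.le_sub_one_of_lt (M.pos_lt v)
  have hΛW : Λ.W = 200 * min A T.numNodes := rfl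
  have hΛL : Λ.L = 9 * (Nat.log 2 T.numNodes + 2) := by
    show 3 * (3 * (Nat.log 2 T.numNodes + 2)) = _
    ring
  obtain ⟨v, hv⟩ := exists_pos Λ M.pos_lt (k := 0) (by omega)
  obtain ⟨u, hu⟩ := exists_pos Λ M.pos_lt (k := T.numNodes - 1) (by omega)
  refine ⟨Λ.drawing, Λ.W, Λ.L, (T.numNodes - 1) / Λ.W, Λ.isKnuthian, fun C h13 hC => ?_,
    ⟨hn, hA, hΛW, hΛL, rfl, Λ.width_le hpos, Λ.height_le hpos, fun hle => ?_, ?_,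
      Nat.succ_pos _, Nat.succ_pos _⟩, ?_⟩
  · have hm := MDigraph.two_mul_m_le h3
    have hQ : (env T A).Q = 2 * T.graph.m + 2 := by
      have h1 := T.code_length; have h2 := graph_m T; have h3 : (env T A).Q = T.code.length + 3 := rfl
      omega
    have hQn : (env T A).Q ≤ 4 * T.numNodes := by omega
    obtain ⟨c, t, h, ht⟩ := exec_prog T A (B := (((T.numNodes + A) ^ C : ℕ) : ℤ)) (by
      have hM : (env T A).M = ((10000 * ((env T A).Q * (env T A).Q) : ℕ) : ℤ) := by
        push_cast; exact H.hM
      rw [hM]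
      have h1 : (env T A).Q * (env T A).Q ≤ 4 * T.numNodes * (4 * T.numNodes) :=
        Nat.mul_le_mul hQn hQn
      have h2 : (T.numNodes + A) ^ 13 ≤ (T.numNodes + A) ^ C :=
        Nat.pow_le_pow_right (by omega) h13
      -- The bound of the guards is at most `160000 * n ^ 2`. As `160000 < 3 ^ 11` and `n + A ≥ 3`,
      -- the exponent `11 + 2` suffices.
      have h3 : 3 ^ 11 * T.numNodes ^ 2 ≤ (T.numNodes + A) ^ 11 * (T.numNodes + A) ^ 2 :=
        Nat.mul_le_mul (Nat.pow_le_pow_left (by omega) _) (Nat.pow_le_pow_left (by omega) _)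
      rw [← pow_add] at h3
      have h4 : 4 * T.numNodes * (4 * T.numNodes) = 16 * T.numNodes ^ 2 := by ring
      norm_num at h3
      exact_mod_cast (show 10000 * ((env T A).Q * (env T A).Q) ≤ (T.numNodes + A) ^ C by omega))
    refine ⟨_, t, h, ht.trans ?_, M.encodes _⟩
    calc (passesCost passes + 20) * ((env T A).Q + 1)
        ≤ (passesCost passes + 20) * (5 * T.numNodes) := Nat.mul_le_mul_left _ (by omega)
      _ = 5 * (passesCost passes + 20) * T.numNodes := by ring
      _ ≤ C * T.numNodes := Nat.mul_le_mul_right _ hC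
  · obtain ⟨x, hx⟩ := exists_pos Λ M.pos_lt (k := Λ.W - 1) (by omega)
    exact Λ.le_width_of hv hx
  · exact Λ.le_height_of hv hu
  · have h1 := Λ.totalBends_le
    have h2 := Λ.sum_wrap_le _ hpos
    omega

end Draw
end Knuthian

theorem theorem2 :
    ∃ (P : Knuthian.Prog) (C : ℕ) (β : ℕ → ℝ) (A₀ : ℕ → ℕ),
      Asymptotics.IsLittleO Filter.atTop β (fun n : ℕ => (n : ℝ)) ∧
      (∀ n : ℕ, 2 ≤ n → Real.log n ≤ A₀ n) ∧
      ∀ (T : Knuthian.SPTree) (n : ℕ), n = T.numNodes → T.graph.DegreeThree →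
        ∀ A : ℕ, Real.log n ≤ A →
          ∃ D : Knuthian.Drawing T.graph,
            D.IsKnuthian ∧
            Knuthian.Computes P T A D (C * n) ((n + A) ^ C) ∧
            (D.width : ℝ) ≤ C * (A + Real.log n) ∧
            (D.height : ℝ) ≤ C * (⌈(n : ℝ) / A⌉₊ * Real.log n) ∧
            (D.area : ℝ) ≤ C * (n * Real.log n) ∧
            (D.totalBends : ℝ) ≤ 7 / 2 * n + β n ∧
            (A = A₀ n → D.width ≤ C * D.height ∧ D.height ≤ C * D.width) := by
  -- One constant for everything: the aspect ratio requires `10 ^ 13`, the running time the second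
  -- bound, and the other requirements are weaker.
  obtain ⟨C, hC, hC'⟩ : ∃ C, 10 ^ 13 ≤ C ∧
      5 * (Knuthian.passesCost Knuthian.Draw.passes + 20) ≤ C :=
    ⟨_, le_max_left _ _, le_max_right _ _⟩
  -- The bound on the bends holds without an error term, so `β = 0`.
  refine ⟨Knuthian.Draw.prog, C, fun _ => 0, Knuthian.Draw.balanced,
    Asymptotics.isLittleO_zero _ _, fun n hn => Knuthian.Draw.log_le_balanced (by omega), ?_⟩
  rintro T n rfl h3 A hA
  have hn : 2 ≤ T.numNodes := Nat.le_add_left 2 _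
  have hlog : 0 < Real.log T.numNodes := Real.log_pos (by exact_mod_cast hn)
  have hA0 : 0 < A := by exact_mod_cast hlog.trans_le hA
  obtain ⟨D, W, L, q, hK, hcomp, S, hb⟩ := Knuthian.Draw.exists_drawing T h3 hA0
  obtain ⟨h1, h2, h4, h5⟩ := S.bounds hA
  have hCR : (10 ^ 6 : ℝ) ≤ C := by exact_mod_cast (show 10 ^ 6 ≤ 10 ^ 13 by norm_num).trans hC
  refine ⟨D, hK, hcomp C (le_trans (by norm_num) hC) hC', h1.trans ?_, h2.trans ?_, h4.trans ?_, ?_,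
    fun h => ?_⟩
  · exact mul_le_mul_of_nonneg_right hCR (by positivity)
  · exact mul_le_mul_of_nonneg_right hCR (by positivity)
  · exact mul_le_mul_of_nonneg_right hCR (by positivity)
  · rw [add_zero]
    exact le_trans (by exact_mod_cast hb) h5
  · obtain ⟨h6, h7⟩ := S.aspect h
    exact ⟨h6.trans (Nat.mul_le_mul_right _ hC), h7.trans (Nat.mul_le_mul_right _ hC)⟩
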